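/- **Setting.** Let $Y=G(X,\varepsilon)$ with $X\in\mathbb R^p$, $Y,\varepsilon\in\mathbb R$, $\varepsilon$ independent of $X$, $E X=0$, $E\|X\|^2<\infty$, $EY^2<\infty$, and let $X$ have a Lebesgue density $f$. Let $(x_j,y_j)_{j\ge1}$ be i.i.d. copies of $(X,Y)$. Let $\Theta\subset\mathbb R^d$ be compact and convex, and let $g(x,\theta)$ be Borel measurable in $x$ and twice continuously differentiable in $\theta$ (near each point of $\Theta$), with $\dot g=\partial g/\partial\theta$ and $\ddot g=\partial^2 g/\partial\theta\partial\theta^\top$. Assume that $$E\sup_{\theta\in\Theta} g^2(X,\theta),\quad E\sup_{\theta\in\Theta}\|\dot g\dot g^\top(X,\theta)\|,\quad E\sup_{\theta\in\Theta}(Y-g(X,\theta))^2\|\dot g\dot g^\top(X,\theta)\|,$$ $$E\sup_{\theta\in\Theta}(Y-g(X,\theta))^2\|\ddot g(X,\theta)\|,\quad E\Big[\sup_{\theta\in\Theta}(Y-g(X,\theta))^2\,f(X)\Big]$$ are finite (the last follows from the first and $EY^2<\infty$ if $f$ is bounded); that $\theta\mapsto E(Y-g(X,\theta))^2$ has a unique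 minimizer $\theta^*$ over $\Theta$; and that $E(\dot g\dot g^\top)$ is nonsingular, where here and below $\dot g=\dot g(X,\theta^*)$. Let $w$ be a measurable weight with $E\,w(X)^2<\infty$ (for example $w(x)=c\,e^{-\|x\|}$, $c>0$). Put $\Delta=\eta=Y-g(X,\theta^*)$ and $$\Sigma_{01}=E(\Delta^2)\big[E(w^2)-E(\dot g w)^\top E(\dot g\dot g^\top)^{-1}E(\dot g w)\big],\qquad \mu=\frac{E\{[E(\Delta\mid X)]^2 f(X)\}}{\Sigma_{01}},$$ and assume $\Sigma_{01}\ne0$. A subspace $\mathrm{span}(B)$ is a dimension reduction subspace if $\eta$ and $X$ are conditionally independent given $B^\top X$; let $S$ be the intersection of all of them. Assume that $S$ is itself a dimension reduction subspace; that $E(X\mid B^\top X)=\Sigma B(B^\top\Sigma B)^{-1}B^\top X$ for every basis matrix $B$ of $S$, where $\Sigma=\mathrm{Var}(X)$; and that the matrix $M=\int E[Xe^{it\eta}]\,E[Xe^{it\eta}]^H\,dF_\eta(t)$ has rank $\dim S$, where $F_\eta$ is the law of $\eta$. **Test statistic.** Let $K:\mathbb R^p\to\mathbb R$ be symmetric,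 nonnegative, continuous and bounded with $\int K=1$. As $n\to\infty$, let the bandwidth $h=h_n>0$ satisfy $h\to0$ and $nh^p\to\infty$, and let the ridges $c_{1n},c_{2n}>0$ satisfy $c_{1n}\to0$, $c_{2n}\to0$, $nc_{1n}c_{2n}\to\infty$. Fix $0<\tau<1$. Let $\hat\theta_n$ be a (measurable) minimizer over $\Theta$ of $\sum_{j\le n}(y_j-g(x_j,\theta))^2$, and put $\hat\eta_j=y_j-g(x_j,\hat\theta_n)$, $$V_0=\frac1n\sum_{j\le n}\hat\eta_jw(x_j),\qquad V_1=\frac1{n(n-1)}\sum_{j\ne k}\hat\eta_j\hat\eta_k\frac1{h^p}K\Big(\frac{x_j-x_k}h\Big).$$ Let $\hat m_n(t)=\frac1n\sum_{j\le n} x_je^{it\hat\eta_j}$ and $\hat M_n=\frac1n\sum_{j\le n}\hat m_n(\hat\eta_j)\hat m_n(\hat\eta_j)^H$, let $\hat\lambda_1\ge\dots\ge\hat\lambda_p$ be the eigenvalues of $\hat M_n$, and put $\hat\lambda_{p+1}=\hat\lambda_{p+2}=0$, $$\hat s_j=\frac{\hat\lambda_j}{\hat\lambda_j+1},\qquad \hat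 s_j^*=\frac{\hat s_j^2+c_{1n}}{\hat s_{j+1}^2+c_{1n}}-1,\qquad \hat r_j=\frac{\hat s_{j+1}^*+c_{2n}}{\hat s_j^*+c_{2n}}.$$ Let $\hat q$ be the largest $j\in\{1,\dots,p\}$ with $\hat r_j\le\tau$, and $\hat q=0$ if there is none. Finally put $$V_n=\big|V_0^2\,I(\hat q=0)+V_1\,I(\hat q>0)\big|,\qquad T_n=\frac{nV_n}{\hat\sigma_0^2},$$ where $\hat\sigma_0^2$ is the empirical version of $\Sigma_{01}$: the sample means of $\hat\eta_j^2$, $w(x_j)^2$, $\dot g(x_j,\hat\theta_n)w(x_j)$ and $\dot g(x_j,\hat\theta_n)\dot g(x_j,\hat\theta_n)^\top$ replace the corresponding expectations. **Theorem.** Assume the alternative $H_1$: for no $\theta\in\Theta$ is $Y-g(X,\theta)$ independent of $X$, and for no $\theta\in\Theta$ is $E(Y\mid X)=g(X,\theta)$ almost surely. Then $\mu>0$, and $$T_n/n\to\mu\quad\text{in probability as } n\to\infty .$$ -/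

import Mathlib

open MeasureTheory ProbabilityTheory Filter Topology
open scoped ENNReal

noncomputable section

namespace HybridTest

/-- The Euclidean space of column vectors of length `k`, with the Euclidean norm. -/
abbrev Vec (k : ℕ) := EuclideanSpace ℝ (Fin k)

section Sample

variable {p d : ℕ}

/-- `θ` is a least squares estimate: it minimizes over `Θ` the residual sum of squares of the
first `n` observations `(x 0, y 0), …, (x (n - 1), y (n - 1))`. -/
def IsLeastSquares (g : Vec p → Vec d → ℝ) (Θ : Set (Vec d)) (x : ℕ → Vec p) (y : ℕ → ℝ)
    (n : ℕ) (θ : Vec d) : Prop :=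
  θ ∈ Θ ∧ ∀ θ' ∈ Θ,
    ∑ j ∈ Finset.range n, (y j - g (x j) θ) ^ 2 ≤ ∑ j ∈ Finset.range n, (y j - g (x j) θ') ^ 2

/-- The residuals `y_j - g(x_j, θ)`. -/
def resid (g : Vec p → Vec d → ℝ) (x : ℕ → Vec p) (y : ℕ → ℝ) (θ : Vec d) (j : ℕ) : ℝ :=
  y j - g (x j) θ

/-- The moment component: the mean of the residuals `r j`, weighted by `w`. -/
def V0 (w : Vec p → ℝ) (x : ℕ → Vec p) (r : ℕ → ℝ) (n : ℕ) : ℝ :=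
  (1 / (n : ℝ)) * ∑ j ∈ Finset.range n, r j * w (x j)

/-- The kernel-based conditional moment component with kernel `K` and bandwidth `h`. -/
def V1 (K : Vec p → ℝ) (h : ℝ) (x : ℕ → Vec p) (r : ℕ → ℝ) (n : ℕ) : ℝ :=
  (1 / ((n : ℝ) * ((n : ℝ) - 1))) *
    ∑ j ∈ Finset.range n, ∑ k ∈ (Finset.range n).erase j,
      r j * r k * ((1 / h ^ p) * K (h⁻¹ • (x j - x k)))

/-- The empirical Gram matrix of the gradients of `g` in the parameter. -/
def gramHat (g : Vec p → Vec d → ℝ) (x : ℕ → Vec p) (θ : Vec d) (n : ℕ) :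
    Matrix (Fin d) (Fin d) ℝ :=
  Matrix.of fun a b =>
    (1 / (n : ℝ)) * ∑ j ∈ Finset.range n, gradient (g (x j)) θ a * gradient (g (x j)) θ b

/-- The empirical cross moment of the gradient of `g` in the parameter and the weight. -/
def crossHat (g : Vec p → Vec d → ℝ) (w : Vec p → ℝ) (x : ℕ → Vec p) (θ : Vec d) (n : ℕ) :
    Fin d → ℝ :=
  fun a => (1 / (n : ℝ)) * ∑ j ∈ Finset.range n, gradient (g (x j)) θ a * w (x j)

/-- The standardizing variance estimator. -/
def sigmaHatSq (g : Vec p → Vec d → ℝ) (w : Vec p → ℝ) (x : ℕ → Vec p) (y : ℕ → ℝ)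
    (θ : Vec d) (n : ℕ) : ℝ :=
  ((1 / (n : ℝ)) * ∑ j ∈ Finset.range n, resid g x y θ j ^ 2) *
    ((1 / (n : ℝ)) * ∑ j ∈ Finset.range n, w (x j) ^ 2 -
      crossHat g w x θ n ⬝ᵥ Matrix.mulVec (gramHat g x θ n)⁻¹ (crossHat g w x θ n))

/-- The empirical version of `t ↦ E(X exp(i t η))`. -/
def mHat (x : ℕ → Vec p) (r : ℕ → ℝ) (n : ℕ) (t : ℝ) : Fin p → ℂ :=
  fun a => (1 / (n : ℂ)) * ∑ j ∈ Finset.range n,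
    ((x j a : ℝ) : ℂ) * Complex.exp (Complex.I * t * (r j : ℂ))

/-- The empirical target matrix. -/
def targetHat (x : ℕ → Vec p) (r : ℕ → ℝ) (n : ℕ) : Matrix (Fin p) (Fin p) ℂ :=
  ((1 / (n : ℝ) : ℝ) : ℂ) • ∑ j ∈ Finset.range n,
    Matrix.vecMulVec (mHat x r n (r j)) (star (mHat x r n (r j)))

theorem targetHat_isHermitian (x : ℕ → Vec p) (r : ℕ → ℝ) (n : ℕ) :
    (targetHat x r n).IsHermitian := by
  ext a b
  simp [targetHat, Matrix.sum_apply, Matrix.vecMulVec_apply, mul_comm]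

/-- The `j`-th largest eigenvalue (`j = 1, …, p`, with multiplicity) of a Hermitian matrix, and
`0` for every other index. -/
def sortedEigenvalue {A : Matrix (Fin p) (Fin p) ℂ} (hA : A.IsHermitian) (j : ℕ) : ℝ :=
  if hj : 1 ≤ j ∧ j ≤ p then
    hA.eigenvalues₀ ⟨j - 1, by rw [Fintype.card_fin]; omega⟩
  else 0

/-- The quantities `λ / (λ + 1)`. -/
def sHat (lam : ℕ → ℝ) (j : ℕ) : ℝ := lam j / (lam j + 1)

/-- The first ridge ratio. -/
def sStar (lam : ℕ → ℝ) (c₁ : ℝ) (j : ℕ) : ℝ :=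
  (sHat lam j ^ 2 + c₁) / (sHat lam (j + 1) ^ 2 + c₁) - 1

/-- The second ridge ratio. -/
def rHat (lam : ℕ → ℝ) (c₁ c₂ : ℝ) (j : ℕ) : ℝ :=
  (sStar lam c₁ (j + 1) + c₂) / (sStar lam c₁ j + c₂)

/-- The thresholding double ridge ratio estimate of the indicative dimension: the largest
`j ∈ {1, …, p}` whose second ratio is at most `τ`, and `0` if there is none. -/
def qHat (c₁ c₂ τ : ℝ) (x : ℕ → Vec p) (r : ℕ → ℝ) (n : ℕ) : ℕ :=
  ((Finset.Icc 1 p).filter fun j =>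
    rHat (sortedEigenvalue (targetHat_isHermitian x r n)) c₁ c₂ j ≤ τ).sup id

/-- The hybrid of the two components. -/
def Vn (w K : Vec p → ℝ) (h c₁ c₂ τ : ℝ) (x : ℕ → Vec p) (r : ℕ → ℝ) (n : ℕ) : ℝ :=
  |V0 w x r n ^ 2 * (if qHat c₁ c₂ τ x r n = 0 then 1 else 0) +
    V1 K h x r n * (if 0 < qHat c₁ c₂ τ x r n then 1 else 0)|

/-- The hybrid test statistic of the first `n` observations, with parameter estimate `θ`. -/
def Tn (g : Vec p → Vec d → ℝ) (w K : Vec p → ℝ) (h c₁ c₂ τ : ℝ) (x : ℕ → Vec p) (y : ℕ → ℝ)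
    (θ : Vec d) (n : ℕ) : ℝ :=
  (n : ℝ) * Vn w K h c₁ c₂ τ x (resid g x y θ) n / sigmaHatSq g w x y θ n

end Sample

section Population

variable {p d : ℕ} {Ω : Type*} [MeasurableSpace Ω]

/-- The population residual `Y - g(X, θ)`. -/
def popResid (g : Vec p → Vec d → ℝ) (X : Ω → Vec p) (Y : Ω → ℝ) (θ : Vec d) (ω : Ω) : ℝ :=
  Y ω - g (X ω) θ

/-- The conditional expectation of `Z` given (the sigma-algebra generated by) `X`. -/
def condMean (P : Measure Ω) {E : Type*} [MeasurableSpace E] (X : Ω → E) (Z : Ω → ℝ) : Ω → ℝ :=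
  P[Z | MeasurableSpace.comap X inferInstance]

/-- The Gram matrix of the gradient of `g(X, ·)` at `θ`. -/
def gram (P : Measure Ω) (g : Vec p → Vec d → ℝ) (X : Ω → Vec p) (θ : Vec d) :
    Matrix (Fin d) (Fin d) ℝ :=
  Matrix.of fun a b => ∫ ω, gradient (g (X ω)) θ a * gradient (g (X ω)) θ b ∂P

/-- The cross moment of the gradient of `g(X, ·)` at `θ` and the weight `w(X)`. -/
def cross (P : Measure Ω) (g : Vec p → Vec d → ℝ) (w : Vec p → ℝ) (X : Ω → Vec p)
    (θ : Vec d) : Fin d → ℝ :=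
  fun a => ∫ ω, gradient (g (X ω)) θ a * w (X ω) ∂P

/-- The limit of the standardizing variance estimator:
`E(Δ²) [E(w²) - E(ġ w)ᵀ E(ġ ġᵀ)⁻¹ E(ġ w)]` with `Δ = Y - g(X, θ)`. -/
def Sigma01 (P : Measure Ω) (g : Vec p → Vec d → ℝ) (w : Vec p → ℝ) (X : Ω → Vec p)
    (Y : Ω → ℝ) (θ : Vec d) : ℝ :=
  (∫ ω, popResid g X Y θ ω ^ 2 ∂P) *
    ((∫ ω, w (X ω) ^ 2 ∂P) -
      cross P g w X θ ⬝ᵥ Matrix.mulVec (gram P g X θ)⁻¹ (cross P g w X θ))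

/-- `E[(E(Δ | X))² f(X)] / Σ₀₁` with `Δ = Y - g(X, θ)`. -/
def muLimit (P : Measure Ω) (g : Vec p → Vec d → ℝ) (w f : Vec p → ℝ) (X : Ω → Vec p)
    (Y : Ω → ℝ) (θ : Vec d) : ℝ :=
  (∫ ω, condMean P X (popResid g X Y θ) ω ^ 2 * f (X ω) ∂P) / Sigma01 P g w X Y θ

/-- The target matrix `∫ E[X exp(i t η)] E[X exp(i t η)]ᴴ dF_η(t)`, with `F_η` the law
of `η`. -/
def targetMatrix (P : Measure Ω) (X : Ω → Vec p) (η : Ω → ℝ) : Matrix (Fin p) (Fin p) ℂ :=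
  let m : ℝ → Fin p → ℂ := fun t a =>
    ∫ ω, ((X ω a : ℝ) : ℂ) * Complex.exp (Complex.I * t * (η ω : ℂ)) ∂P
  Matrix.of fun a b => ∫ t, m t a * star (m t b) ∂(P.map η)

/-- `S` is a sufficient dimension reduction subspace for a pair `(Z₁, Z₂)` with joint law `ρ`:
`Z₂` and `Z₁` are conditionally independent given the orthogonal projection of `Z₁` to `S`.
If the columns of `B` span `S`, this projection and `Bᵀ Z₁` generate the same sigma-algebra. -/
def IsDimensionReduction (ρ : Measure (Vec p × ℝ)) [IsFiniteMeasure ρ]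
    (S : Submodule ℝ (Vec p)) : Prop :=
  CondIndepFun (MeasurableSpace.comap (fun z : Vec p × ℝ => S.starProjection z.1) inferInstance)
    ((S.starProjection.continuous.measurable.comp measurable_fst).comap_le)
    (Prod.snd : Vec p × ℝ → ℝ) (Prod.fst : Vec p × ℝ → Vec p) ρ

/-- The intersection of all sufficient dimension reduction subspaces. -/
def centralSubspace (ρ : Measure (Vec p × ℝ)) [IsFiniteMeasure ρ] : Submodule ℝ (Vec p) :=
  sInf {S | IsDimensionReduction ρ S}

/-- The covariance matrix of `X`. -/
def covMatrix (P : Measure Ω) (X : Ω → Vec p) : Matrix (Fin p) (Fin p) ℝ :=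
  Matrix.of fun a b => covariance (fun ω => X ω a) (fun ω => X ω b) P

/-- The linearity condition `E(X | Bᵀ X) = P_B(Σ)ᵀ X`, `P_B(Σ) = B (Bᵀ Σ B)⁻¹ Bᵀ Σ`, for every
matrix `B` whose columns are a basis of `S`. -/
def LinearityCondition (P : Measure Ω) (X : Ω → Vec p) (S : Submodule ℝ (Vec p)) : Prop :=
  ∀ (k : ℕ) (B : Matrix (Fin p) (Fin k) ℝ),
    LinearIndependent ℝ (fun j => WithLp.toLp 2 (fun i => B i j) : Fin k → Vec p) →
    Submodule.span ℝ (Set.range (fun j => WithLp.toLp 2 (fun i => B i j) : Fin k → Vec p)) = S →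
    ∀ a : Fin p,
      condMean P (fun ω => Matrix.mulVec B.transpose (X ω).ofLp) (fun ω => X ω a) =ᵐ[P]
        fun ω => Matrix.mulVec
          (B * (B.transpose * covMatrix P X * B)⁻¹ * B.transpose * covMatrix P X).transpose
          (X ω).ofLp a

end Population

end HybridTest

end

/-!
Under the alternative the estimated dimension is positive with probability tending to one, so the
statistic divided by `n` is eventually `|V1| / sigmaHatSq`, and both parts converge in probability.

Convergence in probability is treated as convergence along the filter `probFilter P` on `ℕ × Ω`
of events whose complements have outer probability tending to zero; limits of sums, products,
quotients and compositions are then instances of the calculus of filters, and the measurability of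
the statistics plays no role. The law of large numbers is used in the form
`tendsto_average_nhdsWithin`: for a dominated family `F(z, t)` continuous in `t`, sample means at
`t` converge as `n → ∞` and `t → t₀` jointly. It gives the consistency of least squares
(`tendsto_leastSquares`), of the standardizing variance (`tendsto_sigmaHatSq`), and a neighbourhood
on which the empirical version of `m(t) = E[X exp(i t η)]` stays away from zero.

*The dimension.* If every second ridge ratio exceeded the threshold `τ`, these ratios would
telescope, starting from the vanishing eigenvalues of index `p + 1` and `p + 2`, to
`ŝ₁² ≤ (1 + c₂ / τ ^ p) ^ p * c₁ → 0` (`sHat_one_sq_le_of_forall_lt_rHat`). Hence a lower bound of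
the leading eigenvalue is enough for a positive estimate, and no rate of convergence of the other
eigenvalues is needed. Such a bound holds as soon as `m` does not vanish almost everywhere under
the law of `η`. If it did vanish, the target matrix would be zero, by the rank condition the
central subspace would be trivial, and `η` would be independent of `X`, which the alternative
excludes (`exists_not_ae_charMoment_eq_zero`).

*The kernel estimator.* For a response that is bounded and vanishes where the density is large,
the mean over pairs is close in mean square to the sample mean of its projection, with an error of
order `1 / (n h ^ p)`, and the projection converges because convolution with the rescaled kernel
approximates the identity in `L¹` (`tendsto_V1_of_bounded`). The passage from these truncated
responses at `θs` to the residuals at the estimate rests on the inequality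
`E[e(Z) s(Z') K_h(X - X')] ≤ (E[e(Z)² f(X)])^(1/2) (E[s(Z)² f(X)])^(1/2)`
(`lintegral_lintegral_kernel_le`), which is uniform in the bandwidth: with `s` the supremum of the
absolute residuals over the parameter space and `e` the truncation error plus the oscillation of
`g` near `θs`, the right-hand side is small by dominated convergence (`tendsto_V1`).

*Positivity.* The density is positive almost surely at `X`, and `E(η | X)` is not almost surely
zero, so the numerator of the limit is positive; `Sigma01` is nonnegative, being a product of mean
squares, and does not vanish by assumption.
-/

namespace HybridTest

/-! ### Convergence in probability as convergence along a filter -/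

section InProbability

variable {Ω : Type*} [MeasurableSpace Ω]

/-- The filter of events of outer probability tending to one: a set of pairs `(n, ω)` belongs to
it if the outer measure of its complement at stage `n` tends to `0`. Convergence in probability
to a constant is convergence along this filter, and no measurability is involved. -/
def probFilter (P : Measure Ω) : Filter (ℕ × Ω) where
  sets := {S | Tendsto (fun n => P {ω | (n, ω) ∉ S}) atTop (𝓝 0)}
  univ_sets := by simp
  sets_of_superset {S T} hS hST :=
    tendsto_of_tendsto_of_tendsto_of_le_of_le tendsto_const_nhds hS (fun _ => zero_le)
      fun n => measure_mono fun ω hω h => hω (hST h)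
  inter_sets {S T} hS hT := by
    have h : Tendsto (fun n => P {ω | (n, ω) ∉ S} + P {ω | (n, ω) ∉ T}) atTop (𝓝 0) := by
      simpa using Tendsto.add hS hT
    refine tendsto_of_tendsto_of_tendsto_of_le_of_le tendsto_const_nhds h (fun _ => zero_le)
      fun n => (measure_mono ?_).trans (measure_union_le _ _)
    intro ω hω
    by_cases h1 : (n, ω) ∈ S
    · exact Or.inr fun h2 => hω ⟨h1, h2⟩
    · exact Or.inl h1

variable {P : Measure Ω}

theorem eventually_probFilter {p : ℕ × Ω → Prop} :
    (∀ᶠ a in probFilter P, p a) ↔ Tendsto (fun n => P {ω | ¬ p (n, ω)}) atTop (𝓝 0) :=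
  Iff.rfl

theorem tendstoInMeasure_const_iff {E : Type*} [PseudoEMetricSpace E] {f : ℕ → Ω → E} {c : E} :
    TendstoInMeasure P f atTop (fun _ => c) ↔
      Tendsto (fun a : ℕ × Ω => f a.1 a.2) (probFilter P) (𝓝 c) := by
  rw [EMetric.tendsto_nhds]
  simp only [TendstoInMeasure, eventually_probFilter, not_lt]

theorem eventually_probFilter_of_ae {p : ℕ × Ω → Prop} (h : ∀ n, ∀ᵐ ω ∂P, p (n, ω)) :
    ∀ᶠ a in probFilter P, p a := by
  rw [eventually_probFilter]
  have : ∀ n, P {ω | ¬ p (n, ω)} = 0 := fun n => h n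
  simp [this]

theorem tendsto_fst_probFilter : Tendsto Prod.fst (probFilter P) atTop := by
  intro s hs
  obtain ⟨N, hN⟩ := mem_atTop_sets.1 hs
  refine tendsto_const_nhds.congr' ?_
  filter_upwards [eventually_ge_atTop N] with n hn
  simp [hN n hn]

/-- A sequence converges in probability to `c` if, up to an event of arbitrarily small limiting
probability and an arbitrarily small error, it is approximated by sequences that converge in
probability to limits arbitrarily close to `c`. -/
theorem tendsto_probFilter_of_approx {V : ℕ × Ω → ℝ} {c : ℝ}
    (h : ∀ ε : ℝ, 0 < ε → ∀ κ : ℝ≥0∞, 0 < κ → ∃ (W : ℕ × Ω → ℝ) (c' : ℝ),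
      Tendsto W (probFilter P) (𝓝 c') ∧ |c' - c| < ε ∧
      ∀ᶠ n in atTop, P {ω | ε ≤ |V (n, ω) - W (n, ω)|} ≤ κ) :
    Tendsto V (probFilter P) (𝓝 c) := by
  rw [Metric.tendsto_nhds]
  intro ε hε
  rw [eventually_probFilter, ENNReal.tendsto_nhds_zero]
  intro κ hκ
  have hκ2 : 0 < κ / 2 := ENNReal.half_pos hκ.ne'
  obtain ⟨W, c', hW, hc, hVW⟩ := h (ε / 3) (by positivity) (κ / 2) hκ2
  have hW' := ENNReal.tendsto_nhds_zero.1
    (eventually_probFilter.1 (Metric.tendsto_nhds.1 hW (ε / 3) (by positivity))) _ hκ2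
  filter_upwards [hVW, hW'] with n h1 h2
  refine le_trans ?_ ((measure_union_le _ _).trans ((add_le_add h1 h2).trans_eq
    (ENNReal.add_halves κ)))
  refine measure_mono fun ω hω => ?_
  by_contra hcon
  simp only [Set.mem_union, Set.mem_ofPred_eq, not_or, not_not, not_le, Real.dist_eq] at hcon hω
  apply hω
  calc |V (n, ω) - c| = |(V (n, ω) - W (n, ω)) + (W (n, ω) - c') + (c' - c)| := by ring_nf
    _ ≤ _ := abs_add_three _ _ _
    _ < ε := by linarith [hcon.1, hcon.2]

end InProbability

/-! ### Laws of large numbers at a moving parameter and minimum contrast estimators -/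

section UniformLaw

/-- A supremum of a continuous function may be taken over a dense subset. -/
theorem biSup_eq_of_subset_closure {T : Type*} [TopologicalSpace T] {D B : Set T}
    (hDB : D ⊆ B) (hBD : B ⊆ closure D) {φ : T → ℝ≥0∞} (hφ : ContinuousOn φ B) :
    ⨆ t ∈ B, φ t = ⨆ t ∈ D, φ t := by
  apply le_antisymm
  · refine iSup₂_le fun t ht => ?_
    have : (𝓝[D] t).NeBot := mem_closure_iff_nhdsWithin_neBot.1 (hBD ht)
    refine le_of_tendsto ((hφ t ht).mono_left (nhdsWithin_mono t hDB)) ?_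
    filter_upwards [self_mem_nhdsWithin] with s hs
    exact le_iSup₂ (f := fun t (_ : t ∈ D) => φ t) s hs
  · exact iSup₂_le fun t ht => le_iSup₂ (f := fun t (_ : t ∈ B) => φ t) t (hDB ht)

/-- The supremum over a set of a family of measurable functions that depends continuously on the
parameter is measurable. -/
theorem measurable_biSup_of_continuousOn {Z T : Type*} [MeasurableSpace Z] [PseudoMetricSpace T]
    [SecondCountableTopology T] {B : Set T} {φ : Z → T → ℝ≥0∞}
    (hm : ∀ t ∈ B, Measurable fun z => φ z t) (hc : ∀ z, ContinuousOn (φ z) B) :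
    Measurable fun z => ⨆ t ∈ B, φ z t := by
  obtain ⟨D, hDB, hD, hBD⟩ :=
    (TopologicalSpace.IsSeparable.of_separableSpace B).exists_countable_dense_subset
  have : (fun z => ⨆ t ∈ B, φ z t) = fun z => ⨆ t ∈ D, φ z t :=
    funext fun z => biSup_eq_of_subset_closure hDB hBD (hc z)
  rw [this]
  exact Measurable.biSup D hD fun t ht => hm t (hDB ht)

/-- The oscillation over `A ∩ ball t₀ (1 / (m + 1))` of a family continuous on `A` tends to `0`
pointwise. -/
theorem tendsto_biSup_sub {T E : Type*} [PseudoMetricSpace T] [NormedAddCommGroup E] {A : Set T}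
    {t₀ : T} (ht₀ : t₀ ∈ A) {φ : T → E} (hc : ContinuousOn φ A) :
    Tendsto (fun m : ℕ => ⨆ t ∈ A ∩ Metric.ball t₀ (1 / ((m : ℝ) + 1)), ‖φ t - φ t₀‖ₑ)
      atTop (𝓝 0) := by
  rw [ENNReal.tendsto_nhds_zero]
  intro ε hε
  have h1 : Tendsto (fun t => ‖φ t - φ t₀‖ₑ) (𝓝[A] t₀) (𝓝 0) := by
    have : Tendsto (fun t => ‖φ t - φ t₀‖ₑ) (𝓝[A] t₀) (𝓝 ‖φ t₀ - φ t₀‖ₑ) :=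
      ((hc t₀ ht₀).sub tendsto_const_nhds).enorm
    simpa using this
  have h2 := ENNReal.tendsto_nhds_zero.1 h1 ε hε
  obtain ⟨r, hr, hrA⟩ := Metric.mem_nhdsWithin_iff.1 h2
  have h3 := (tendsto_one_div_add_atTop_nhds_zero_nat (𝕜 := ℝ)).eventually_lt_const hr
  filter_upwards [h3] with m hm
  refine iSup₂_le fun t ht => hrA ⟨?_, ht.1⟩
  exact Metric.ball_subset_ball hm.le ht.2

/-- `z` is a sequence of independent observations, each with law `ρ`. -/
structure IsIIDSample {Ω Z : Type*} [MeasurableSpace Ω] [MeasurableSpace Z] (P : Measure Ω)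
    (ρ : Measure Z) (z : ℕ → Ω → Z) : Prop where
  aemeasurable : ∀ j, AEMeasurable (z j) P
  law : ∀ j, P.map (z j) = ρ
  indep : iIndepFun z P

variable {Ω : Type*} [MeasurableSpace Ω] {P : Measure Ω} [IsProbabilityMeasure P]
  {Z : Type*} [MeasurableSpace Z] {ρ : Measure Z} {z : ℕ → Ω → Z}

theorem IsIIDSample.isProbabilityMeasure (hs : IsIIDSample P ρ z) : IsProbabilityMeasure ρ := by
  rw [← hs.law 0]
  exact Measure.isProbabilityMeasure_map (hs.aemeasurable 0)

theorem tendsto_average {E : Type*} [NormedAddCommGroup E] [NormedSpace ℝ E] [CompleteSpace E]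
    [MeasurableSpace E] [BorelSpace E] [SecondCountableTopology E]
    (hs : IsIIDSample P ρ z)
    {φ : Z → E} (hφ : Measurable φ) (hint : Integrable φ ρ) :
    Tendsto (fun a : ℕ × Ω => (a.1 : ℝ)⁻¹ • ∑ j ∈ Finset.range a.1, φ (z j a.2)) (probFilter P)
      (𝓝 (∫ u, φ u ∂ρ)) := by
  rw [← tendstoInMeasure_const_iff
    (f := fun n ω => (n : ℝ)⁻¹ • ∑ j ∈ Finset.range n, φ (z j ω))]
  have hm : ∀ j, AEMeasurable (fun ω => φ (z j ω)) P := fun j =>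
    hφ.comp_aemeasurable (hs.aemeasurable j)
  apply tendstoInMeasure_of_tendsto_ae
  · intro n
    have : AEMeasurable (fun ω => ∑ j ∈ Finset.range n, φ (z j ω)) P :=
      Finset.aemeasurable_fun_sum _ fun j _ => hm j
    exact (this.const_smul _).aestronglyMeasurable
  · have hid : ∀ j, IdentDistrib (z j) (z 0) P P := fun j =>
      ⟨hs.aemeasurable j, hs.aemeasurable 0, by rw [hs.law, hs.law]⟩
    have h0 : ∫ ω, φ (z 0 ω) ∂P = ∫ u, φ u ∂ρ := by
      rw [← hs.law 0, integral_map (hs.aemeasurable 0) hφ.aestronglyMeasurable]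
    rw [← h0]
    refine strong_law_ae (fun j ω => φ (z j ω)) ?_ ?_ ?_
    · rw [← hs.law 0] at hint
      exact hint.comp_aemeasurable (hs.aemeasurable 0)
    · intro i j hij
      exact (hs.indep.indepFun hij).comp hφ hφ
    · intro j
      exact (hid j).comp hφ

/-- **Law of large numbers at a moving parameter.** For a dominated family `F(·, t)`, `t ∈ A`,
that is continuous in `t`, the sample mean of `F(z_j, t)` converges in probability to
`E F(Z, t₀)` as `n → ∞` and, simultaneously, `t → t₀` within `A`. -/
theorem tendsto_average_nhdsWithin {T : Type*} [PseudoMetricSpace T] [SecondCountableTopology T]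
    {E : Type*} [NormedAddCommGroup E] [NormedSpace ℝ E] [CompleteSpace E]
    [MeasurableSpace E] [BorelSpace E] [SecondCountableTopology E]
    (hs : IsIIDSample P ρ z)
    {A : Set T} {t₀ : T} (ht₀ : t₀ ∈ A) {F : Z → T → E}
    (hmeas : ∀ t ∈ A, Measurable fun u => F u t) (hcont : ∀ u, ContinuousOn (F u) A)
    {G : Z → ℝ≥0∞} (hdom : ∀ u, ∀ t ∈ A, ‖F u t‖ₑ ≤ G u) (hG : ∫⁻ u, G u ∂ρ ≠ ∞) :
    Tendsto (fun q : (ℕ × Ω) × T =>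
        (q.1.1 : ℝ)⁻¹ • ∑ j ∈ Finset.range q.1.1, F (z j q.1.2) q.2)
      (probFilter P ×ˢ 𝓝[A] t₀) (𝓝 (∫ u, F u t₀ ∂ρ)) := by
  -- the oscillation of `F` near `t₀`
  let R : ℕ → Z → ℝ≥0∞ := fun m u =>
    ⨆ t ∈ A ∩ Metric.ball t₀ (1 / ((m : ℝ) + 1)), ‖F u t - F u t₀‖ₑ
  have hRm : ∀ m, Measurable (R m) := fun m =>
    measurable_biSup_of_continuousOn
      (fun t ht => ((hmeas t ht.1).sub (hmeas t₀ ht₀)).enorm)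
      (fun u => (((hcont u).mono Set.inter_subset_left).sub continuousOn_const).enorm)
  have hRle : ∀ m u, R m u ≤ 2 * G u := by
    intro m u
    refine iSup₂_le fun t ht => ?_
    refine (enorm_sub_le).trans ?_
    rw [two_mul]
    exact add_le_add (hdom u t ht.1) (hdom u t₀ ht₀)
  have h2G : ∫⁻ u, 2 * G u ∂ρ ≠ ∞ := by
    rw [lintegral_const_mul' _ _ (by simp)]
    exact ENNReal.mul_ne_top (by simp) hG
  have hRint : Tendsto (fun m => ∫⁻ u, R m u ∂ρ) atTop (𝓝 0) := by
    have := tendsto_lintegral_of_dominated_convergence (μ := ρ) (F := R) (f := fun _ => 0)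
      (fun u => 2 * G u) hRm (fun m => Eventually.of_forall (hRle m)) h2G
      (Eventually.of_forall fun u => tendsto_biSup_sub ht₀ (hcont u))
    simpa using this
  have hF0 : Integrable (fun u => F u t₀) ρ :=
    ⟨(hmeas t₀ ht₀).aestronglyMeasurable,
      (lintegral_mono fun u => hdom u t₀ ht₀).trans_lt hG.lt_top⟩
  rw [Metric.tendsto_nhds]
  intro ε hε
  obtain ⟨m, hm⟩ := ((ENNReal.tendsto_nhds_zero.1 hRint) (ENNReal.ofReal (ε / 4))
    (by simpa using hε)).exists
  have hRfin : ∫⁻ u, R m u ∂ρ ≠ ∞ := (hm.trans_lt ENNReal.ofReal_lt_top).ne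
  have hRlt : ∀ᵐ u ∂ρ, R m u < ∞ := ae_lt_top (hRm m) hRfin
  have hRI : Integrable (fun u => (R m u).toReal) ρ :=
    integrable_toReal_of_lintegral_ne_top (hRm m).aemeasurable hRfin
  have hRI' : ∫ u, (R m u).toReal ∂ρ ≤ ε / 4 := by
    rw [integral_toReal (hRm m).aemeasurable hRlt]
    exact ENNReal.toReal_le_of_le_ofReal (by positivity) hm
  have e1 := (tendsto_average hs (hRm m).ennreal_toReal hRI).eventually_lt_const
    (show ∫ u, (R m u).toReal ∂ρ < ε / 2 by linarith)
  have e2 := Metric.tendsto_nhds.1 (tendsto_average hs (hmeas t₀ ht₀) hF0) (ε / 2)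
    (by positivity)
  have e3 : ∀ᶠ a in probFilter P, ∀ j, R m (z j a.2) < ∞ := by
    refine eventually_probFilter_of_ae fun n => ?_
    rw [ae_all_iff]
    intro j
    rw [← hs.law j] at hRlt
    exact ae_of_ae_map (hs.aemeasurable j) hRlt
  have e4 : ∀ᶠ t in 𝓝[A] t₀, t ∈ A ∩ Metric.ball t₀ (1 / ((m : ℝ) + 1)) :=
    inter_mem_nhdsWithin A (Metric.ball_mem_nhds _ (by positivity))
  filter_upwards [(e1.and (e2.and e3)).prod_mk e4] with ⟨⟨n, ω⟩, t⟩ ⟨⟨h1, h2, h3⟩, h4⟩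
  simp only [smul_eq_mul] at h1 h2 h3 h4 ⊢
  have hstep : ∀ j, ‖F (z j ω) t - F (z j ω) t₀‖ ≤ (R m (z j ω)).toReal := by
    intro j
    have : ‖F (z j ω) t - F (z j ω) t₀‖ₑ ≤ R m (z j ω) :=
      le_iSup₂ (f := fun t (_ : t ∈ A ∩ Metric.ball t₀ (1 / ((m : ℝ) + 1))) =>
        ‖F (z j ω) t - F (z j ω) t₀‖ₑ) t h4
    rw [← toReal_enorm]
    exact ENNReal.toReal_mono (h3 j).ne this
  have hdist : dist ((n : ℝ)⁻¹ • ∑ j ∈ Finset.range n, F (z j ω) t)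
      ((n : ℝ)⁻¹ • ∑ j ∈ Finset.range n, F (z j ω) t₀) ≤
      (n : ℝ)⁻¹ * ∑ j ∈ Finset.range n, (R m (z j ω)).toReal := by
    rw [dist_eq_norm, ← smul_sub, ← Finset.sum_sub_distrib, norm_smul]
    rw [Real.norm_of_nonneg (by positivity)]
    gcongr
    exact (norm_sum_le _ _).trans (Finset.sum_le_sum fun j _ => hstep j)
  calc _ ≤ _ := dist_triangle _ ((n : ℝ)⁻¹ • ∑ j ∈ Finset.range n, F (z j ω) t₀) _
    _ < ε := by linarith

theorem tendsto_average_comp {T : Type*} [PseudoMetricSpace T] [SecondCountableTopology T]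
    {E : Type*} [NormedAddCommGroup E] [NormedSpace ℝ E] [CompleteSpace E]
    [MeasurableSpace E] [BorelSpace E] [SecondCountableTopology E]
    (hs : IsIIDSample P ρ z) {A : Set T} {t₀ : T} (ht₀ : t₀ ∈ A) {F : Z → T → E}
    (hmeas : ∀ t ∈ A, Measurable fun u => F u t) (hcont : ∀ u, ContinuousOn (F u) A)
    {G : Z → ℝ≥0∞} (hdom : ∀ u, ∀ t ∈ A, ‖F u t‖ₑ ≤ G u) (hG : ∫⁻ u, G u ∂ρ ≠ ∞)
    {T' : ℕ × Ω → T} (hT' : Tendsto T' (probFilter P) (𝓝[A] t₀)) :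
    Tendsto (fun a : ℕ × Ω => (a.1 : ℝ)⁻¹ • ∑ j ∈ Finset.range a.1, F (z j a.2) (T' a))
      (probFilter P) (𝓝 (∫ u, F u t₀ ∂ρ)) := by
  have h := tendsto_average_nhdsWithin hs ht₀ hmeas hcont hdom hG
  have h2 : Tendsto (fun a : ℕ × Ω => (a, T' a)) (probFilter P) (probFilter P ×ˢ 𝓝[A] t₀) :=
    tendsto_id.prodMk hT'
  exact Tendsto.comp (f := fun a : ℕ × Ω => (a, T' a)) h h2

/-- **Consistency of minimum contrast estimators** over a compact set with a unique population
minimizer `t₀`: near each competitor the empirical contrast eventually exceeds the one at `t₀`,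
and finitely many such neighbourhoods cover the competitors at a positive distance from `t₀`. -/
theorem tendsto_minimizer {T : Type*} [PseudoMetricSpace T] [SecondCountableTopology T]
    (hs : IsIIDSample P ρ z) {A : Set T} (hA : IsCompact A) {t₀ : T} (ht₀ : t₀ ∈ A)
    {F : Z → T → ℝ} (hmeas : ∀ t ∈ A, Measurable fun u => F u t)
    (hcont : ∀ u, ContinuousOn (F u) A)
    {G : Z → ℝ≥0∞} (hdom : ∀ u, ∀ t ∈ A, ‖F u t‖ₑ ≤ G u) (hG : ∫⁻ u, G u ∂ρ ≠ ∞)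
    (hmin : ∀ t ∈ A, t ≠ t₀ → ∫ u, F u t₀ ∂ρ < ∫ u, F u t ∂ρ) {T' : ℕ × Ω → T}
    (hT' : ∀ᶠ a in probFilter P, T' a ∈ A ∧ ∀ t ∈ A,
      ∑ j ∈ Finset.range a.1, F (z j a.2) (T' a) ≤ ∑ j ∈ Finset.range a.1, F (z j a.2) t) :
    Tendsto T' (probFilter P) (𝓝[A] t₀) := by
  have hl : ∀ t ∈ A, Tendsto (fun q : (ℕ × Ω) × T =>
      (q.1.1 : ℝ)⁻¹ • ∑ j ∈ Finset.range q.1.1, F (z j q.1.2) q.2)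
      (probFilter P ×ˢ 𝓝[A] t) (𝓝 (∫ u, F u t ∂ρ)) := fun t ht =>
    tendsto_average_nhdsWithin hs ht hmeas hcont hdom hG
  have hconst : Tendsto (fun _ : ℕ × Ω => t₀) (probFilter P) (𝓝[A] t₀) :=
    tendsto_nhdsWithin_iff.2 ⟨tendsto_const_nhds, Eventually.of_forall fun _ => ht₀⟩
  have hbase := tendsto_average_comp hs ht₀ hmeas hcont hdom hG hconst
  refine tendsto_nhdsWithin_iff.2 ⟨?_, hT'.mono fun a ha => ha.1⟩
  intro U hU
  change ∀ᶠ a in probFilter P, T' a ∈ U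
  obtain ⟨V, hVU, hV, htV⟩ := mem_nhds_iff.1 hU
  have key : ∀ᶠ a in probFilter P, ∀ t ∈ A \ V,
      ∑ j ∈ Finset.range a.1, F (z j a.2) t₀ < ∑ j ∈ Finset.range a.1, F (z j a.2) t := by
    let p : Set T → Prop := fun s => ∀ᶠ a in probFilter P, ∀ t ∈ s,
      ∑ j ∈ Finset.range a.1, F (z j a.2) t₀ < ∑ j ∈ Finset.range a.1, F (z j a.2) t
    have h0 : p ∅ := Eventually.of_forall fun a t ht => absurd ht (Set.notMem_empty t)
    have hmono : ∀ ⦃s t : Set T⦄, s ⊆ t → p t → p s :=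
      fun s t hst h => h.mono fun a ha u hu => ha u (hst hu)
    have hunion : ∀ ⦃s t : Set T⦄, p s → p t → p (s ∪ t) := by
      intro s t h1 h2
      filter_upwards [h1, h2] with a ha hb u hu
      exact hu.elim (ha u) (hb u)
    have hnhds : ∀ t ∈ A \ V, ∃ s ∈ 𝓝[A \ V] t, p s := by
      intro t ht
      have hne : t ≠ t₀ := fun h => ht.2 (h ▸ htV)
      obtain ⟨c, hc1, hc2⟩ := exists_between (hmin t ht.1 hne)
      have e1 := (hl t ht.1).eventually_const_lt hc2
      obtain ⟨pa, hpa, pb, hpb, hp⟩ := eventually_prod_iff.1 e1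
      refine ⟨{u | pb u}, nhdsWithin_mono t Set.sdiff_subset hpb, ?_⟩
      filter_upwards [hpa, hbase.eventually_lt_const hc1, tendsto_fst_probFilter.eventually
        (eventually_gt_atTop 0)] with a ha1 ha2 ha3 u hu
      have h3 := ha2.trans (hp ha1 hu)
      simp only [smul_eq_mul] at h3
      have : (0 : ℝ) < (a.1 : ℝ)⁻¹ := by positivity
      exact lt_of_mul_lt_mul_left h3 this.le
    exact (hA.diff hV).induction_on h0 hmono hunion hnhds
  filter_upwards [key, hT'] with a h1 h2
  apply hVU
  by_contra hV'
  exact absurd (h1 _ ⟨h2.1, hV'⟩) (not_lt.2 (h2.2 t₀ ht₀))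

end UniformLaw

/-! ### Ridge ratios and the leading eigenvalue -/

section RidgeRatio

open scoped ComplexOrder

variable {p : ℕ}

/-- If every second ridge ratio exceeds the threshold, the leading eigenvalue is of the order of
the first ridge. The ratios telescope: backwards from `sStar (p + 1) = 0` every first ratio is at
most `c₂ / τ ^ p`, so `sHat j ^ 2 + c₁` grows by at most the factor `1 + c₂ / τ ^ p` per step. -/
theorem sHat_one_sq_le_of_forall_lt_rHat {lam : ℕ → ℝ} {c₁ c₂ τ : ℝ} (hc₁ : 0 < c₁)
    (hc₂ : 0 < c₂) (hτ0 : 0 < τ) (hτ1 : τ < 1) (hlam : ∀ j, 0 ≤ lam j)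
    (hanti : ∀ j, 1 ≤ j → lam (j + 1) ≤ lam j)
    (h1 : lam (p + 1) = 0) (h2 : lam (p + 2) = 0)
    (hr : ∀ j, 1 ≤ j → j ≤ p → τ < rHat lam c₁ c₂ j) :
    sHat lam 1 ^ 2 ≤ (1 + c₂ / τ ^ p) ^ p * c₁ := by
  have hs0 : ∀ j, 0 ≤ sHat lam j := fun j => div_nonneg (hlam j) (by linarith [hlam j])
  have hA : ∀ j, 0 < sHat lam j ^ 2 + c₁ := fun j => by positivity
  have hsanti : ∀ j, 1 ≤ j → sHat lam (j + 1) ≤ sHat lam j := by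
    intro j hj
    unfold sHat
    rw [div_le_div_iff₀ (by linarith [hlam (j + 1)]) (by linarith [hlam j])]
    nlinarith [hanti j hj]
  have hstar0 : ∀ j, 1 ≤ j → 0 ≤ sStar lam c₁ j := by
    intro j hj
    unfold sStar
    rw [sub_nonneg, one_le_div (hA _)]
    gcongr
    · exact hs0 _
    · exact hsanti j hj
  have hback : ∀ i, i ≤ p → sStar lam c₁ (p + 1 - i) + c₂ ≤ c₂ / τ ^ i := by
    intro i
    induction i with
    | zero =>
      intro _
      simp [sStar, sHat, h1, h2, hc₁.ne']
    | succ i ih =>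
      intro hi
      have hj := hr (p - i) (by omega) (by omega)
      have hpos := hstar0 (p - i) (by omega)
      have ih' := ih (by omega)
      rw [show p + 1 - i = p - i + 1 by omega] at ih'
      rw [show p + 1 - (i + 1) = p - i by omega]
      unfold rHat at hj
      rw [lt_div_iff₀ (by linarith)] at hj
      rw [pow_succ, ← div_div, le_div_iff₀ hτ0]
      linarith
  have hstep : ∀ j, 1 ≤ j → j ≤ p →
      sHat lam j ^ 2 + c₁ ≤ (1 + c₂ / τ ^ p) * (sHat lam (j + 1) ^ 2 + c₁) := by
    intro j hj hjp
    have h3 := hback (p + 1 - j) (by omega)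
    rw [show p + 1 - (p + 1 - j) = j by omega] at h3
    have h4 : c₂ / τ ^ (p + 1 - j) ≤ c₂ / τ ^ p :=
      div_le_div_of_nonneg_left hc₂.le (by positivity)
        (pow_le_pow_of_le_one hτ0.le hτ1.le (by omega))
    rw [← div_le_iff₀ (hA _)]
    have : (sHat lam j ^ 2 + c₁) / (sHat lam (j + 1) ^ 2 + c₁) = sStar lam c₁ j + 1 := by
      simp [sStar]
    linarith
  have hprod : ∀ i, i ≤ p → sHat lam (p + 1 - i) ^ 2 + c₁ ≤ (1 + c₂ / τ ^ p) ^ i * c₁ := by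
    intro i
    induction i with
    | zero =>
      intro _
      simp [sHat, h1]
    | succ i ih =>
      intro hi
      have h3 := hstep (p - i) (by omega) (by omega)
      have ih' := ih (by omega)
      rw [show p + 1 - i = p - i + 1 by omega] at ih'
      rw [show p + 1 - (i + 1) = p - i by omega, pow_succ' (1 + c₂ / τ ^ p), mul_assoc]
      refine h3.trans ?_
      gcongr
  have := hprod p le_rfl
  rw [show p + 1 - p = 1 by omega] at this
  linarith

variable {A : Matrix (Fin p) (Fin p) ℂ}

theorem sortedEigenvalue_nonneg (hA : A.IsHermitian) (hpos : A.PosSemidef) (j : ℕ) :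
    0 ≤ sortedEigenvalue hA j := by
  unfold sortedEigenvalue
  split_ifs with hj
  · have := hpos.eigenvalues_nonneg (Fintype.equivOfCardEq (Fintype.card_fin _)
      ⟨j - 1, by rw [Fintype.card_fin]; omega⟩)
    simpa [Matrix.IsHermitian.eigenvalues] using this
  · exact le_rfl

theorem sortedEigenvalue_succ_le (hA : A.IsHermitian) (hpos : A.PosSemidef) {j : ℕ} (hj : 1 ≤ j) :
    sortedEigenvalue hA (j + 1) ≤ sortedEigenvalue hA j := by
  by_cases hjp : j + 1 ≤ p
  · unfold sortedEigenvalue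
    rw [dif_pos ⟨by omega, hjp⟩, dif_pos ⟨hj, by omega⟩]
    exact hA.eigenvalues₀_antitone (by simp [Fin.le_def])
  · have : sortedEigenvalue hA (j + 1) = 0 := by
      unfold sortedEigenvalue
      rw [dif_neg (by omega)]
    rw [this]
    exact sortedEigenvalue_nonneg hA hpos j

/-- Every diagonal entry is at most the trace, hence at most `p` times the leading eigenvalue. -/
theorem diag_le_mul_sortedEigenvalue_one (hA : A.IsHermitian) (hpos : A.PosSemidef) (a : Fin p) :
    (A a a).re ≤ p * sortedEigenvalue hA 1 := by
  have hdiag : ∀ b, 0 ≤ (A b b).re := fun b => by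
    have := hpos.diag_nonneg (i := b)
    exact (Complex.le_def.1 this).1
  have h1 : (A a a).re ≤ A.trace.re := by
    rw [Matrix.trace, Complex.re_sum]
    exact Finset.single_le_sum (f := fun b => (A b b).re) (fun b _ => hdiag b)
      (Finset.mem_univ a)
  have h2 : A.trace.re = ∑ i, hA.eigenvalues i := by
    rw [hA.trace_eq_sum_eigenvalues]
    simp
  have h3 : ∀ i, hA.eigenvalues i ≤ sortedEigenvalue hA 1 := by
    intro i
    unfold sortedEigenvalue Matrix.IsHermitian.eigenvalues
    have := a.2
    rw [dif_pos ⟨le_rfl, by omega⟩]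
    exact hA.eigenvalues₀_antitone (by simp [Fin.le_def])
  calc (A a a).re ≤ ∑ i, hA.eigenvalues i := h2 ▸ h1
    _ ≤ ∑ _i : Fin p, sortedEigenvalue hA 1 := Finset.sum_le_sum fun i _ => h3 i
    _ = _ := by simp

theorem targetHat_posSemidef (x : ℕ → Vec p) (r : ℕ → ℝ) (n : ℕ) :
    (targetHat x r n).PosSemidef := by
  unfold targetHat
  refine Matrix.PosSemidef.smul (Matrix.posSemidef_sum _ fun j _ =>
    Matrix.posSemidef_vecMulVec_self_star _) ?_
  rw [Complex.zero_le_real]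
  positivity

theorem targetHat_diag_re (x : ℕ → Vec p) (r : ℕ → ℝ) (n : ℕ) (a : Fin p) :
    (targetHat x r n a a).re = (n : ℝ)⁻¹ * ∑ j ∈ Finset.range n, ‖mHat x r n (r j) a‖ ^ 2 := by
  simp only [targetHat, Matrix.smul_apply, Matrix.sum_apply, Matrix.vecMulVec_apply, Pi.star_apply,
    smul_eq_mul, Complex.re_ofReal_mul, one_div, Complex.re_sum]
  congr 1
  refine Finset.sum_congr rfl fun j _ => ?_
  rw [Complex.star_def, Complex.mul_conj, Complex.ofReal_re, Complex.normSq_eq_norm_sq]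

/-- A diagonal entry of the empirical target matrix that exceeds the order of the first ridge
forces a positive estimated dimension. -/
theorem qHat_pos_of_lt {c₁ c₂ τ δ : ℝ} (hc₁ : 0 < c₁) (hc₂ : 0 < c₂) (hτ0 : 0 < τ) (hτ1 : τ < 1)
    (hδ : 0 < δ) {x : ℕ → Vec p} {r : ℕ → ℝ} {n : ℕ} {a : Fin p}
    (ha : δ ≤ (targetHat x r n a a).re)
    (hlt : (1 + c₂ / τ ^ p) ^ p * c₁ < (δ / p / (δ / p + 1)) ^ 2) :
    0 < qHat c₁ c₂ τ x r n := by
  by_contra hq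
  have hq0 : qHat c₁ c₂ τ x r n = 0 := by omega
  set lam := sortedEigenvalue (targetHat_isHermitian x r n)
  have hp : (0 : ℝ) < p := by exact_mod_cast a.pos
  have hpos := targetHat_posSemidef x r n
  have hr : ∀ j, 1 ≤ j → j ≤ p → τ < rHat lam c₁ c₂ j := by
    intro j hj hjp
    by_contra hle
    have hmem : j ∈ (Finset.Icc 1 p).filter fun j => rHat lam c₁ c₂ j ≤ τ := by
      simp [hj, hjp, not_lt.1 hle]
    have : j ≤ qHat c₁ c₂ τ x r n := Finset.le_sup (f := id) hmem
    omega
  have hb := sHat_one_sq_le_of_forall_lt_rHat (p := p) hc₁ hc₂ hτ0 hτ1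
    (sortedEigenvalue_nonneg _ hpos) (fun j hj => sortedEigenvalue_succ_le _ hpos hj)
    (by simp [sortedEigenvalue]) (by simp [sortedEigenvalue]) hr
  have hlam : δ / p ≤ lam 1 := by
    rw [div_le_iff₀ hp, mul_comm]
    exact ha.trans (diag_le_mul_sortedEigenvalue_one _ hpos a)
  have hs : δ / p / (δ / p + 1) ≤ sHat lam 1 := by
    have h0 : 0 < δ / p := by positivity
    unfold sHat
    rw [div_le_div_iff₀ (by linarith) (by linarith)]
    nlinarith
  have : (δ / p / (δ / p + 1)) ^ 2 ≤ sHat lam 1 ^ 2 := by gcongr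
  exact absurd (hlt.trans_le this) (not_lt.2 hb)

end RidgeRatio

/-! ### Elementary inequalities -/

section Moments

theorem add_sq_le_four_mul (a b : ℝ≥0∞) : (a + b) ^ 2 ≤ 4 * (a ^ 2 + b ^ 2) := by
  rcases le_total a b with h | h
  · calc (a + b) ^ 2 ≤ (b + b) ^ 2 := by gcongr
      _ = 4 * b ^ 2 := by ring
      _ ≤ _ := by gcongr; exact le_add_self
  · calc (a + b) ^ 2 ≤ (a + a) ^ 2 := by gcongr
      _ = 4 * a ^ 2 := by ring
      _ ≤ _ := by gcongr; exact le_self_add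

theorem mul_le_sq_add_sq (a b : ℝ≥0∞) : a * b ≤ a ^ 2 + b ^ 2 := by
  rcases le_total a b with h | h
  · calc a * b ≤ b * b := by gcongr
      _ = b ^ 2 := by ring
      _ ≤ _ := le_add_self
  · calc a * b ≤ a * a := by gcongr
      _ = a ^ 2 := by ring
      _ ≤ _ := le_self_add

theorem enorm_apply_le {d : ℕ} (v : Vec d) (a : Fin d) : ‖v a‖ₑ ≤ ‖v‖ₑ := by
  rw [← ofReal_norm, ← ofReal_norm]
  exact ENNReal.ofReal_le_ofReal (PiLp.norm_apply_le v a)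

end Moments

/-! ### The gradient in the parameter -/

section Gradient

variable {p d : ℕ} {g : Vec p → Vec d → ℝ} {Θ : Set (Vec d)}

theorem gradient_apply {φ : Vec d → ℝ} {θ : Vec d} (a : Fin d) :
    gradient φ θ a = fderiv ℝ φ θ (EuclideanSpace.single a 1) := by
  have h : inner ℝ (gradient φ θ) (EuclideanSpace.single a (1 : ℝ)) =
      fderiv ℝ φ θ (EuclideanSpace.single a 1) := by
    unfold gradient
    exact InnerProductSpace.toDual_symm_apply
  rw [← h, EuclideanSpace.inner_single_right]
  simp

/-- A coordinate of the gradient in the parameter is a limit of difference quotients, hence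
measurable in the covariate. -/
theorem measurable_gradient_apply (hg_meas : ∀ θ, Measurable fun u => g u θ)
    (hg : ∀ u, ∀ θ ∈ Θ, ContDiffAt ℝ 2 (g u) θ) {θ : Vec d} (hθ : θ ∈ Θ) (a : Fin d) :
    Measurable fun u => gradient (g u) θ a := by
  have hlim : ∀ u, Tendsto (fun n : ℕ => (n : ℝ) •
      (g u (θ + ((n : ℝ))⁻¹ • EuclideanSpace.single a 1) - g u θ)) atTop
      (𝓝 (gradient (g u) θ a)) := by
    intro u
    rw [gradient_apply]
    have hd : HasFDerivAt (g u) (fderiv ℝ (g u) θ) θ :=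
      ((hg u θ hθ).differentiableAt (by norm_num)).hasFDerivAt
    apply hd.lim
    simpa using tendsto_natCast_atTop_atTop
  refine measurable_of_tendsto_metrizable (fun n => ?_) (tendsto_pi_nhds.2 hlim)
  exact ((hg_meas _).sub (hg_meas _)).const_smul (n : ℝ)

theorem continuousOn_gradient (hg : ∀ u, ∀ θ ∈ Θ, ContDiffAt ℝ 2 (g u) θ) (u : Vec p) :
    ContinuousOn (fun θ => gradient (g u) θ) Θ := by
  intro θ hθ
  have h : ContinuousAt (fderiv ℝ (g u)) θ :=
    ((hg u θ hθ).fderiv_right (m := 1) (by norm_num)).continuousAt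
  exact (((InnerProductSpace.toDual ℝ (Vec d)).symm.continuous.continuousAt).comp
    h).continuousWithinAt

theorem continuousOn_gradient_apply (hg : ∀ u, ∀ θ ∈ Θ, ContDiffAt ℝ 2 (g u) θ) (u : Vec p)
    (a : Fin d) : ContinuousOn (fun θ => gradient (g u) θ a) Θ :=
  (EuclideanSpace.proj (𝕜 := ℝ) a).continuous.comp_continuousOn (continuousOn_gradient hg u)

theorem continuousOn_of_contDiffAt (hg : ∀ u, ∀ θ ∈ Θ, ContDiffAt ℝ 2 (g u) θ) (u : Vec p) :
    ContinuousOn (g u) Θ :=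
  fun θ hθ => (hg u θ hθ).continuousAt.continuousWithinAt

end Gradient

/-! ### Consistency of least squares and of the standardizing variance -/

section Variance

variable {p d : ℕ} {g : Vec p → Vec d → ℝ} {Θ : Set (Vec d)}
  {Ω : Type*} [MeasurableSpace Ω] {P : Measure Ω} [IsProbabilityMeasure P]
  {ρ : Measure (Vec p × ℝ)} {x : ℕ → Ω → Vec p} {y : ℕ → Ω → ℝ}

/-- The bound `4 (y² + sup g²)` of the squared residuals. -/
theorem enorm_sub_sq_le (z : Vec p × ℝ) {θ : Vec d} (hθ : θ ∈ Θ) :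
    ‖(z.2 - g z.1 θ) ^ 2‖ₑ ≤ 4 * (‖z.2‖ₑ ^ 2 + ⨆ θ ∈ Θ, ‖g z.1 θ‖ₑ ^ 2) := by
  rw [enorm_pow]
  calc ‖z.2 - g z.1 θ‖ₑ ^ 2 ≤ (‖z.2‖ₑ + ‖g z.1 θ‖ₑ) ^ 2 := by gcongr; exact enorm_sub_le
    _ ≤ 4 * (‖z.2‖ₑ ^ 2 + ‖g z.1 θ‖ₑ ^ 2) := add_sq_le_four_mul _ _
    _ ≤ _ := by
      gcongr
      exact le_iSup₂ (f := fun θ (_ : θ ∈ Θ) => ‖g z.1 θ‖ₑ ^ 2) θ hθ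

theorem lintegral_residual_bound_ne_top
    (hy2 : ∫⁻ z, ‖z.2‖ₑ ^ 2 ∂ρ ≠ ∞) (hg2 : ∫⁻ z, ⨆ θ ∈ Θ, ‖g z.1 θ‖ₑ ^ 2 ∂ρ ≠ ∞) :
    ∫⁻ z, 4 * (‖z.2‖ₑ ^ 2 + ⨆ θ ∈ Θ, ‖g z.1 θ‖ₑ ^ 2) ∂ρ ≠ ∞ := by
  rw [lintegral_const_mul' _ _ (by simp), lintegral_add_left (by fun_prop)]
  exact ENNReal.mul_ne_top (by simp) (ENNReal.add_ne_top.2 ⟨hy2, hg2⟩)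

/-- The least squares estimators are consistent. -/
theorem tendsto_leastSquares (hs : IsIIDSample P ρ fun j ω => (x j ω, y j ω))
    (hΘ : IsCompact Θ) (hg_meas : ∀ θ, Measurable fun u => g u θ)
    (hg : ∀ u, ∀ θ ∈ Θ, ContDiffAt ℝ 2 (g u) θ)
    (hy2 : ∫⁻ z, ‖z.2‖ₑ ^ 2 ∂ρ ≠ ∞) (hg2 : ∫⁻ z, ⨆ θ ∈ Θ, ‖g z.1 θ‖ₑ ^ 2 ∂ρ ≠ ∞)
    {θs : Vec d} (hθs : θs ∈ Θ)
    (hmin : ∀ θ ∈ Θ, θ ≠ θs → ∫ z, (z.2 - g z.1 θs) ^ 2 ∂ρ < ∫ z, (z.2 - g z.1 θ) ^ 2 ∂ρ)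
    {θhat : ℕ → Ω → Vec d}
    (hθhat : ∀ n, ∀ᵐ ω ∂P, IsLeastSquares g Θ (fun j => x j ω) (fun j => y j ω) n (θhat n ω)) :
    Tendsto (fun a : ℕ × Ω => θhat a.1 a.2) (probFilter P) (𝓝[Θ] θs) := by
  refine tendsto_minimizer (F := fun z θ => (z.2 - g z.1 θ) ^ 2) hs hΘ hθs ?_ ?_
    (fun z θ hθ => enorm_sub_sq_le z hθ) (lintegral_residual_bound_ne_top hy2 hg2) hmin ?_
  · intro θ _
    have := (hg_meas θ).comp (measurable_fst : Measurable (Prod.fst : Vec p × ℝ → Vec p))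
    exact (measurable_snd.sub this).pow_const 2
  · intro z
    exact (continuousOn_const.sub (continuousOn_of_contDiffAt hg z.1)).pow 2
  · exact eventually_probFilter_of_ae hθhat

theorem tendsto_sigmaHatSq (hs : IsIIDSample P ρ fun j ω => (x j ω, y j ω))
    (hg_meas : ∀ θ, Measurable fun u => g u θ)
    (hg : ∀ u, ∀ θ ∈ Θ, ContDiffAt ℝ 2 (g u) θ)
    (hy2 : ∫⁻ z, ‖z.2‖ₑ ^ 2 ∂ρ ≠ ∞) (hg2 : ∫⁻ z, ⨆ θ ∈ Θ, ‖g z.1 θ‖ₑ ^ 2 ∂ρ ≠ ∞)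
    (hgrad2 : ∫⁻ z, ⨆ θ ∈ Θ, ‖gradient (g z.1) θ‖ₑ ^ 2 ∂ρ ≠ ∞)
    {w : Vec p → ℝ} (hw : Measurable w) (hw2 : ∫⁻ z, ‖w z.1‖ₑ ^ 2 ∂ρ ≠ ∞)
    {θs : Vec d} (hθs : θs ∈ Θ) {θhat : ℕ × Ω → Vec d}
    (hθhat : Tendsto θhat (probFilter P) (𝓝[Θ] θs)) {X : Ω → Vec p} {Y : Ω → ℝ}
    (hX : Measurable X) (hY : Measurable Y) (hρ : P.map (fun ω => (X ω, Y ω)) = ρ)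
    (hgram : IsUnit (gram P g X θs).det) :
    Tendsto (fun a : ℕ × Ω =>
        sigmaHatSq g w (fun j => x j a.2) (fun j => y j a.2) (θhat a) a.1)
      (probFilter P) (𝓝 (Sigma01 P g w X Y θs)) := by
  have hXY : Measurable fun ω => (X ω, Y ω) := hX.prodMk hY
  have hgm : ∀ θ, Measurable fun z : Vec p × ℝ => g z.1 θ := fun θ =>
    (hg_meas θ).comp measurable_fst
  have hdm : ∀ θ ∈ Θ, ∀ a, Measurable fun z : Vec p × ℝ => gradient (g z.1) θ a := fun θ hθ a =>
    (measurable_gradient_apply hg_meas hg hθ a).comp measurable_fst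
  have hwm : Measurable fun z : Vec p × ℝ => w z.1 := hw.comp measurable_fst
  have hsup : ∀ z : Vec p × ℝ, ∀ θ ∈ Θ, ∀ a,
      ‖gradient (g z.1) θ a‖ₑ ^ 2 ≤ ⨆ θ ∈ Θ, ‖gradient (g z.1) θ‖ₑ ^ 2 := by
    intro z θ hθ a
    calc ‖gradient (g z.1) θ a‖ₑ ^ 2 ≤ ‖gradient (g z.1) θ‖ₑ ^ 2 := by
          gcongr; exact enorm_apply_le _ a
      _ ≤ _ := le_iSup₂ (f := fun θ (_ : θ ∈ Θ) => ‖gradient (g z.1) θ‖ₑ ^ 2) θ hθ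
  -- the mean squared residual
  have h1 := tendsto_average_comp (F := fun z θ => (z.2 - g z.1 θ) ^ 2) hs hθs
    (fun θ _ => (measurable_snd.sub (hgm θ)).pow_const 2)
    (fun z => (continuousOn_const.sub (continuousOn_of_contDiffAt hg z.1)).pow 2)
    (fun z θ hθ => enorm_sub_sq_le z hθ) (lintegral_residual_bound_ne_top hy2 hg2) hθhat
  -- the mean squared weight
  have h2 := tendsto_average hs (φ := fun z => w z.1 ^ 2) (hwm.pow_const 2)
    ⟨(hwm.pow_const 2).aestronglyMeasurable, by
      simpa [HasFiniteIntegral, enorm_pow] using hw2.lt_top⟩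
  -- the cross moments
  have h3 : ∀ a, _ := fun a => tendsto_average_comp
    (F := fun z θ => gradient (g z.1) θ a * w z.1) hs hθs
    (fun θ hθ => (hdm θ hθ a).mul hwm)
    (fun z => (continuousOn_gradient_apply hg z.1 a).mul continuousOn_const)
    (G := fun z => (⨆ θ ∈ Θ, ‖gradient (g z.1) θ‖ₑ ^ 2) + ‖w z.1‖ₑ ^ 2)
    (fun z θ hθ => by
      rw [enorm_mul]
      refine (mul_le_sq_add_sq _ _).trans ?_
      gcongr
      exact hsup z θ hθ a)
    (by
      rw [lintegral_add_right _ (by fun_prop)]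
      exact ENNReal.add_ne_top.2 ⟨hgrad2, hw2⟩) hθhat
  -- the entries of the Gram matrix
  have h4 : ∀ a b, _ := fun a b => tendsto_average_comp
    (F := fun z θ => gradient (g z.1) θ a * gradient (g z.1) θ b) hs hθs
    (fun θ hθ => (hdm θ hθ a).mul (hdm θ hθ b))
    (fun z => (continuousOn_gradient_apply hg z.1 a).mul (continuousOn_gradient_apply hg z.1 b))
    (G := fun z => 2 * ⨆ θ ∈ Θ, ‖gradient (g z.1) θ‖ₑ ^ 2)
    (fun z θ hθ => by
      rw [enorm_mul, two_mul]
      refine (mul_le_sq_add_sq _ _).trans ?_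
      exact add_le_add (hsup z θ hθ a) (hsup z θ hθ b))
    (by
      rw [lintegral_const_mul' _ _ (by simp)]
      exact ENNReal.mul_ne_top (by simp) hgrad2) hθhat
  have hmap : ∀ φ : Vec p × ℝ → ℝ, Measurable φ → ∫ z, φ z ∂ρ = ∫ ω, φ (X ω, Y ω) ∂P := by
    intro φ hφ
    rw [← hρ, integral_map hXY.aemeasurable hφ.aestronglyMeasurable]
  rw [hmap (fun z => (z.2 - g z.1 θs) ^ 2) ((measurable_snd.sub (hgm θs)).pow_const 2)] at h1
  rw [hmap (fun z => w z.1 ^ 2) (hwm.pow_const 2)] at h2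
  simp only [fun a => hmap (fun z => gradient (g z.1) θs a * w z.1) ((hdm θs hθs a).mul hwm)] at h3
  simp only [fun a b => hmap
    (fun z => gradient (g z.1) θs a * gradient (g z.1) θs b)
    ((hdm θs hθs a).mul (hdm θs hθs b))] at h4
  have hgramlim : Tendsto (fun a : ℕ × Ω => gramHat g (fun j => x j a.2) (θhat a) a.1)
      (probFilter P) (𝓝 (gram P g X θs)) := by
    refine tendsto_pi_nhds.2 fun a => tendsto_pi_nhds.2 fun b => ?_
    simpa [gramHat, gram] using h4 a b
  have hcrosslim : Tendsto (fun a : ℕ × Ω => crossHat g w (fun j => x j a.2) (θhat a) a.1)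
      (probFilter P) (𝓝 (cross P g w X θs)) := by
    refine tendsto_pi_nhds.2 fun a => ?_
    simpa [crossHat, cross] using h3 a
  have hinv := (continuousAt_matrix_inv (gram P g X θs) (by
    simpa [Ring.inverse_eq_inv'] using continuousAt_inv₀ hgram.ne_zero)).tendsto.comp hgramlim
  have hcont : Continuous fun q : (Fin d → ℝ) × Matrix (Fin d) (Fin d) ℝ =>
      q.1 ⬝ᵥ Matrix.mulVec q.2 q.1 :=
    continuous_fst.dotProduct (continuous_snd.matrix_mulVec continuous_fst)
  have hquad := (hcont.tendsto (cross P g w X θs, (gram P g X θs)⁻¹)).comp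
    (hcrosslim.prodMk_nhds hinv)
  have := h1.mul (h2.sub hquad)
  simpa [sigmaHatSq, Sigma01, resid, popResid, Function.comp_def] using this

end Variance

/-! ### Positivity of the estimated dimension -/

section Dimension

variable {p d : ℕ} {g : Vec p → Vec d → ℝ} {Θ : Set (Vec d)}
  {Ω : Type*} [MeasurableSpace Ω] {P : Measure Ω} [IsProbabilityMeasure P]
  {ρ : Measure (Vec p × ℝ)} {x : ℕ → Ω → Vec p} {y : ℕ → Ω → ℝ}

/-- Let `t₀` be a point of the support of the law of the residual at which
`m(t) = E[X_a exp(i t η)]` does not vanish. The empirical version of `m` stays away from `0` on a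
neighbourhood of `t₀`, and a positive fraction of the residuals falls into it; so a diagonal entry
of the empirical target matrix stays away from `0`. -/
theorem exists_le_targetHat_diag (hs : IsIIDSample P ρ fun j ω => (x j ω, y j ω))
    (hg_meas : ∀ θ, Measurable fun u => g u θ)
    (hg : ∀ u, ∀ θ ∈ Θ, ContDiffAt ℝ 2 (g u) θ)
    {θs : Vec d} (hθs : θs ∈ Θ) {θhat : ℕ × Ω → Vec d}
    (hθhat : Tendsto θhat (probFilter P) (𝓝[Θ] θs)) {a : Fin p}
    (hx1 : ∫⁻ z, ‖z.1 a‖ₑ ∂ρ ≠ ∞) {t₀ : ℝ}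
    (ht₀ : t₀ ∈ (ρ.map fun z => z.2 - g z.1 θs).support)
    (hm : ∫ z, ((z.1 a : ℝ) : ℂ) * Complex.exp (Complex.I * t₀ * ((z.2 - g z.1 θs : ℝ) : ℂ)) ∂ρ
      ≠ 0) :
    ∃ δ > 0, ∀ᶠ q in probFilter P, δ ≤ (targetHat (fun j => x j q.2)
      (resid g (fun j => x j q.2) (fun j => y j q.2) (θhat q)) q.1 a a).re := by
  have := hs.isProbabilityMeasure
  have hgm : ∀ θ, Measurable fun z : Vec p × ℝ => g z.1 θ := fun θ =>
    (hg_meas θ).comp measurable_fst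
  have hηm : ∀ θ, Measurable fun z : Vec p × ℝ => z.2 - g z.1 θ := fun θ =>
    measurable_snd.sub (hgm θ)
  have hcoord : Measurable fun z : Vec p × ℝ => z.1 a := by fun_prop
  set m₀ := ∫ z, ((z.1 a : ℝ) : ℂ) *
    Complex.exp (Complex.I * t₀ * ((z.2 - g z.1 θs : ℝ) : ℂ)) ∂ρ with hm₀
  have hc : 0 < ‖m₀‖ := norm_pos_iff.2 hm
  -- the empirical characteristic functions near `(θs, t₀)`
  have hmem : (θs, t₀) ∈ Θ ×ˢ (Set.univ : Set ℝ) := ⟨hθs, Set.mem_univ _⟩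
  have hl := tendsto_average_nhdsWithin (T := Vec d × ℝ) (t₀ := (θs, t₀)) hs hmem
    (F := fun z q => ((z.1 a : ℝ) : ℂ) *
      Complex.exp (Complex.I * q.2 * ((z.2 - g z.1 q.1 : ℝ) : ℂ)))
    (G := fun z => ‖z.1 a‖ₑ)
    (by
      intro q _
      have := hηm q.1
      fun_prop)
    (by
      intro z
      have h1 : ContinuousOn (fun q : Vec d × ℝ => z.2 - g z.1 q.1) (Θ ×ˢ Set.univ) :=
        continuousOn_const.sub ((continuousOn_of_contDiffAt hg z.1).comp continuousOn_fst
          fun q hq => hq.1)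
      have h2 : ContinuousOn (fun q : Vec d × ℝ => Complex.I * (q.2 : ℂ) *
          ((z.2 - g z.1 q.1 : ℝ) : ℂ)) (Θ ×ˢ Set.univ) := by
        refine ContinuousOn.mul (by fun_prop) ?_
        exact Complex.continuous_ofReal.comp_continuousOn h1
      exact continuousOn_const.mul (Complex.continuous_exp.comp_continuousOn h2))
    (by
      intro z q _
      rw [enorm_mul]
      have h1 : ‖Complex.exp (Complex.I * q.2 * ((z.2 - g z.1 q.1 : ℝ) : ℂ))‖ₑ = 1 := by
        rw [← ofReal_norm, mul_assoc, ← Complex.ofReal_mul, mul_comm,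
          Complex.norm_exp_ofReal_mul_I, ENNReal.ofReal_one]
      rw [h1, mul_one, ← ofReal_norm, Complex.norm_real, ofReal_norm])
    hx1
  have hl' := hl.norm.eventually_const_lt (show ‖m₀‖ / 2 < ‖m₀‖ by linarith)
  rw [nhdsWithin_prod_eq, nhdsWithin_univ] at hl'
  obtain ⟨pa, hpa, pb, hpb, hab⟩ := eventually_prod_iff.1 hl'
  obtain ⟨pθ, hpθ, pt, hpt, hbt⟩ := eventually_prod_iff.1 hpb
  obtain ⟨r, hr, hball⟩ := Metric.eventually_nhds_iff.1 hpt
  -- the fraction of residuals near `t₀`, bounded below with a tent function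
  let ψ : ℝ → ℝ := fun t => max 0 (1 - |t - t₀| / r)
  have hψc : Continuous ψ := by fun_prop
  have hψ0 : ∀ t, 0 ≤ ψ t := fun t => le_max_left _ _
  have hψ1 : ∀ t, ψ t ≤ 1 := fun t => max_le zero_le_one (by
    have : 0 ≤ |t - t₀| / r := by positivity
    linarith)
  have hψb : ∀ t, ψ t ≠ 0 ↔ dist t t₀ < r := by
    intro t
    rw [← (hψ0 t).lt_iff_ne', Real.dist_eq]
    simp only [ψ, lt_max_iff, lt_irrefl, false_or, sub_pos, div_lt_one hr]
  have hψint : ∀ θ, Integrable (fun z : Vec p × ℝ => ψ (z.2 - g z.1 θ)) ρ := fun θ =>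
    Integrable.of_bound (hψc.measurable.comp (hηm θ)).aestronglyMeasurable 1
      (Eventually.of_forall fun z => by rw [Real.norm_of_nonneg (hψ0 _)]; exact hψ1 _)
  have hκ : 0 < ∫ z, ψ (z.2 - g z.1 θs) ∂ρ := by
    rw [integral_pos_iff_support_of_nonneg (fun z => hψ0 _) (hψint θs)]
    have h1 := (Measure.mem_support_iff_forall t₀).1 ht₀ _ (Metric.ball_mem_nhds t₀ hr)
    rw [Measure.map_apply (hηm θs) measurableSet_ball] at h1
    refine h1.trans_eq (congrArg ρ ?_)
    ext z
    simp only [Set.mem_preimage, Metric.mem_ball, Function.mem_support]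
    exact (hψb _).symm
  set κ := ∫ z, ψ (z.2 - g z.1 θs) ∂ρ
  have hψl := tendsto_average_comp (F := fun z θ => ψ (z.2 - g z.1 θ)) hs hθs
    (fun θ _ => hψc.measurable.comp (hηm θ))
    (fun z => hψc.comp_continuousOn (continuousOn_const.sub (continuousOn_of_contDiffAt hg z.1)))
    (G := fun _ => 1)
    (fun z θ _ => by
      rw [← ofReal_norm, Real.norm_of_nonneg (hψ0 _)]
      exact ENNReal.ofReal_le_one.2 (hψ1 _)) (by simp) hθhat
  refine ⟨(‖m₀‖ / 2) ^ 2 * (κ / 2), by positivity, ?_⟩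
  filter_upwards [hpa, hθhat.eventually hpθ, hψl.eventually_const_lt (show κ / 2 < κ by linarith)]
    with q h1 h2 h3
  rw [targetHat_diag_re]
  simp only [smul_eq_mul] at h3
  calc (‖m₀‖ / 2) ^ 2 * (κ / 2)
      ≤ (‖m₀‖ / 2) ^ 2 * ((q.1 : ℝ)⁻¹ *
          ∑ j ∈ Finset.range q.1, ψ (y j q.2 - g (x j q.2) (θhat q))) := by gcongr
    _ = (q.1 : ℝ)⁻¹ * ∑ j ∈ Finset.range q.1,
          (‖m₀‖ / 2) ^ 2 * ψ (y j q.2 - g (x j q.2) (θhat q)) := by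
        rw [← Finset.mul_sum]; ring
    _ ≤ _ := by
      gcongr with j _
      by_cases hj : ψ (y j q.2 - g (x j q.2) (θhat q)) = 0
      · rw [hj, mul_zero]; positivity
      · have h4 := hab h1 (hbt h2 (hball ((hψb _).1 hj)))
        have h5 : ‖m₀‖ / 2 < ‖mHat (fun j => x j q.2)
            (resid g (fun j => x j q.2) (fun j => y j q.2) (θhat q)) q.1
            (resid g (fun j => x j q.2) (fun j => y j q.2) (θhat q) j) a‖ := by
          refine h4.trans_eq ?_
          simp only [mHat, resid, Complex.real_smul, one_div]
          push_cast
          rfl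
        calc _ ≤ (‖m₀‖ / 2) ^ 2 * 1 := by gcongr; exact hψ1 _
          _ ≤ _ := by rw [mul_one]; gcongr

/-- If `m(t) = E[X_a exp(i t η)]` is not almost everywhere zero under the law of the residual,
the estimated dimension is positive with probability tending to one. -/
theorem eventually_qHat_pos (hs : IsIIDSample P ρ fun j ω => (x j ω, y j ω))
    (hg_meas : ∀ θ, Measurable fun u => g u θ)
    (hg : ∀ u, ∀ θ ∈ Θ, ContDiffAt ℝ 2 (g u) θ)
    {θs : Vec d} (hθs : θs ∈ Θ) {θhat : ℕ × Ω → Vec d}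
    (hθhat : Tendsto θhat (probFilter P) (𝓝[Θ] θs)) {a : Fin p}
    (hx1 : ∫⁻ z, ‖z.1 a‖ₑ ∂ρ ≠ ∞)
    (hm : ¬ ∀ᵐ (t : ℝ) ∂(ρ.map fun z => z.2 - g z.1 θs),
      ∫ z, ((z.1 a : ℝ) : ℂ) * Complex.exp (Complex.I * t * ((z.2 - g z.1 θs : ℝ) : ℂ)) ∂ρ = 0)
    {c₁ c₂ : ℕ → ℝ} {τ : ℝ} (hc_pos : ∀ᶠ n in atTop, 0 < c₁ n ∧ 0 < c₂ n)
    (hc₁ : Tendsto c₁ atTop (𝓝 0)) (hc₂ : Tendsto c₂ atTop (𝓝 0))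
    (hτ0 : 0 < τ) (hτ1 : τ < 1) :
    ∀ᶠ q in probFilter P, 0 < qHat (c₁ q.1) (c₂ q.1) τ (fun j => x j q.2)
      (resid g (fun j => x j q.2) (fun j => y j q.2) (θhat q)) q.1 := by
  obtain ⟨t₀, ht₀, hmt⟩ : ∃ t : ℝ, t ∈ (ρ.map fun z => z.2 - g z.1 θs).support ∧
      ∫ z, ((z.1 a : ℝ) : ℂ) * Complex.exp (Complex.I * t * ((z.2 - g z.1 θs : ℝ) : ℂ)) ∂ρ
        ≠ 0 := by
    by_contra! hcon
    apply hm
    filter_upwards [Measure.support_mem_ae] with t ht using hcon t ht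
  obtain ⟨δ, hδ, hev⟩ := exists_le_targetHat_diag hs hg_meas hg hθs hθhat hx1 ht₀ hmt
  have hp : (0 : ℝ) < p := by exact_mod_cast a.pos
  have hlim : Tendsto (fun n => (1 + c₂ n / τ ^ p) ^ p * c₁ n) atTop (𝓝 0) := by
    have := (((hc₂.div_const (τ ^ p)).const_add 1).pow p).mul hc₁
    simpa using this
  have hpos : 0 < (δ / p / (δ / p + 1)) ^ 2 := by positivity
  filter_upwards [hev, tendsto_fst_probFilter.eventually hc_pos,
    tendsto_fst_probFilter.eventually (hlim.eventually_lt_const hpos)] with q h1 h2 h3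
  exact qHat_pos_of_lt h2.1 h2.2 hτ0 hτ1 hδ h1 h3

end Dimension

/-! ### The target matrix and the central subspace -/

section Target

variable {p : ℕ} {Ω : Type*} [MeasurableSpace Ω] {P : Measure Ω}

theorem targetMatrix_eq_zero {X : Ω → Vec p} {η : Ω → ℝ}
    (h : ∀ a : Fin p, ∀ᵐ (t : ℝ) ∂(P.map η),
      ∫ ω, ((X ω a : ℝ) : ℂ) * Complex.exp (Complex.I * t * (η ω : ℂ)) ∂P = 0) :
    targetMatrix P X η = 0 := by
  ext a b
  simp only [targetMatrix, Matrix.of_apply, Matrix.zero_apply]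
  refine integral_eq_zero_of_ae ?_
  filter_upwards [h a] with t ht
  simp [ht]

/-- If the zero subspace is a dimension reduction subspace, the pair is independent. -/
theorem indepFun_of_isDimensionReduction_bot {ρ : Measure (Vec p × ℝ)} [IsProbabilityMeasure ρ]
    (h : IsDimensionReduction ρ ⊥) :
    IndepFun (Prod.snd : Vec p × ℝ → ℝ) (Prod.fst : Vec p × ℝ → Vec p) ρ := by
  have hbot : MeasurableSpace.comap
      (fun z : Vec p × ℝ => (⊥ : Submodule ℝ (Vec p)).starProjection z.1) inferInstance = ⊥ := by
    have : (fun z : Vec p × ℝ => (⊥ : Submodule ℝ (Vec p)).starProjection z.1) = fun _ => 0 := by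
      ext z; simp
    rw [this, MeasurableSpace.comap_const]
  unfold IsDimensionReduction at h
  rw [condIndepFun_iff_condExp_inter_preimage_eq_mul measurable_snd measurable_fst] at h
  rw [indepFun_iff_measure_inter_preimage_eq_mul]
  intro s t hs ht
  have h1 := h s t hs ht
  simp only [hbot, condExp_bot] at h1
  obtain ⟨z, hz⟩ := h1.exists
  have i1 : MeasurableSet ((Prod.snd : Vec p × ℝ → ℝ) ⁻¹' s) := measurable_snd hs
  have i2 : MeasurableSet ((Prod.fst : Vec p × ℝ → Vec p) ⁻¹' t) := measurable_fst ht
  simp only [integral_indicator (i1.inter i2), integral_indicator i1,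
    integral_indicator i2] at hz
  simp only [integral_const, smul_eq_mul, mul_one, measureReal_restrict_apply_univ] at hz
  rw [measureReal_def, measureReal_def, measureReal_def, ← ENNReal.toReal_mul] at hz
  exact (ENNReal.toReal_eq_toReal_iff' (by simp)
    (ENNReal.mul_ne_top (by simp) (by simp))).1 hz

end Target

/-! ### The rescaled kernel as an approximate identity -/

section ApproximateIdentity

variable {p : ℕ}

/-- The rescaled kernel `h⁻ᵖ K(u / h)`. -/
noncomputable def scaledKernel (K : Vec p → ℝ) (h : ℝ) (u : Vec p) : ℝ :=
  (1 / h ^ p) * K (h⁻¹ • u)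

theorem scaledKernel_nonneg {K : Vec p → ℝ} (hK : ∀ u, 0 ≤ K u) {h : ℝ} (hh : 0 < h) (u : Vec p) :
    0 ≤ scaledKernel K h u :=
  mul_nonneg (by positivity) (hK _)

theorem scaledKernel_le {K : Vec p → ℝ} {C : ℝ} (hK : ∀ u, K u ≤ C) {h : ℝ} (hh : 0 < h)
    (u : Vec p) : scaledKernel K h u ≤ C / h ^ p := by
  unfold scaledKernel
  rw [div_mul_eq_mul_div, one_mul]
  gcongr
  exact hK _

theorem measurable_scaledKernel {K : Vec p → ℝ} (hK : Continuous K) (h : ℝ) :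
    Measurable (scaledKernel K h) := by
  have := hK.measurable
  unfold scaledKernel
  fun_prop

/-- The change of variables `u = h v`. -/
theorem lintegral_scaledKernel_mul {K : Vec p → ℝ} (hK : Continuous K) {h : ℝ} (hh : 0 < h)
    {ω : Vec p → ℝ≥0∞} (hω : Measurable ω) :
    ∫⁻ u, ENNReal.ofReal (scaledKernel K h u) * ω u =
      ∫⁻ v, ENNReal.ofReal (K v) * ω (h • v) := by
  have hKm := hK.measurable
  have hF : Measurable fun v => ENNReal.ofReal (K v) * ω (h • v) := by fun_prop
  have hmap := Measure.map_addHaar_smul (volume : Measure (Vec p)) (inv_ne_zero hh.ne')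
  have h1 : ∫⁻ v, ENNReal.ofReal (K v) * ω (h • v) ∂(Measure.map (h⁻¹ • ·) volume) =
      ∫⁻ u, ENNReal.ofReal (K (h⁻¹ • u)) * ω u := by
    rw [lintegral_map hF (by fun_prop)]
    simp [smul_smul, hh.ne']
  rw [hmap, lintegral_smul_measure] at h1
  have h2 : ∀ u, ENNReal.ofReal (scaledKernel K h u) * ω u =
      ENNReal.ofReal (1 / h ^ p) * (ENNReal.ofReal (K (h⁻¹ • u)) * ω u) := by
    intro u
    unfold scaledKernel
    rw [ENNReal.ofReal_mul (by positivity), mul_assoc]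
  simp_rw [h2]
  rw [lintegral_const_mul _ (by fun_prop), ← h1, smul_eq_mul, ← mul_assoc,
    ← ENNReal.ofReal_mul (by positivity)]
  have : 1 / h ^ p * |((h⁻¹ ^ Module.finrank ℝ (Vec p)))⁻¹| = 1 := by
    rw [finrank_euclideanSpace_fin, abs_of_pos (by positivity), inv_pow, inv_inv]
    field_simp
  rw [this, ENNReal.ofReal_one, one_mul]

theorem lintegral_ofReal_kernel {K : Vec p → ℝ} (hK0 : ∀ u, 0 ≤ K u) (hK1 : ∫ u, K u = 1) :
    ∫⁻ u, ENNReal.ofReal (K u) = 1 := by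
  rw [← ofReal_integral_eq_lintegral_ofReal (integrable_of_integral_eq_one hK1)
    (Eventually.of_forall hK0), hK1, ENNReal.ofReal_one]

theorem lintegral_scaledKernel {K : Vec p → ℝ} (hK : Continuous K) (hK0 : ∀ u, 0 ≤ K u)
    (hK1 : ∫ u, K u = 1) {h : ℝ} (hh : 0 < h) :
    ∫⁻ u, ENNReal.ofReal (scaledKernel K h u) = 1 := by
  have := lintegral_scaledKernel_mul hK hh (ω := fun _ => 1) measurable_const
  simpa [lintegral_ofReal_kernel hK0 hK1] using this

/-- Translation is continuous in `L¹`. -/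
theorem tendsto_lintegral_translation {φ : Vec p → ℝ} (hφ : Integrable φ) :
    Tendsto (fun u : Vec p => ∫⁻ x, ‖φ (x - u) - φ x‖ₑ) (𝓝 0) (𝓝 0) := by
  have hφ1 : MemLp φ 1 volume := memLp_one_iff_integrable.2 hφ
  have : Fact ((1 : ℝ≥0∞) ≠ ∞) := ⟨by simp⟩
  have hc : Continuous fun u : Vec p => (DomAddAct.mk (-u)) +ᵥ hφ1.toLp φ := by
    have h1 : Continuous fun u : Vec p => DomAddAct.mk (-u) :=
      DomAddAct.continuous_mk.comp continuous_neg
    exact h1.vadd continuous_const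
  have h2 := (hc.edist (continuous_const (y := hφ1.toLp φ))).tendsto 0
  have h3 : ∀ u : Vec p, edist ((DomAddAct.mk (-u)) +ᵥ hφ1.toLp φ) (hφ1.toLp φ) =
      ∫⁻ x, ‖φ (x - u) - φ x‖ₑ := by
    intro u
    rw [DomAddAct.mk_vadd_toLp, Lp.edist_toLp_toLp, eLpNorm_one_eq_lintegral_enorm]
    refine lintegral_congr fun x => ?_
    simp [sub_eq_neg_add]
  simp only [h3] at h2
  simpa using h2

/-- Convolution with the rescaled kernel approximates the identity in `L¹`. -/
theorem tendsto_lintegral_convolution_sub {K : Vec p → ℝ} (hK : Continuous K)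
    (hK0 : ∀ u, 0 ≤ K u) (hK1 : ∫ u, K u = 1) {h : ℕ → ℝ} (hh : ∀ᶠ n in atTop, 0 < h n)
    (hh0 : Tendsto h atTop (𝓝 0)) {φ : Vec p → ℝ} (hφm : Measurable φ) (hφ : Integrable φ)
    {B : ℝ} (hB : ∀ x, |φ x| ≤ B) :
    Tendsto (fun n => ∫⁻ x, ‖(∫ x', φ x' * scaledKernel K (h n) (x - x')) - φ x‖ₑ) atTop
      (𝓝 0) := by
  let ω : Vec p → ℝ≥0∞ := fun u => ∫⁻ x, ‖φ (x - u) - φ x‖ₑ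
  have hωm : Measurable ω := by
    have : Measurable fun q : Vec p × Vec p => ‖φ (q.2 - q.1) - φ q.2‖ₑ := by fun_prop
    exact this.lintegral_prod_right'
  have hωle : ∀ u, ω u ≤ 2 * ∫⁻ x, ‖φ x‖ₑ := by
    intro u
    calc ω u ≤ ∫⁻ x, (‖φ (x - u)‖ₑ + ‖φ x‖ₑ) := lintegral_mono fun x => enorm_sub_le
      _ = _ := by
        rw [lintegral_add_left (by fun_prop), lintegral_sub_right_eq_self (fun x => ‖φ x‖ₑ),
          two_mul]
  have hbound : ∀ᶠ n in atTop, ∫⁻ x, ‖(∫ x', φ x' * scaledKernel K (h n) (x - x')) - φ x‖ₑ ≤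
      ∫⁻ v, ENNReal.ofReal (K v) * ω (h n • v) := by
    filter_upwards [hh] with n hn
    have hkm := measurable_scaledKernel hK (h n)
    have hk0 := scaledKernel_nonneg hK0 hn
    have hkL := lintegral_scaledKernel hK hK0 hK1 hn
    have hki : Integrable (scaledKernel K (h n)) := by
      refine ⟨hkm.aestronglyMeasurable, ?_⟩
      rw [hasFiniteIntegral_iff_ofReal (Eventually.of_forall hk0), hkL]
      exact ENNReal.one_lt_top
    have hk1 : ∫ u, scaledKernel K (h n) u = 1 := by
      rw [integral_eq_lintegral_of_nonneg_ae (Eventually.of_forall hk0) hkm.aestronglyMeasurable,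
        hkL, ENNReal.toReal_one]
    have hpt : ∀ x, ‖(∫ x', φ x' * scaledKernel K (h n) (x - x')) - φ x‖ₑ ≤
        ∫⁻ u, ENNReal.ofReal (scaledKernel K (h n) u) * ‖φ (x - u) - φ x‖ₑ := by
      intro x
      have e1 : ∫ x', φ x' * scaledKernel K (h n) (x - x') =
          ∫ u, φ (x - u) * scaledKernel K (h n) u := by
        rw [← integral_sub_left_eq_self (fun u => φ (x - u) * scaledKernel K (h n) u) volume x]
        simp
      have e2 : φ x = ∫ u, φ x * scaledKernel K (h n) u := by
        rw [integral_const_mul, hk1, mul_one]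
      have i1 : Integrable fun u => φ (x - u) * scaledKernel K (h n) u :=
        hki.bdd_mul (c := B)
          (hφm.comp (measurable_const.sub measurable_id)).aestronglyMeasurable
          (Eventually.of_forall fun u => hB _)
      have e3 : (∫ x', φ x' * scaledKernel K (h n) (x - x')) - φ x =
          ∫ u, (φ (x - u) - φ x) * scaledKernel K (h n) u := by
        rw [e1]
        conv_lhs => rw [e2]
        rw [← integral_sub i1 (hki.const_mul _)]
        simp only [sub_mul]
      rw [e3]
      refine (enorm_integral_le_lintegral_enorm _).trans_eq (lintegral_congr fun u => ?_)
      rw [enorm_mul, mul_comm, Real.enorm_of_nonneg (hk0 u)]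
    calc _ ≤ ∫⁻ x, ∫⁻ u, ENNReal.ofReal (scaledKernel K (h n) u) * ‖φ (x - u) - φ x‖ₑ :=
          lintegral_mono hpt
      _ = ∫⁻ u, ∫⁻ x, ENNReal.ofReal (scaledKernel K (h n) u) * ‖φ (x - u) - φ x‖ₑ :=
          lintegral_lintegral_swap (by fun_prop)
      _ = ∫⁻ u, ENNReal.ofReal (scaledKernel K (h n) u) * ω u := by
          refine lintegral_congr fun u => ?_
          rw [lintegral_const_mul _ (by fun_prop)]
      _ = _ := lintegral_scaledKernel_mul hK hn hωm
  have hKm := hK.measurable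
  have hlim : Tendsto (fun n => ∫⁻ v, ENNReal.ofReal (K v) * ω (h n • v)) atTop (𝓝 0) := by
    have := tendsto_lintegral_of_dominated_convergence (μ := (volume : Measure (Vec p)))
      (F := fun n v => ENNReal.ofReal (K v) * ω (h n • v)) (f := fun _ => 0)
      (fun v => ENNReal.ofReal (K v) * (2 * ∫⁻ x, ‖φ x‖ₑ)) (fun n => by fun_prop)
      (fun n => Eventually.of_forall fun v => mul_le_mul' le_rfl (hωle _))
      (by
        rw [lintegral_mul_const _ (by fun_prop), lintegral_ofReal_kernel hK0 hK1, one_mul]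
        exact ENNReal.mul_ne_top (by simp) hφ.2.ne)
      (Eventually.of_forall fun v => by
        have h1 : Tendsto (fun n => h n • v) atTop (𝓝 0) := by
          simpa using hh0.smul_const v
        have h2 := ENNReal.Tendsto.const_mul (a := ENNReal.ofReal (K v))
          ((tendsto_lintegral_translation hφ).comp h1) (Or.inr ENNReal.ofReal_ne_top)
        simpa using h2)
    simpa using this
  exact tendsto_of_tendsto_of_tendsto_of_le_of_le' tendsto_const_nhds hlim
    (Eventually.of_forall fun _ => zero_le) hbound

end ApproximateIdentity

/-! ### A bilinear bound for kernel-weighted moments -/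

section BilinearBound

variable {p : ℕ} {ρ : Measure (Vec p × ℝ)} {f : Vec p → ℝ}

theorem lintegral_fst_eq (hf : Measurable f)
    (hρ : ρ.map Prod.fst = volume.withDensity fun u => ENNReal.ofReal (f u))
    {φ : Vec p → ℝ≥0∞} (hφ : Measurable φ) :
    ∫⁻ z, φ z.1 ∂ρ = ∫⁻ x, ENNReal.ofReal (f x) * φ x := by
  rw [← lintegral_map hφ measurable_fst, hρ,
    lintegral_withDensity_eq_lintegral_mul _ (by fun_prop) hφ]
  rfl

theorem ae_withDensity_pos (hf : Measurable f) :
    ∀ᵐ u ∂(volume.withDensity fun u => ENNReal.ofReal (f u)), 0 < f u := by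
  rw [ae_withDensity_iff (by fun_prop)]
  exact Eventually.of_forall fun u hu => by simpa using hu

/-- The weighted second moment `E[s(Z)² f(X)]`. -/
noncomputable def weightedMoment (ρ : Measure (Vec p × ℝ)) (f : Vec p → ℝ)
    (s : Vec p × ℝ → ℝ≥0∞) : ℝ≥0∞ :=
  ∫⁻ z, s z ^ 2 * ENNReal.ofReal (f z.1) ∂ρ

/-- The density cancels against its inverse; only the set where it is positive contributes, whence
the inequality. -/
theorem lintegral_kernel_div_le (hf : Measurable f)
    (hρ : ρ.map Prod.fst = volume.withDensity fun u => ENNReal.ofReal (f u))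
    {k : Vec p → ℝ≥0∞} (hk : Measurable k) (hk1 : ∫⁻ u, k u ≤ 1) :
    ∫⁻ z, k z.1 * (ENNReal.ofReal (f z.1))⁻¹ ∂ρ ≤ 1 := by
  rw [lintegral_fst_eq hf hρ (φ := fun x => k x * (ENNReal.ofReal (f x))⁻¹) (by fun_prop)]
  refine (lintegral_mono fun x => ?_).trans hk1
  by_cases h0 : ENNReal.ofReal (f x) = 0
  · simp [h0]
  · rw [mul_left_comm, ENNReal.mul_inv_cancel h0 ENNReal.ofReal_ne_top, mul_one]

/-- The kernel-weighted product moment is bounded by weighted second moments. The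
Cauchy-Schwarz inequality is applied to the factors `e(z) (f(x) / f(x'))^(1/2) k(x - x')^(1/2)` and
`s(z') (f(x') / f(x))^(1/2) k(x - x')^(1/2)`: integrating `k(x - x') / f(x')` over the second
observation gives at most `∫ k = 1`. -/
theorem lintegral_lintegral_kernel_le [SFinite ρ] (hf : Measurable f)
    (hρ : ρ.map Prod.fst = volume.withDensity fun u => ENNReal.ofReal (f u))
    {k : Vec p → ℝ≥0∞} (hk : Measurable k) (hk1 : ∫⁻ u, k u ≤ 1)
    {e s : Vec p × ℝ → ℝ≥0∞} (he : Measurable e) (hs : Measurable s) :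
    ∫⁻ z, ∫⁻ z', e z * s z' * k (z.1 - z'.1) ∂ρ ∂ρ ≤
      weightedMoment ρ f e ^ (1 / 2 : ℝ) * weightedMoment ρ f s ^ (1 / 2 : ℝ) := by
  let D : Vec p × ℝ → ℝ≥0∞ := fun z => ENNReal.ofReal (f z.1)
  have hD : Measurable D := by fun_prop
  let F : (Vec p × ℝ) × (Vec p × ℝ) → ℝ≥0∞ := fun q =>
    e q.1 * (D q.1 * (k (q.1.1 - q.2.1) * (D q.2)⁻¹)) ^ (1 / 2 : ℝ)
  let H : (Vec p × ℝ) × (Vec p × ℝ) → ℝ≥0∞ := fun q =>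
    s q.2 * (D q.2 * (k (q.1.1 - q.2.1) * (D q.1)⁻¹)) ^ (1 / 2 : ℝ)
  have hF : Measurable F := by fun_prop
  have hH : Measurable H := by fun_prop
  have hsq : ∀ a b : ℝ≥0∞, (a * b ^ (1 / 2 : ℝ)) ^ (2 : ℝ) = a ^ 2 * b := by
    intro a b
    rw [ENNReal.mul_rpow_of_nonneg _ _ (by norm_num), ← ENNReal.rpow_mul]
    norm_num
  have hpos : ∀ᵐ z ∂ρ, 0 < f z.1 :=
    ae_of_ae_map measurable_fst.aemeasurable (hρ ▸ ae_withDensity_pos hf)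
  have hFH : ∀ᵐ z ∂ρ, ∀ᵐ z' ∂ρ, e z * s z' * k (z.1 - z'.1) = F (z, z') * H (z, z') := by
    filter_upwards [hpos] with z hz
    filter_upwards [hpos] with z' hz'
    have d1 : D z ≠ 0 := by simpa [D] using hz
    have d2 : D z' ≠ 0 := by simpa [D] using hz'
    have d3 : D z ≠ ∞ := ENNReal.ofReal_ne_top
    have d4 : D z' ≠ ∞ := ENNReal.ofReal_ne_top
    simp only [F, H]
    have : (D z * (k (z.1 - z'.1) * (D z')⁻¹)) ^ (1 / 2 : ℝ) *
        (D z' * (k (z.1 - z'.1) * (D z)⁻¹)) ^ (1 / 2 : ℝ) = k (z.1 - z'.1) := by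
      rw [← ENNReal.mul_rpow_of_nonneg _ _ (by norm_num)]
      have : D z * (k (z.1 - z'.1) * (D z')⁻¹) * (D z' * (k (z.1 - z'.1) * (D z)⁻¹)) =
          (D z * (D z)⁻¹) * (D z' * (D z')⁻¹) * k (z.1 - z'.1) ^ 2 := by ring
      rw [this, ENNReal.mul_inv_cancel d1 d3, ENNReal.mul_inv_cancel d2 d4, one_mul, one_mul,
        ← ENNReal.rpow_natCast, ← ENNReal.rpow_mul]
      norm_num
    calc _ = e z * s z' * ((D z * (k (z.1 - z'.1) * (D z')⁻¹)) ^ (1 / 2 : ℝ) *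
        (D z' * (k (z.1 - z'.1) * (D z)⁻¹)) ^ (1 / 2 : ℝ)) := by rw [this]
      _ = _ := by ring
  have h1 : ∫⁻ z, ∫⁻ z', e z * s z' * k (z.1 - z'.1) ∂ρ ∂ρ = ∫⁻ q, (F * H) q ∂(ρ.prod ρ) := by
    rw [lintegral_prod _ (hF.mul hH).aemeasurable]
    refine lintegral_congr_ae ?_
    filter_upwards [hFH] with z hz
    exact lintegral_congr_ae hz
  have hF2 : ∫⁻ q, F q ^ (2 : ℝ) ∂(ρ.prod ρ) ≤ weightedMoment ρ f e := by
    simp only [F, hsq]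
    rw [lintegral_prod _ (by fun_prop)]
    refine lintegral_mono fun z => ?_
    calc ∫⁻ z', e z ^ 2 * (D z * (k (z.1 - z'.1) * (D z')⁻¹)) ∂ρ
        = e z ^ 2 * D z * ∫⁻ z', k (z.1 - z'.1) * (D z')⁻¹ ∂ρ := by
          rw [← lintegral_const_mul _ (by fun_prop)]
          simp only [mul_assoc]
      _ ≤ e z ^ 2 * D z * 1 := by
          gcongr
          refine lintegral_kernel_div_le hf hρ (k := fun u => k (z.1 - u)) (by fun_prop) ?_
          rwa [lintegral_sub_left_eq_self (fun u => k u)]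
      _ = _ := by rw [mul_one]
  have hH2 : ∫⁻ q, H q ^ (2 : ℝ) ∂(ρ.prod ρ) ≤ weightedMoment ρ f s := by
    simp only [H, hsq]
    rw [lintegral_prod_symm _ (by fun_prop)]
    refine lintegral_mono fun z => ?_
    calc ∫⁻ z', s z ^ 2 * (D z * (k (z'.1 - z.1) * (D z')⁻¹)) ∂ρ
        = s z ^ 2 * D z * ∫⁻ z', k (z'.1 - z.1) * (D z')⁻¹ ∂ρ := by
          rw [← lintegral_const_mul _ (by fun_prop)]
          simp only [mul_assoc]
      _ ≤ s z ^ 2 * D z * 1 := by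
          gcongr
          refine lintegral_kernel_div_le hf hρ (k := fun u => k (u - z.1)) (by fun_prop) ?_
          rwa [lintegral_sub_right_eq_self (fun u => k u)]
      _ = _ := by rw [mul_one]
  rw [h1]
  refine (ENNReal.lintegral_mul_le_Lp_mul_Lq (ρ.prod ρ) Real.HolderConjugate.two_two
    hF.aemeasurable hH.aemeasurable).trans ?_
  gcongr

end BilinearBound

/-! ### Moment bounds and convergence in probability -/

section Markov

variable {Ω : Type*} [MeasurableSpace Ω] {P : Measure Ω}

theorem tendsto_zero_of_lintegral_enorm {W : ℕ × Ω → ℝ}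
    (hm : ∀ n, AEMeasurable (fun ω => W (n, ω)) P) {b : ℕ → ℝ≥0∞}
    (hb : ∀ᶠ n in atTop, ∫⁻ ω, ‖W (n, ω)‖ₑ ∂P ≤ b n) (hb0 : Tendsto b atTop (𝓝 0)) :
    Tendsto W (probFilter P) (𝓝 0) := by
  rw [EMetric.tendsto_nhds]
  intro ε hε
  rw [eventually_probFilter]
  by_cases hεt : ε = ∞
  · simp [hεt]
  have h0 : Tendsto (fun n => b n / ε) atTop (𝓝 0) := by
    simpa using ENNReal.Tendsto.div_const hb0 (Or.inr hε.ne')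
  refine tendsto_of_tendsto_of_tendsto_of_le_of_le' tendsto_const_nhds h0
    (Eventually.of_forall fun _ => zero_le) ?_
  filter_upwards [hb] with n hn
  have h1 := meas_ge_le_lintegral_div (hm n).enorm hε.ne' hεt
  simp only [edist_zero_right, not_lt]
  exact h1.trans (ENNReal.div_le_div_right hn _)

theorem tendsto_zero_of_integral_sq {W : ℕ × Ω → ℝ}
    (hm : ∀ n, AEMeasurable (fun ω => W (n, ω)) P)
    {b : ℕ → ℝ} (hb : ∀ᶠ n in atTop, Integrable (fun ω => W (n, ω) ^ 2) P ∧
      ∫ ω, W (n, ω) ^ 2 ∂P ≤ b n) (hb0 : Tendsto b atTop (𝓝 0)) :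
    Tendsto W (probFilter P) (𝓝 0) := by
  have h1 : Tendsto (fun a => W a ^ 2) (probFilter P) (𝓝 0) := by
    refine tendsto_zero_of_lintegral_enorm (b := fun n => ENNReal.ofReal (b n))
      (fun n => (hm n).pow_const 2) ?_ (by simpa using ENNReal.tendsto_ofReal hb0)
    filter_upwards [hb] with n ⟨hint, hn⟩
    rw [← ofReal_integral_norm_eq_lintegral_enorm hint]
    refine ENNReal.ofReal_le_ofReal ?_
    simpa using hn
  have h2 : Tendsto (fun a => |W a|) (probFilter P) (𝓝 0) := by
    have := (Real.continuous_sqrt.tendsto 0).comp h1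
    simpa [Function.comp_def, Real.sqrt_sq_eq_abs] using this
  exact (tendsto_zero_iff_abs_tendsto_zero _).2 h2

end Markov

/-! ### Means over pairs of independent observations -/

section Pairs

variable {Ω : Type*} [MeasurableSpace Ω] {P : Measure Ω} [IsProbabilityMeasure P]
  {Z : Type*} [MeasurableSpace Z] {ρ : Measure Z} {z : ℕ → Ω → Z}

theorem IsIIDSample.map_pair (hs : IsIIDSample P ρ z) {j k : ℕ} (hjk : j ≠ k) :
    P.map (fun ω => (z j ω, z k ω)) = ρ.prod ρ := by
  rw [(indepFun_iff_map_prod_eq_prod_map_map (hs.aemeasurable j) (hs.aemeasurable k)).1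
    (hs.indep.indepFun hjk), hs.law, hs.law]

theorem IsIIDSample.map_triple (hs : IsIIDSample P ρ z) {j k l : ℕ} (hjk : j ≠ k) (hjl : j ≠ l)
    (hkl : k ≠ l) :
    P.map (fun ω => ((z j ω, z k ω), z l ω)) = (ρ.prod ρ).prod ρ := by
  rw [(indepFun_iff_map_prod_eq_prod_map_map ((hs.aemeasurable j).prodMk (hs.aemeasurable k))
    (hs.aemeasurable l)).1 (hs.indep.indepFun_prodMk₀ hs.aemeasurable j k l hjl hkl),
    hs.law, hs.map_pair hjk]

theorem IsIIDSample.lintegral_sum_pairs (hs : IsIIDSample P ρ z) {φ : Z × Z → ℝ≥0∞}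
    (hφ : Measurable φ) (n : ℕ) :
    ∫⁻ ω, ∑ j ∈ Finset.range n, ∑ k ∈ (Finset.range n).erase j, φ (z j ω, z k ω) ∂P =
      (n : ℝ≥0∞) * ((n - 1 : ℕ) : ℝ≥0∞) * ∫⁻ q, φ q ∂(ρ.prod ρ) := by
  have hm : ∀ j k, AEMeasurable (fun ω => φ (z j ω, z k ω)) P := fun j k =>
    hφ.comp_aemeasurable ((hs.aemeasurable j).prodMk (hs.aemeasurable k))
  rw [lintegral_finsetSum' _ fun j _ => Finset.aemeasurable_fun_sum _ fun k _ => hm j k]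
  have h1 : ∀ j ∈ Finset.range n,
      ∫⁻ ω, ∑ k ∈ (Finset.range n).erase j, φ (z j ω, z k ω) ∂P =
        ((n - 1 : ℕ) : ℝ≥0∞) * ∫⁻ q, φ q ∂(ρ.prod ρ) := by
    intro j hj
    rw [lintegral_finsetSum' _ fun k _ => hm j k]
    have h2 : ∀ k ∈ (Finset.range n).erase j,
        ∫⁻ ω, φ (z j ω, z k ω) ∂P = ∫⁻ q, φ q ∂(ρ.prod ρ) := by
      intro k hk
      rw [← hs.map_pair (Finset.ne_of_mem_erase hk).symm,
        lintegral_map' hφ.aemeasurable ((hs.aemeasurable j).prodMk (hs.aemeasurable k))]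
    rw [Finset.sum_congr rfl h2, Finset.sum_const, Finset.card_erase_of_mem hj,
      Finset.card_range, nsmul_eq_mul]
  rw [Finset.sum_congr rfl h1, Finset.sum_const, Finset.card_range, nsmul_eq_mul, mul_assoc]

/-- Given `z j`, the variables `G(z j, z k)` are conditionally centered and independent, so the
second moment of their sum is the sum of the second moments. -/
theorem IsIIDSample.integral_sq_sum (hs : IsIIDSample P ρ z) {G : Z × Z → ℝ}
    (hG : Measurable G) {B : ℝ} (hB : ∀ q, |G q| ≤ B) (hG0 : ∀ u, ∫ v, G (u, v) ∂ρ = 0)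
    {j : ℕ} {s : Finset ℕ} (hj : j ∉ s) :
    ∫ ω, (∑ k ∈ s, G (z j ω, z k ω)) ^ 2 ∂P = s.card * ∫ q, G q ^ 2 ∂(ρ.prod ρ) := by
  have := hs.isProbabilityMeasure
  have hmp : ∀ k, AEMeasurable (fun ω => (z j ω, z k ω)) P := fun k =>
    (hs.aemeasurable j).prodMk (hs.aemeasurable k)
  have hm : ∀ k, AEMeasurable (fun ω => G (z j ω, z k ω)) P := fun k =>
    hG.comp_aemeasurable (hmp k)
  have hint : ∀ k l, Integrable (fun ω => G (z j ω, z k ω) * G (z j ω, z l ω)) P := fun k l =>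
    Integrable.of_bound ((hm k).mul (hm l)).aestronglyMeasurable (B * B)
      (Eventually.of_forall fun ω => by
        rw [norm_mul]
        exact mul_le_mul (hB _) (hB _) (norm_nonneg _) ((abs_nonneg _).trans (hB (z j ω, z k ω))))
  have hterm : ∀ k ∈ s, ∀ l ∈ s, ∫ ω, G (z j ω, z k ω) * G (z j ω, z l ω) ∂P =
      if k = l then ∫ q, G q ^ 2 ∂(ρ.prod ρ) else 0 := by
    intro k hk l hl
    have hjk : j ≠ k := fun h => hj (h ▸ hk)
    have hjl : j ≠ l := fun h => hj (h ▸ hl)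
    split_ifs with hkl
    · subst hkl
      rw [← hs.map_pair hjk, integral_map (hmp k) (by fun_prop)]
      simp only [pow_two]
    · have hφ : Measurable fun q : (Z × Z) × Z => G q.1 * G (q.1.1, q.2) := by fun_prop
      have h1 : ∫ ω, G (z j ω, z k ω) * G (z j ω, z l ω) ∂P =
          ∫ q, G q.1 * G (q.1.1, q.2) ∂((ρ.prod ρ).prod ρ) := by
        rw [← hs.map_triple hjk hjl hkl,
          integral_map ((hmp k).prodMk (hs.aemeasurable l)) hφ.aestronglyMeasurable]
      rw [h1, integral_prod]
      · simp [integral_const_mul, hG0]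
      · exact Integrable.of_bound hφ.aestronglyMeasurable (B * B)
          (Eventually.of_forall fun q => by
            rw [norm_mul]
            exact mul_le_mul (hB _) (hB _) (norm_nonneg _) ((abs_nonneg _).trans (hB q.1)))
  have hexp : ∀ ω, (∑ k ∈ s, G (z j ω, z k ω)) ^ 2 =
      ∑ k ∈ s, ∑ l ∈ s, G (z j ω, z k ω) * G (z j ω, z l ω) := by
    intro ω
    rw [pow_two, Finset.sum_mul_sum]
  simp_rw [hexp]
  rw [integral_finsetSum _ fun k _ => integrable_finsetSum _ fun l _ => hint k l]
  have : ∀ k ∈ s, ∫ ω, ∑ l ∈ s, G (z j ω, z k ω) * G (z j ω, z l ω) ∂P =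
      ∫ q, G q ^ 2 ∂(ρ.prod ρ) := by
    intro k hk
    rw [integral_finsetSum _ fun l _ => hint k l, Finset.sum_congr rfl (hterm k hk),
      Finset.sum_ite_eq, if_pos hk]
  rw [Finset.sum_congr rfl this, Finset.sum_const, nsmul_eq_mul]

/-- The mean of a bounded `H` over the pairs of distinct observations differs from the sample mean
of its projection `u ↦ E H(u, Z)` by at most `E H(Z, Z')² / (n - 1)` in mean square. -/
theorem IsIIDSample.integral_sq_pairMean_sub_le (hs : IsIIDSample P ρ z) {H : Z × Z → ℝ}
    (hH : Measurable H) {B : ℝ} (hB : ∀ q, |H q| ≤ B) {n : ℕ} (hn : 2 ≤ n) :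
    ∫ ω, ((1 / ((n : ℝ) * ((n : ℝ) - 1))) *
        ∑ j ∈ Finset.range n, ∑ k ∈ (Finset.range n).erase j, H (z j ω, z k ω) -
        (n : ℝ)⁻¹ * ∑ j ∈ Finset.range n, ∫ v, H (z j ω, v) ∂ρ) ^ 2 ∂P ≤
      ((n : ℝ) - 1)⁻¹ * ∫ q, H q ^ 2 ∂(ρ.prod ρ) := by
  have := hs.isProbabilityMeasure
  have hn1 : (0 : ℝ) < (n : ℝ) - 1 := by
    have : (2 : ℝ) ≤ n := by exact_mod_cast hn
    linarith
  have hn0 : (0 : ℝ) < n := by linarith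
  have hH1m : Measurable fun u => ∫ v, H (u, v) ∂ρ :=
    (hH.stronglyMeasurable.integral_prod_right').measurable
  have hH1B : ∀ u, |∫ v, H (u, v) ∂ρ| ≤ B := by
    intro u
    have := norm_integral_le_of_norm_le_const (μ := ρ) (f := fun v => H (u, v))
      (Eventually.of_forall fun v => hB _)
    simpa using this
  have hHi : ∀ u, Integrable (fun v => H (u, v)) ρ := fun u =>
    Integrable.of_bound (hH.comp measurable_prodMk_left).aestronglyMeasurable B
      (Eventually.of_forall fun v => hB _)
  let G : Z × Z → ℝ := fun q => H q - ∫ v, H (q.1, v) ∂ρ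
  have hGm : Measurable G := hH.sub (hH1m.comp measurable_fst)
  have hGB : ∀ q, |G q| ≤ B + B := fun q =>
    (abs_sub _ _).trans (add_le_add (hB _) (hH1B _))
  have hG0 : ∀ u, ∫ v, G (u, v) ∂ρ = 0 := by
    intro u
    simp only [G]
    rw [integral_sub (hHi u) (integrable_const _)]
    simp
  have hsqi : ∀ {F : Z × Z → ℝ} {B' : ℝ}, Measurable F → (∀ q, |F q| ≤ B') →
      Integrable (fun q => F q ^ 2) (ρ.prod ρ) := fun {F B'} hF hFB =>
    Integrable.of_bound (hF.pow_const 2).aestronglyMeasurable (B' ^ 2)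
      (Eventually.of_forall fun q => by
        rw [norm_pow]; exact pow_le_pow_left₀ (norm_nonneg _) (hFB q) 2)
  have hGH : ∫ q, G q ^ 2 ∂(ρ.prod ρ) ≤ ∫ q, H q ^ 2 ∂(ρ.prod ρ) := by
    rw [integral_prod _ (hsqi hGm hGB), integral_prod _ (hsqi hH hB)]
    refine integral_mono (hsqi hGm hGB).integral_prod_left (hsqi hH hB).integral_prod_left
      fun u => ?_
    have hm := (hH.comp (measurable_prodMk_left (x := u))).aemeasurable (μ := ρ)
    have h1 := variance_eq_integral hm
    have h2 := variance_le_expectation_sq (μ := ρ) hm.aestronglyMeasurable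
    simp only [Function.comp_def] at h1 h2
    rw [h1] at h2
    exact h2
  have hident : ∀ ω, (1 / ((n : ℝ) * ((n : ℝ) - 1))) *
        ∑ j ∈ Finset.range n, ∑ k ∈ (Finset.range n).erase j, H (z j ω, z k ω) -
        (n : ℝ)⁻¹ * ∑ j ∈ Finset.range n, ∫ v, H (z j ω, v) ∂ρ =
      (n : ℝ)⁻¹ * ((n : ℝ) - 1)⁻¹ *
        ∑ j ∈ Finset.range n, ∑ k ∈ (Finset.range n).erase j, G (z j ω, z k ω) := by
    intro ω
    have h1 : ∀ j ∈ Finset.range n, ∑ k ∈ (Finset.range n).erase j, G (z j ω, z k ω) =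
        (∑ k ∈ (Finset.range n).erase j, H (z j ω, z k ω)) -
          ((n : ℝ) - 1) * ∫ v, H (z j ω, v) ∂ρ := by
      intro j hj
      simp only [G]
      rw [Finset.sum_sub_distrib, Finset.sum_const, Finset.card_erase_of_mem hj,
        Finset.card_range, nsmul_eq_mul, Nat.cast_sub (by omega), Nat.cast_one]
    rw [Finset.sum_congr rfl h1, Finset.sum_sub_distrib, ← Finset.mul_sum]
    field_simp
  simp_rw [hident]
  have hmp : ∀ j k, AEMeasurable (fun ω => G (z j ω, z k ω)) P := fun j k =>
    hGm.comp_aemeasurable ((hs.aemeasurable j).prodMk (hs.aemeasurable k))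
  have hDi : ∀ j, Integrable
      (fun ω => (∑ k ∈ (Finset.range n).erase j, G (z j ω, z k ω)) ^ 2) P := by
    intro j
    refine Integrable.of_bound ((Finset.aemeasurable_fun_sum _ fun k _ => hmp j k).pow_const
      2).aestronglyMeasurable ((∑ k ∈ (Finset.range n).erase j, (B + B)) ^ 2)
      (Eventually.of_forall fun ω => ?_)
    rw [norm_pow]
    exact pow_le_pow_left₀ (norm_nonneg _)
      ((norm_sum_le _ _).trans (Finset.sum_le_sum fun k _ => hGB _)) 2
  calc _ ≤ ∫ ω, ((n : ℝ)⁻¹ * ((n : ℝ) - 1)⁻¹) ^ 2 * ((n : ℝ) *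
          ∑ j ∈ Finset.range n, (∑ k ∈ (Finset.range n).erase j, G (z j ω, z k ω)) ^ 2) ∂P := by
        refine integral_mono_of_nonneg (Eventually.of_forall fun ω => sq_nonneg _)
          (((integrable_finsetSum _ fun j _ => hDi j).const_mul _).const_mul _)
          (Eventually.of_forall fun ω => ?_)
        simp only [mul_pow _ (∑ j ∈ Finset.range n, _)]
        gcongr
        have := sq_sum_le_card_mul_sum_sq (s := Finset.range n)
          (f := fun j => ∑ k ∈ (Finset.range n).erase j, G (z j ω, z k ω))
        simpa using this
    _ = ((n : ℝ)⁻¹ * ((n : ℝ) - 1)⁻¹) ^ 2 * ((n : ℝ) *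
          ∑ j ∈ Finset.range n, (((n : ℝ) - 1) * ∫ q, G q ^ 2 ∂(ρ.prod ρ))) := by
        rw [integral_const_mul, integral_const_mul, integral_finsetSum _ fun j _ => hDi j]
        congr 2
        refine Finset.sum_congr rfl fun j hj => ?_
        rw [hs.integral_sq_sum hGm hGB hG0 (Finset.notMem_erase j _),
          Finset.card_erase_of_mem hj, Finset.card_range, Nat.cast_sub (by omega), Nat.cast_one]
    _ = ((n : ℝ) - 1)⁻¹ * ∫ q, G q ^ 2 ∂(ρ.prod ρ) := by
        rw [Finset.sum_const, Finset.card_range, nsmul_eq_mul]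
        field_simp
    _ ≤ _ := by gcongr

end Pairs

/-! ### Triangular arrays of sample means and pair means -/

section Averages

variable {Ω : Type*} [MeasurableSpace Ω] {P : Measure Ω} [IsProbabilityMeasure P]
  {Z : Type*} [MeasurableSpace Z] {ρ : Measure Z} {z : ℕ → Ω → Z}

theorem IsIIDSample.lintegral_enorm_average_le (hs : IsIIDSample P ρ z) {ψ : Z → ℝ}
    (hψ : Measurable ψ) (n : ℕ) :
    ∫⁻ ω, ‖(n : ℝ)⁻¹ * ∑ j ∈ Finset.range n, ψ (z j ω)‖ₑ ∂P ≤ ∫⁻ u, ‖ψ u‖ₑ ∂ρ := by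
  rcases Nat.eq_zero_or_pos n with rfl | hn
  · simp
  have hm : ∀ j, AEMeasurable (fun ω => ‖ψ (z j ω)‖ₑ) P := fun j =>
    hψ.enorm.comp_aemeasurable (hs.aemeasurable j)
  calc _ ≤ ∫⁻ ω, ‖(n : ℝ)⁻¹‖ₑ * ∑ j ∈ Finset.range n, ‖ψ (z j ω)‖ₑ ∂P := by
        refine lintegral_mono fun ω => ?_
        rw [enorm_mul]
        gcongr
        exact enorm_sum_le _ _
    _ = ‖(n : ℝ)⁻¹‖ₑ * ∑ _j ∈ Finset.range n, ∫⁻ u, ‖ψ u‖ₑ ∂ρ := by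
        rw [lintegral_const_mul' _ _ (by simp), lintegral_finsetSum' _ fun j _ => hm j]
        congr 1
        refine Finset.sum_congr rfl fun j _ => ?_
        rw [← hs.law j, lintegral_map' hψ.enorm.aemeasurable (hs.aemeasurable j)]
    _ = _ := by
        have hn0 : (n : ℝ≥0∞) ≠ 0 := by exact_mod_cast hn.ne'
        rw [Finset.sum_const, Finset.card_range, nsmul_eq_mul, ← mul_assoc,
          enorm_inv (by exact_mod_cast hn.ne'), Real.enorm_of_nonneg (Nat.cast_nonneg n),
          ENNReal.ofReal_natCast,
          ENNReal.inv_mul_cancel hn0 (ENNReal.natCast_ne_top n), one_mul]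

theorem IsIIDSample.tendsto_average_zero (hs : IsIIDSample P ρ z) {ψ : ℕ → Z → ℝ}
    (hψ : ∀ n, Measurable (ψ n)) (hψ0 : Tendsto (fun n => ∫⁻ u, ‖ψ n u‖ₑ ∂ρ) atTop (𝓝 0)) :
    Tendsto (fun q : ℕ × Ω => (q.1 : ℝ)⁻¹ * ∑ j ∈ Finset.range q.1, ψ q.1 (z j q.2))
      (probFilter P) (𝓝 0) :=
  tendsto_zero_of_lintegral_enorm
    (fun n => by
      have : AEMeasurable (fun ω => ∑ j ∈ Finset.range n, ψ n (z j ω)) P :=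
        Finset.aemeasurable_fun_sum _ fun j _ => (hψ n).comp_aemeasurable (hs.aemeasurable j)
      exact this.const_mul ((n : ℝ)⁻¹))
    (Eventually.of_forall fun n => hs.lintegral_enorm_average_le (hψ n) n) hψ0

/-- The mean over pairs of a kernel that varies with `n` is asymptotically the sample mean of its
projection, provided the second moments are of smaller order than `n`. -/
theorem IsIIDSample.tendsto_pairMean_sub (hs : IsIIDSample P ρ z) {H : ℕ → Z × Z → ℝ}
    (hH : ∀ n, Measurable (H n)) {B : ℕ → ℝ} (hB : ∀ n q, |H n q| ≤ B n) {b : ℕ → ℝ}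
    (hb : ∀ᶠ n : ℕ in atTop, ((n : ℝ) - 1)⁻¹ * ∫ q, H n q ^ 2 ∂(ρ.prod ρ) ≤ b n)
    (hb0 : Tendsto b atTop (𝓝 0)) :
    Tendsto (fun q : ℕ × Ω => (1 / ((q.1 : ℝ) * ((q.1 : ℝ) - 1))) *
        ∑ j ∈ Finset.range q.1, ∑ l ∈ (Finset.range q.1).erase j, H q.1 (z j q.2, z l q.2) -
        (q.1 : ℝ)⁻¹ * ∑ j ∈ Finset.range q.1, ∫ v, H q.1 (z j q.2, v) ∂ρ)
      (probFilter P) (𝓝 0) := by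
  have := hs.isProbabilityMeasure
  have hz := hs.aemeasurable
  have hL : ∀ n : ℕ, MemLp (fun ω => (1 / ((n : ℝ) * ((n : ℝ) - 1))) *
        ∑ j ∈ Finset.range n, ∑ l ∈ (Finset.range n).erase j, H n (z j ω, z l ω) -
        (n : ℝ)⁻¹ * ∑ j ∈ Finset.range n, ∫ v, H n (z j ω, v) ∂ρ) 2 P := by
    intro n
    have e1 : ∀ j l, MemLp (fun ω => H n (z j ω, z l ω)) 2 P := fun j l =>
      MemLp.of_bound ((hH n).comp_aemeasurable ((hz j).prodMk (hz l))).aestronglyMeasurable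
        (B n) (Eventually.of_forall fun ω => hB n _)
    have e2 : ∀ j, MemLp (fun ω => ∫ v, H n (z j ω, v) ∂ρ) 2 P := by
      intro j
      have hm : Measurable fun u => ∫ v, H n (u, v) ∂ρ :=
        ((hH n).stronglyMeasurable.integral_prod_right').measurable
      refine MemLp.of_bound (hm.comp_aemeasurable (hz j)).aestronglyMeasurable (B n)
        (Eventually.of_forall fun ω => ?_)
      have := norm_integral_le_of_norm_le_const (μ := ρ) (f := fun v => H n (z j ω, v))
        (Eventually.of_forall fun v => hB n _)
      simpa using this
    have e3 : MemLp (fun ω => ∑ j ∈ Finset.range n, ∑ l ∈ (Finset.range n).erase j,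
        H n (z j ω, z l ω)) 2 P :=
      memLp_finsetSum _ fun j _ => memLp_finsetSum _ fun l _ => e1 j l
    have e4 : MemLp (fun ω => ∑ j ∈ Finset.range n, ∫ v, H n (z j ω, v) ∂ρ) 2 P :=
      memLp_finsetSum _ fun j _ => e2 j
    exact (e3.const_mul (1 / ((n : ℝ) * ((n : ℝ) - 1)))).sub (e4.const_mul ((n : ℝ)⁻¹))
  refine tendsto_zero_of_integral_sq (b := b) ?_ ?_ hb0
  · intro n
    exact (hL n).1.aemeasurable
  filter_upwards [hb, eventually_ge_atTop 2] with n hn hn2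
  exact ⟨(hL n).integrable_sq, (hs.integral_sq_pairMean_sub_le (hH n) (hB n) hn2).trans hn⟩

end Averages

/-! ### The kernel estimator for bounded responses -/

section BoundedResponse

variable {p : ℕ} {Ω : Type*} [MeasurableSpace Ω] {P : Measure Ω} [IsProbabilityMeasure P]
  {ρ : Measure (Vec p × ℝ)} {x : ℕ → Ω → Vec p} {y : ℕ → Ω → ℝ} {f : Vec p → ℝ}
  {κ : Kernel (Vec p) ℝ} {a : Vec p × ℝ → ℝ} {M : ℝ} {K : Vec p → ℝ}

/-- Integration against the joint law of covariate and response, disintegrated over the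
covariate, which has density `f`. -/
theorem integral_eq_integral_density (hf : Measurable f) (hf0 : ∀ u, 0 ≤ f u)
    (hρ : ρ.map Prod.fst = volume.withDensity fun u => ENNReal.ofReal (f u)) [SFinite ρ]
    [IsSFiniteKernel κ] (hκ : ρ.map Prod.fst ⊗ₘ κ = ρ) {q : Vec p → ℝ}
    (hint : Integrable (fun z => a z * q z.1) ρ) :
    ∫ z, a z * q z.1 ∂ρ = ∫ u, (f u * ∫ t, a (u, t) ∂κ u) * q u := by
  conv_lhs => rw [← hκ]
  rw [Measure.integral_compProd (by rwa [hκ]), hρ,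
    integral_withDensity_eq_integral_toReal_smul (by fun_prop) (by simp)]
  refine integral_congr_ae (Eventually.of_forall fun u => ?_)
  simp only [integral_mul_const, smul_eq_mul, ENNReal.toReal_ofReal (hf0 u)]
  ring

/-- The product `f(u) E[a(X, Y) | X = u]`, with the conditional law of the response given by the
kernel `κ`. -/
noncomputable def regDensity (f : Vec p → ℝ) (κ : Kernel (Vec p) ℝ) (a : Vec p × ℝ → ℝ)
    (u : Vec p) : ℝ :=
  f u * ∫ t, a (u, t) ∂κ u

theorem measurable_regDensity [IsSFiniteKernel κ] (hf : Measurable f) (ha : Measurable a) :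
    Measurable (regDensity f κ a) :=
  hf.mul ha.stronglyMeasurable.integral_kernel_prod_right'.measurable

theorem abs_integral_kernel_le [IsMarkovKernel κ] (hM : ∀ z, |a z| ≤ M) (u : Vec p) :
    |∫ t, a (u, t) ∂κ u| ≤ M := by
  have := norm_integral_le_of_norm_le_const (μ := κ u) (f := fun t => a (u, t))
    (Eventually.of_forall fun t => hM _)
  simpa using this

/-- The response vanishes where the density exceeds `M`, so its product with the density is
bounded. -/
theorem abs_regDensity_le [IsMarkovKernel κ] (hf0 : ∀ u, 0 ≤ f u) (hM : ∀ z, |a z| ≤ M)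
    (hfM : ∀ z, a z ≠ 0 → f z.1 ≤ M) (u : Vec p) : |regDensity f κ a u| ≤ M * M := by
  have hM0 : 0 ≤ M := (abs_nonneg _).trans (hM (0, 0))
  unfold regDensity
  rw [abs_mul, abs_of_nonneg (hf0 u)]
  rcases le_or_gt (f u) M with h1 | h1
  · exact mul_le_mul h1 (abs_integral_kernel_le hM u) (abs_nonneg _) hM0
  · have : ∀ t, a (u, t) = 0 := fun t => by
      by_contra h0
      exact absurd (hfM _ h0) (not_le.2 h1)
    simp only [this, integral_zero, abs_zero, mul_zero]
    positivity

theorem integrable_density [IsProbabilityMeasure ρ] (hf : Measurable f) (hf0 : ∀ u, 0 ≤ f u)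
    (hρ : ρ.map Prod.fst = volume.withDensity fun u => ENNReal.ofReal (f u)) : Integrable f := by
  refine ⟨hf.aestronglyMeasurable, ?_⟩
  rw [hasFiniteIntegral_iff_ofReal (Eventually.of_forall hf0)]
  have h1 := lintegral_fst_eq hf hρ (φ := fun _ => 1) measurable_const
  simp only [lintegral_const, measure_univ, mul_one] at h1
  rw [← h1]
  exact ENNReal.one_lt_top

theorem enorm_le_ofReal_of_abs_le {s t : ℝ} (h : |s| ≤ t) : ‖s‖ₑ ≤ ENNReal.ofReal t := by
  rw [← ofReal_norm]
  exact ENNReal.ofReal_le_ofReal h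

/-- The second moment of the summands of the kernel estimator is of order `h⁻ᵖ`. -/
theorem exists_integral_sq_kernel_le [IsProbabilityMeasure ρ] (hf : Measurable f)
    (hρ : ρ.map Prod.fst = volume.withDensity fun u => ENNReal.ofReal (f u))
    (hK : Continuous K) (hK0 : ∀ u, 0 ≤ K u) {C : ℝ} (hC : ∀ u, K u ≤ C)
    (hK1 : ∫ u, K u = 1) (ha : Measurable a) (hM : ∀ z, |a z| ≤ M)
    (hfM : ∀ z, a z ≠ 0 → f z.1 ≤ M) :
    ∃ L : ℝ, 0 ≤ L ∧ ∀ h : ℝ, 0 < h →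
      ∫ q : (Vec p × ℝ) × (Vec p × ℝ),
        (a q.1 * a q.2 * scaledKernel K h (q.1.1 - q.2.1)) ^ 2 ∂(ρ.prod ρ) ≤ L / h ^ p := by
  have hM0 : 0 ≤ M := (abs_nonneg _).trans (hM (0, 0))
  have hC0 : 0 ≤ C := (hK0 0).trans (hC 0)
  let N : ℝ≥0∞ := weightedMoment ρ f (fun z => ‖a z‖ₑ)
  have hN : N ≠ ∞ := by
    have h1 : N ≤ ∫⁻ _z, ENNReal.ofReal M ^ 2 * ENNReal.ofReal M ∂ρ := by
      refine lintegral_mono fun z => ?_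
      by_cases h0 : a z = 0
      · simp [h0]
      · exact mul_le_mul' (pow_le_pow_left' (enorm_le_ofReal_of_abs_le (hM z)) 2)
          (ENNReal.ofReal_le_ofReal (hfM z h0))
    refine (h1.trans_lt ?_).ne
    rw [lintegral_const, measure_univ, mul_one]
    exact ENNReal.mul_lt_top (ENNReal.pow_lt_top ENNReal.ofReal_lt_top) ENNReal.ofReal_lt_top
  let L : ℝ := (N ^ (1 / 2 : ℝ) * N ^ (1 / 2 : ℝ)).toReal
  have hL0 : 0 ≤ L := ENNReal.toReal_nonneg
  refine ⟨M * M * C * L, by positivity, fun h hh => ?_⟩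
  have hk0 := scaledKernel_nonneg hK0 hh
  have hkm := measurable_scaledKernel hK h
  let H : (Vec p × ℝ) × (Vec p × ℝ) → ℝ := fun q => a q.1 * a q.2 * scaledKernel K h (q.1.1 - q.2.1)
  have hHm : Measurable H := by fun_prop
  have hHB : ∀ q, |H q| ≤ M * M * (C / h ^ p) := by
    intro q
    simp only [H, abs_mul, abs_of_nonneg (hk0 _)]
    gcongr
    · exact hk0 _
    · exact hM _
    · exact hM _
    · exact scaledKernel_le hC hh _
  have habs : ∫ q, |H q| ∂(ρ.prod ρ) ≤ L := by
    rw [integral_eq_lintegral_of_nonneg_ae (Eventually.of_forall fun q => abs_nonneg _)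
      hHm.norm.aestronglyMeasurable]
    refine ENNReal.toReal_mono (ENNReal.mul_ne_top (ENNReal.rpow_ne_top_of_nonneg (by norm_num) hN)
      (ENNReal.rpow_ne_top_of_nonneg (by norm_num) hN)) ?_
    have h1 := lintegral_lintegral_kernel_le hf hρ
      (k := fun u => ENNReal.ofReal (scaledKernel K h u)) hkm.ennreal_ofReal
      (lintegral_scaledKernel hK hK0 hK1 hh).le ha.enorm ha.enorm
    refine le_trans (le_of_eq ?_) h1
    have hHa : AEMeasurable (fun q => ENNReal.ofReal |H q|) (ρ.prod ρ) :=
      hHm.norm.ennreal_ofReal.aemeasurable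
    rw [lintegral_prod _ hHa]
    refine lintegral_congr fun z => lintegral_congr fun z' => ?_
    have : |H (z, z')| = ‖a z * a z' * scaledKernel K h (z.1 - z'.1)‖ := rfl
    rw [this, ofReal_norm, enorm_mul, enorm_mul, Real.enorm_of_nonneg (hk0 _)]
  have hle : ∀ q, H q ^ 2 ≤ M * M * (C / h ^ p) * |H q| := by
    intro q
    rw [← sq_abs, pow_two]
    gcongr
    exact hHB q
  have hHi : Integrable (fun q => |H q|) (ρ.prod ρ) :=
    Integrable.of_bound hHm.norm.aestronglyMeasurable _
      (Eventually.of_forall fun q => by rw [Real.norm_eq_abs, abs_abs]; exact hHB q)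
  calc ∫ q, H q ^ 2 ∂(ρ.prod ρ) ≤ ∫ q, M * M * (C / h ^ p) * |H q| ∂(ρ.prod ρ) :=
        integral_mono_of_nonneg (Eventually.of_forall fun q => sq_nonneg _)
          (hHi.const_mul _) (Eventually.of_forall hle)
    _ = M * M * (C / h ^ p) * ∫ q, |H q| ∂(ρ.prod ρ) := integral_const_mul _ _
    _ ≤ M * M * (C / h ^ p) * L := by gcongr
    _ = _ := by ring

/-- The projection of the summands of the kernel estimator converges in mean. -/
theorem tendsto_lintegral_projection_sub [IsMarkovKernel κ] [IsProbabilityMeasure ρ]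
    (hf : Measurable f) (hf0 : ∀ u, 0 ≤ f u)
    (hρ : ρ.map Prod.fst = volume.withDensity fun u => ENNReal.ofReal (f u))
    (hK : Continuous K) (hK0 : ∀ u, 0 ≤ K u) (hK1 : ∫ u, K u = 1)
    {h : ℕ → ℝ} (hh : ∀ᶠ n in atTop, 0 < h n) (hh0 : Tendsto h atTop (𝓝 0))
    (ha : Measurable a) (hM : ∀ z, |a z| ≤ M) (hfM : ∀ z, a z ≠ 0 → f z.1 ≤ M) :
    Tendsto (fun n => ∫⁻ z, ‖a z * (∫ v, regDensity f κ a v * scaledKernel K (h n) (z.1 - v)) -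
      a z * regDensity f κ a z.1‖ₑ ∂ρ) atTop (𝓝 0) := by
  have hφm := measurable_regDensity (κ := κ) hf ha
  have hφB := abs_regDensity_le (κ := κ) hf0 hM hfM
  have hφi : Integrable (regDensity f κ a) :=
    (integrable_density hf hf0 hρ).mul_bdd (c := M)
      ha.stronglyMeasurable.integral_kernel_prod_right'.aestronglyMeasurable
      (Eventually.of_forall (abs_integral_kernel_le hM))
  set φ := regDensity f κ a
  have hcm : ∀ n, Measurable fun u => ∫ v, φ v * scaledKernel K (h n) (u - v) := by
    intro n
    have h1 : Measurable fun q : Vec p × Vec p => φ q.2 * scaledKernel K (h n) (q.1 - q.2) := by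
      have := measurable_scaledKernel hK (h n)
      fun_prop
    exact h1.stronglyMeasurable.integral_prod_right'.measurable
  have hlim : Tendsto (fun n => ENNReal.ofReal M * ENNReal.ofReal M *
      ∫⁻ u, ‖(∫ v, φ v * scaledKernel K (h n) (u - v)) - φ u‖ₑ) atTop (𝓝 0) := by
    have := ENNReal.Tendsto.const_mul (a := ENNReal.ofReal M * ENNReal.ofReal M)
      (tendsto_lintegral_convolution_sub hK hK0 hK1 hh hh0 hφm hφi hφB)
      (Or.inr (ENNReal.mul_ne_top ENNReal.ofReal_ne_top ENNReal.ofReal_ne_top))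
    simpa using this
  refine tendsto_of_tendsto_of_tendsto_of_le_of_le tendsto_const_nhds hlim (fun _ => zero_le)
    fun n => ?_
  have hsm : MeasurableSet {u | f u ≤ M} := measurableSet_le hf measurable_const
  let c : Vec p → ℝ := fun u => ∫ v, φ v * scaledKernel K (h n) (u - v)
  have hd : Measurable fun u => ‖c u - φ u‖ₑ := ((hcm n).sub hφm).enorm
  have h1 : ∀ z : Vec p × ℝ, ‖a z * c z.1 - a z * φ z.1‖ₑ ≤
      ({u | f u ≤ M}.indicator (fun _ => ENNReal.ofReal M) z.1) * ‖c z.1 - φ z.1‖ₑ := by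
    intro z
    rw [← mul_sub, enorm_mul]
    by_cases h0 : a z = 0
    · simp [h0]
    · rw [Set.indicator_of_mem (show z.1 ∈ {u | f u ≤ M} from hfM z h0)]
      gcongr
      exact enorm_le_ofReal_of_abs_le (hM z)
  refine (lintegral_mono h1).trans ?_
  rw [lintegral_fst_eq hf hρ (φ := fun u =>
    ({u | f u ≤ M}.indicator (fun _ => ENNReal.ofReal M) u) * ‖c u - φ u‖ₑ)
    ((measurable_const.indicator hsm).mul hd), ← lintegral_const_mul _ hd]
  refine lintegral_mono fun u => ?_
  rw [← mul_assoc]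
  refine mul_le_mul' ?_ le_rfl
  by_cases hu : f u ≤ M
  · exact mul_le_mul' (ENNReal.ofReal_le_ofReal hu) (Set.indicator_le_self' (by simp) _)
  · rw [Set.indicator_of_notMem (show u ∉ {u | f u ≤ M} from hu)]
    simp

/-- The kernel estimator of a bounded response that vanishes where the density is large. The mean
over pairs is close to the sample mean of its projection, in mean square because `n h ^ p → ∞`;
and the projection is close to `a(z) f(x) E[a | x]` because convolution with the rescaled kernel
approximates the identity. -/
theorem tendsto_V1_of_bounded [IsMarkovKernel κ] (hs : IsIIDSample P ρ fun j ω => (x j ω, y j ω))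
    (hf : Measurable f) (hf0 : ∀ u, 0 ≤ f u)
    (hρ : ρ.map Prod.fst = volume.withDensity fun u => ENNReal.ofReal (f u))
    (hκ : ρ.map Prod.fst ⊗ₘ κ = ρ)
    (hK : Continuous K) (hK0 : ∀ u, 0 ≤ K u) {C : ℝ} (hC : ∀ u, K u ≤ C)
    (hK1 : ∫ u, K u = 1) {h : ℕ → ℝ} (hh : ∀ᶠ n in atTop, 0 < h n)
    (hh0 : Tendsto h atTop (𝓝 0)) (hrate : Tendsto (fun n : ℕ => (n : ℝ) * h n ^ p) atTop atTop)
    (ha : Measurable a) (hM : ∀ z, |a z| ≤ M) (hfM : ∀ z, a z ≠ 0 → f z.1 ≤ M) :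
    Tendsto (fun q : ℕ × Ω => V1 K (h q.1) (fun j => x j q.2) (fun j => a (x j q.2, y j q.2)) q.1)
      (probFilter P) (𝓝 (∫ u, (∫ t, a (u, t) ∂κ u) ^ 2 * f u ∂(ρ.map Prod.fst))) := by
  have := hs.isProbabilityMeasure
  have hM0 : 0 ≤ M := (abs_nonneg _).trans (hM (0, 0))
  have hφm := measurable_regDensity (κ := κ) hf ha
  have hφB := abs_regDensity_le (κ := κ) hf0 hM hfM
  have hkm : ∀ n, Measurable (scaledKernel K (h n)) := fun n => measurable_scaledKernel hK (h n)
  have hkB : ∀ n u, |scaledKernel K (h n) u| ≤ |1 / h n ^ p| * C := by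
    intro n u
    simp only [scaledKernel, abs_mul, abs_of_nonneg (hK0 _)]
    gcongr
    exact hC _
  -- the distance to the mean of the projection
  obtain ⟨L, hL0, hL⟩ := exists_integral_sq_kernel_le hf hρ hK hK0 hC hK1 ha hM hfM
  have hb0 : Tendsto (fun n : ℕ => 2 * L / ((n : ℝ) * h n ^ p)) atTop (𝓝 0) :=
    tendsto_const_nhds.div_atTop hrate
  have hW₁ := hs.tendsto_pairMean_sub (b := fun n : ℕ => 2 * L / ((n : ℝ) * h n ^ p))
    (H := fun n q => a q.1 * a q.2 * scaledKernel K (h n) (q.1.1 - q.2.1))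
    (B := fun n => M * M * (|1 / h n ^ p| * C))
    (fun n => by
      have := hkm n
      fun_prop)
    (fun n q => by
      rw [abs_mul, abs_mul]
      gcongr
      · exact hM _
      · exact hM _
      · exact hkB n _)
    (by
      filter_upwards [hh, eventually_ge_atTop 2] with n hn hn2
      have hn2' : (2 : ℝ) ≤ n := by exact_mod_cast hn2
      have hhp : 0 < h n ^ p := by positivity
      have h3 : ((n : ℝ) - 1)⁻¹ ≤ 2 / n := by
        rw [inv_eq_one_div, div_le_div_iff₀ (by linarith) (by linarith)]
        linarith
      refine (mul_le_mul h3 (hL (h n) hn) (integral_nonneg fun q => sq_nonneg _)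
        (by positivity)).trans_eq ?_
      rw [div_mul_div_comm]) hb0
  have hproj : ∀ n z, ∫ v : Vec p × ℝ, a z * a v * scaledKernel K (h n) (z.1 - v.1) ∂ρ =
      a z * ∫ v, regDensity f κ a v * scaledKernel K (h n) (z.1 - v) := by
    intro n z
    simp only [mul_assoc]
    rw [integral_const_mul]
    congr 1
    refine integral_eq_integral_density hf hf0 hρ hκ
      (q := fun u => scaledKernel K (h n) (z.1 - u)) ?_
    refine Integrable.of_bound (ha.mul ((hkm n).comp
      (measurable_const.sub measurable_fst))).aestronglyMeasurable (M * (|1 / h n ^ p| * C))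
      (Eventually.of_forall fun v => ?_)
    rw [norm_mul]
    exact mul_le_mul (hM _) (hkB n _) (norm_nonneg _) hM0
  simp only [hproj] at hW₁
  -- the distance of the projection to its limit
  have hW₂ := hs.tendsto_average_zero
    (fun n => by
      have h1 : Measurable fun q : Vec p × Vec p =>
          regDensity f κ a q.2 * scaledKernel K (h n) (q.1 - q.2) := by
        have := hkm n
        fun_prop
      exact (ha.mul (h1.stronglyMeasurable.integral_prod_right'.measurable.comp
        measurable_fst)).sub (ha.mul (hφm.comp measurable_fst)))
    (tendsto_lintegral_projection_sub (κ := κ) hf hf0 hρ hK hK0 hK1 hh hh0 ha hM hfM)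
  -- the sample mean of the limit of the projection
  have hai : Integrable (fun z => a z * regDensity f κ a z.1) ρ :=
    Integrable.of_bound (ha.mul (hφm.comp measurable_fst)).aestronglyMeasurable (M * (M * M))
      (Eventually.of_forall fun z => by
        rw [norm_mul]
        exact mul_le_mul (hM _) (hφB _) (norm_nonneg _) hM0)
  have hW₃ := tendsto_average hs (φ := fun z => a z * regDensity f κ a z.1)
    (ha.mul (hφm.comp measurable_fst)) hai
  have hlim : ∫ z, a z * regDensity f κ a z.1 ∂ρ =
      ∫ u, (∫ t, a (u, t) ∂κ u) ^ 2 * f u ∂(ρ.map Prod.fst) := by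
    conv_lhs => rw [← hκ]
    rw [Measure.integral_compProd (by rwa [hκ])]
    refine integral_congr_ae (Eventually.of_forall fun u => ?_)
    simp only [integral_mul_const, regDensity]
    ring
  rw [hlim] at hW₃
  have hsum := (hW₁.add hW₂).add hW₃
  simp only [zero_add] at hsum
  refine hsum.congr fun q => ?_
  simp only [smul_eq_mul, V1, scaledKernel, Finset.sum_sub_distrib]
  ring

end BoundedResponse

/-! ### Conditional means with respect to a kernel -/

section Regression

variable {p : ℕ} {ρ : Measure (Vec p × ℝ)} [IsProbabilityMeasure ρ] {f : Vec p → ℝ}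
  {κ : Kernel (Vec p) ℝ} [IsMarkovKernel κ] {η : Vec p × ℝ → ℝ}

theorem sq_integral_le_integral_sq {Ω : Type*} [MeasurableSpace Ω] {μ : Measure Ω}
    [IsProbabilityMeasure μ] {φ : Ω → ℝ} (hφ : MemLp φ 2 μ) :
    (∫ ω, φ ω ∂μ) ^ 2 ≤ ∫ ω, φ ω ^ 2 ∂μ := by
  have h1 := variance_nonneg φ μ
  rw [variance_eq_sub hφ] at h1
  simpa using h1

theorem ae_memLp_kernel (hκ : ρ.map Prod.fst ⊗ₘ κ = ρ) (hη : Measurable η)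
    (hη2 : MemLp η 2 ρ) : ∀ᵐ u ∂(ρ.map Prod.fst), MemLp (fun t => η (u, t)) 2 (κ u) := by
  have h1 : Integrable (fun z => η z ^ 2) (ρ.map Prod.fst ⊗ₘ κ) := hκ.symm ▸ hη2.integrable_sq
  filter_upwards [((Measure.integrable_compProd_iff h1.1).1 h1).1] with u hu
  exact (memLp_two_iff_integrable_sq
    (hη.comp measurable_prodMk_left).aestronglyMeasurable).2 hu

theorem integrable_kernel_sq_mul_density (hf0 : ∀ u, 0 ≤ f u) (hκ : ρ.map Prod.fst ⊗ₘ κ = ρ)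
    (hηf : Integrable (fun z => η z ^ 2 * f z.1) ρ) :
    Integrable (fun u => (∫ t, η (u, t) ^ 2 ∂κ u) * f u) (ρ.map Prod.fst) := by
  have h1 : Integrable (fun z => η z ^ 2 * f z.1) (ρ.map Prod.fst ⊗ₘ κ) := hκ.symm ▸ hηf
  refine ((Measure.integrable_compProd_iff h1.1).1 h1).2.congr (Eventually.of_forall fun u => ?_)
  simp only [norm_mul, norm_pow, Real.norm_eq_abs, sq_abs, abs_of_nonneg (hf0 u),
    integral_mul_const]

/-- Continuity of `a ↦ E[E(a | X)² f(X)]` along dominated pointwise convergence. -/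
theorem tendsto_integral_sq_kernel (hf : Measurable f) (hf0 : ∀ u, 0 ≤ f u)
    (hκ : ρ.map Prod.fst ⊗ₘ κ = ρ) (hη : Measurable η) (hη2 : MemLp η 2 ρ)
    (hηf : Integrable (fun z => η z ^ 2 * f z.1) ρ) {a : ℕ → Vec p × ℝ → ℝ}
    (ha : ∀ m, Measurable (a m)) (hle : ∀ m z, |a m z| ≤ |η z|)
    (hlim : ∀ z, Tendsto (fun m => a m z) atTop (𝓝 (η z))) :
    Tendsto (fun m => ∫ u, (∫ t, a m (u, t) ∂κ u) ^ 2 * f u ∂(ρ.map Prod.fst)) atTop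
      (𝓝 (∫ u, (∫ t, η (u, t) ∂κ u) ^ 2 * f u ∂(ρ.map Prod.fst))) := by
  have hae := ae_memLp_kernel hκ hη hη2
  refine tendsto_integral_of_dominated_convergence
    (fun u => (∫ t, η (u, t) ^ 2 ∂κ u) * f u) (fun m => ?_)
    (integrable_kernel_sq_mul_density hf0 hκ hηf) (fun m => ?_) ?_
  · have h1 : Measurable fun u => ∫ t, a m (u, t) ∂κ u :=
      (ha m).stronglyMeasurable.integral_kernel_prod_right'.measurable
    exact ((h1.pow_const 2).mul hf).aestronglyMeasurable
  · filter_upwards [hae] with u hu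
    have hau : MemLp (fun t => a m (u, t)) 2 (κ u) :=
      hu.mono ((ha m).comp measurable_prodMk_left).aestronglyMeasurable
        (Eventually.of_forall fun t => hle m _)
    rw [Real.norm_of_nonneg (mul_nonneg (sq_nonneg _) (hf0 u))]
    gcongr
    · exact hf0 u
    · refine (sq_integral_le_integral_sq hau).trans
        (integral_mono hau.integrable_sq hu.integrable_sq fun t => ?_)
      exact sq_le_sq.2 (hle m _)
  · filter_upwards [hae] with u hu
    have hu1 : Integrable (fun t => η (u, t)) (κ u) := hu.integrable (by norm_num)
    have h1 : Tendsto (fun m => ∫ t, a m (u, t) ∂κ u) atTop (𝓝 (∫ t, η (u, t) ∂κ u)) :=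
      tendsto_integral_of_dominated_convergence (fun t => |η (u, t)|)
        (fun m => ((ha m).comp measurable_prodMk_left).aestronglyMeasurable) hu1.abs
        (fun m => Eventually.of_forall fun t => hle m _)
        (Eventually.of_forall fun t => hlim _)
    exact (h1.pow 2).mul_const _

end Regression

/-! ### Replacing the responses in the kernel estimator -/

section PairBound

variable {p : ℕ} {Ω : Type*} [MeasurableSpace Ω] {P : Measure Ω} [IsProbabilityMeasure P]
  {ρ : Measure (Vec p × ℝ)} {x : ℕ → Ω → Vec p} {y : ℕ → Ω → ℝ} {f K : Vec p → ℝ}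

/-- The kernel-weighted mean over pairs of `e s + s e`, a bound of the change of the kernel
estimator when a response bounded by `s` is changed by at most `e`. -/
noncomputable def pairBound (K : Vec p → ℝ) (h : ℝ) (u : ℕ → Vec p) (e s : ℕ → ℝ≥0∞) (n : ℕ) :
    ℝ≥0∞ :=
  ENNReal.ofReal (1 / ((n : ℝ) * ((n : ℝ) - 1))) *
    ∑ j ∈ Finset.range n, ∑ l ∈ (Finset.range n).erase j,
      (e j * s l + s j * e l) * ENNReal.ofReal (scaledKernel K h (u j - u l))

/-- Each product of responses changes by `(r j - a j) * r l + a j * (r l - a l)`. -/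
theorem enorm_V1_sub_le (hK0 : ∀ u, 0 ≤ K u) {h : ℝ} (hh : 0 < h) {u : ℕ → Vec p} {r a : ℕ → ℝ}
    {e s : ℕ → ℝ≥0∞} (hre : ∀ j, ‖r j - a j‖ₑ ≤ e j) (hrs : ∀ j, ‖r j‖ₑ ≤ s j)
    (has : ∀ j, ‖a j‖ₑ ≤ s j) {n : ℕ} (hn : 2 ≤ n) :
    ‖V1 K h u r n - V1 K h u a n‖ₑ ≤ pairBound K h u e s n := by
  have hn2 : (2 : ℝ) ≤ n := by exact_mod_cast hn
  have hc : 0 ≤ 1 / ((n : ℝ) * ((n : ℝ) - 1)) := by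
    have : (0 : ℝ) ≤ (n : ℝ) - 1 := by linarith
    positivity
  have hident : V1 K h u r n - V1 K h u a n = (1 / ((n : ℝ) * ((n : ℝ) - 1))) *
      ∑ j ∈ Finset.range n, ∑ l ∈ (Finset.range n).erase j,
        ((r j - a j) * r l + a j * (r l - a l)) * scaledKernel K h (u j - u l) := by
    unfold V1 scaledKernel
    rw [← mul_sub, ← Finset.sum_sub_distrib]
    congr 1
    refine Finset.sum_congr rfl fun j _ => ?_
    rw [← Finset.sum_sub_distrib]
    exact Finset.sum_congr rfl fun l _ => by ring
  rw [hident, enorm_mul, Real.enorm_of_nonneg hc]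
  unfold pairBound
  gcongr
  refine (enorm_sum_le _ _).trans (Finset.sum_le_sum fun j _ => ?_)
  refine (enorm_sum_le _ _).trans (Finset.sum_le_sum fun l _ => ?_)
  rw [enorm_mul, Real.enorm_of_nonneg (scaledKernel_nonneg hK0 hh _)]
  gcongr
  refine (enorm_add_le _ _).trans ?_
  rw [enorm_mul, enorm_mul]
  exact add_le_add (mul_le_mul' (hre j) (hrs l)) (mul_le_mul' (has j) (hre l))

/-- Each pair contributes the same mean, to which the bilinear bound applies; the bound does not
depend on `n` or on the bandwidth. -/
theorem lintegral_pairBound_le (hs : IsIIDSample P ρ fun j ω => (x j ω, y j ω))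
    (hf : Measurable f)
    (hρ : ρ.map Prod.fst = volume.withDensity fun u => ENNReal.ofReal (f u))
    (hK : Continuous K) (hK0 : ∀ u, 0 ≤ K u) (hK1 : ∫ u, K u = 1) {h : ℝ} (hh : 0 < h)
    {e s : Vec p × ℝ → ℝ≥0∞} (he : Measurable e) (hsm : Measurable s) {n : ℕ} (hn : 2 ≤ n) :
    ∫⁻ ω, pairBound K h (fun j => x j ω) (fun j => e (x j ω, y j ω)) (fun j => s (x j ω, y j ω)) n
      ∂P ≤ 2 * (weightedMoment ρ f e ^ (1 / 2 : ℝ) * weightedMoment ρ f s ^ (1 / 2 : ℝ)) := by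
  have := hs.isProbabilityMeasure
  have hkm := measurable_scaledKernel hK h
  have hk : Measurable fun u => ENNReal.ofReal (scaledKernel K h u) := hkm.ennreal_ofReal
  have hk1 := (lintegral_scaledKernel hK hK0 hK1 hh).le
  have hn2 : (2 : ℝ) ≤ n := by exact_mod_cast hn
  have hcard : ENNReal.ofReal (1 / ((n : ℝ) * ((n : ℝ) - 1))) * ((n : ℝ≥0∞) *
      ((n - 1 : ℕ) : ℝ≥0∞)) = 1 := by
    rw [← ENNReal.ofReal_natCast, ← ENNReal.ofReal_natCast, ← ENNReal.ofReal_mul (by positivity),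
      ← ENNReal.ofReal_mul (one_div_nonneg.2 (mul_nonneg (by linarith) (by linarith))),
      Nat.cast_sub (by omega), Nat.cast_one, one_div_mul_cancel, ENNReal.ofReal_one]
    have : (n : ℝ) - 1 ≠ 0 := by linarith
    have : (n : ℝ) ≠ 0 := by linarith
    positivity
  let φ : (Vec p × ℝ) × (Vec p × ℝ) → ℝ≥0∞ := fun q =>
    (e q.1 * s q.2 + s q.1 * e q.2) * ENNReal.ofReal (scaledKernel K h (q.1.1 - q.2.1))
  have hφ : Measurable φ := by fun_prop
  unfold pairBound
  rw [lintegral_const_mul' _ _ ENNReal.ofReal_ne_top]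
  have h1 := hs.lintegral_sum_pairs hφ n
  simp only [φ] at h1
  rw [h1, ← mul_assoc, hcard, one_mul, lintegral_prod _ hφ.aemeasurable]
  have h2 : ∀ z, ∫⁻ z', φ (z, z') ∂ρ =
      ∫⁻ z', e z * s z' * ENNReal.ofReal (scaledKernel K h (z.1 - z'.1)) ∂ρ +
      ∫⁻ z', s z * e z' * ENNReal.ofReal (scaledKernel K h (z.1 - z'.1)) ∂ρ := by
    intro z
    rw [← lintegral_add_left (by fun_prop)]
    simp only [φ, add_mul]
  have h3 : Measurable fun z => ∫⁻ z', e z * s z' *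
      ENNReal.ofReal (scaledKernel K h (z.1 - z'.1)) ∂ρ := by
    have : Measurable fun q : (Vec p × ℝ) × (Vec p × ℝ) => e q.1 * s q.2 *
      ENNReal.ofReal (scaledKernel K h (q.1.1 - q.2.1)) := by fun_prop
    exact this.lintegral_prod_right'
  rw [lintegral_congr h2, lintegral_add_left h3, two_mul]
  refine add_le_add (lintegral_lintegral_kernel_le hf hρ hk hk1 he hsm) ?_
  rw [mul_comm (weightedMoment ρ f e ^ (1 / 2 : ℝ))]
  exact lintegral_lintegral_kernel_le hf hρ hk hk1 hsm he

end PairBound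

/-! ### Truncated residuals -/

section Truncation

variable {p d : ℕ} {g : Vec p → Vec d → ℝ} {Θ : Set (Vec d)} {θs : Vec d}
  {ρ : Measure (Vec p × ℝ)} {f : Vec p → ℝ}

/-- The supremum over `θ ∈ Θ` of the absolute residual, written as a square root because the
moment conditions concern the supremum of the squares. -/
noncomputable def residEnvelope (g : Vec p → Vec d → ℝ) (Θ : Set (Vec d)) (z : Vec p × ℝ) :
    ℝ≥0∞ :=
  (⨆ θ ∈ Θ, ‖z.2 - g z.1 θ‖ₑ ^ 2) ^ (1 / 2 : ℝ)

theorem residEnvelope_sq (z : Vec p × ℝ) :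
    residEnvelope g Θ z ^ 2 = ⨆ θ ∈ Θ, ‖z.2 - g z.1 θ‖ₑ ^ 2 := by
  unfold residEnvelope
  rw [← ENNReal.rpow_natCast, ← ENNReal.rpow_mul]
  norm_num

theorem enorm_resid_le (z : Vec p × ℝ) {θ : Vec d} (hθ : θ ∈ Θ) :
    ‖z.2 - g z.1 θ‖ₑ ≤ residEnvelope g Θ z := by
  have h1 : ‖z.2 - g z.1 θ‖ₑ ^ 2 ≤ ⨆ θ ∈ Θ, ‖z.2 - g z.1 θ‖ₑ ^ 2 :=
    le_iSup₂ (f := fun θ (_ : θ ∈ Θ) => ‖z.2 - g z.1 θ‖ₑ ^ 2) θ hθ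
  rw [← residEnvelope_sq] at h1
  exact (ENNReal.pow_le_pow_left_iff two_ne_zero).1 h1

theorem measurable_residEnvelope (hg_meas : ∀ θ, Measurable fun u => g u θ)
    (hg : ∀ u, ContinuousOn (g u) Θ) : Measurable (residEnvelope g Θ) := by
  have h1 : Measurable fun z : Vec p × ℝ => ⨆ θ ∈ Θ, ‖z.2 - g z.1 θ‖ₑ ^ 2 := by
    refine measurable_biSup_of_continuousOn (fun θ _ => ?_) fun z => ?_
    · exact (measurable_snd.sub ((hg_meas θ).comp measurable_fst)).enorm.pow_const 2
    · exact (ENNReal.continuous_pow 2).comp_continuousOn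
        (continuousOn_const.sub (hg z.1)).enorm
  exact h1.pow_const _

open Classical in
/-- The residual at `θs`, set to zero where its absolute value or the density of the covariate
exceeds `m`. -/
noncomputable def truncResid (g : Vec p → Vec d → ℝ) (f : Vec p → ℝ) (θs : Vec d) (m : ℕ)
    (z : Vec p × ℝ) : ℝ :=
  if |z.2 - g z.1 θs| ≤ m ∧ f z.1 ≤ m then z.2 - g z.1 θs else 0

theorem measurable_truncResid (hg_meas : ∀ θ, Measurable fun u => g u θ) (hf : Measurable f)
    (m : ℕ) : Measurable (truncResid g f θs m) := by
  have hη : Measurable fun z : Vec p × ℝ => z.2 - g z.1 θs :=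
    measurable_snd.sub ((hg_meas θs).comp measurable_fst)
  unfold truncResid
  exact Measurable.ite ((measurableSet_le hη.norm measurable_const).inter
    (measurableSet_le (hf.comp measurable_fst) measurable_const)) hη measurable_const

theorem abs_truncResid_le (m : ℕ) (z : Vec p × ℝ) : |truncResid g f θs m z| ≤ m := by
  unfold truncResid
  split_ifs with h
  · exact h.1
  · simp

theorem density_le_of_truncResid_ne_zero (m : ℕ) (z : Vec p × ℝ) (h : truncResid g f θs m z ≠ 0) :
    f z.1 ≤ m := by
  unfold truncResid at h
  split_ifs at h with h1
  · exact h1.2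
  · exact absurd rfl h

theorem abs_truncResid_le_abs (m : ℕ) (z : Vec p × ℝ) :
    |truncResid g f θs m z| ≤ |z.2 - g z.1 θs| := by
  unfold truncResid
  split_ifs
  · exact le_rfl
  · simp

theorem enorm_sub_truncResid_le (m : ℕ) (z : Vec p × ℝ) :
    ‖(z.2 - g z.1 θs) - truncResid g f θs m z‖ₑ ≤ ‖z.2 - g z.1 θs‖ₑ := by
  unfold truncResid
  split_ifs <;> simp

theorem eventually_truncResid_eq (z : Vec p × ℝ) :
    ∀ᶠ m : ℕ in atTop, truncResid g f θs m z = z.2 - g z.1 θs := by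
  filter_upwards [tendsto_natCast_atTop_atTop.eventually_ge_atTop |z.2 - g z.1 θs|,
    tendsto_natCast_atTop_atTop.eventually_ge_atTop (f z.1)] with m h1 h2
  unfold truncResid
  rw [if_pos ⟨h1, h2⟩]

/-- A bound of the difference between the residual at a parameter within `1 / (m + 1)` of `θs`
and the truncated residual at `θs`. -/
noncomputable def approxError (g : Vec p → Vec d → ℝ) (f : Vec p → ℝ) (Θ : Set (Vec d))
    (θs : Vec d) (m : ℕ) (z : Vec p × ℝ) : ℝ≥0∞ :=
  (⨆ θ ∈ Θ ∩ Metric.ball θs (1 / ((m : ℝ) + 1)), ‖g z.1 θ - g z.1 θs‖ₑ) +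
    ‖(z.2 - g z.1 θs) - truncResid g f θs m z‖ₑ

theorem measurable_approxError (hg_meas : ∀ θ, Measurable fun u => g u θ)
    (hg : ∀ u, ContinuousOn (g u) Θ) (hf : Measurable f) (m : ℕ) :
    Measurable (approxError g f Θ θs m) := by
  have hgm : ∀ θ, Measurable fun z : Vec p × ℝ => g z.1 θ := fun θ =>
    (hg_meas θ).comp measurable_fst
  refine Measurable.add (measurable_biSup_of_continuousOn (fun θ _ => ?_) fun z => ?_) ?_
  · exact ((hgm θ).sub (hgm θs)).enorm
  · exact (((hg z.1).mono Set.inter_subset_left).sub continuousOn_const).enorm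
  · exact ((measurable_snd.sub (hgm θs)).sub (measurable_truncResid hg_meas hf m)).enorm

theorem enorm_resid_sub_truncResid_le (m : ℕ) (z : Vec p × ℝ) {θ : Vec d}
    (hθ : θ ∈ Θ ∩ Metric.ball θs (1 / ((m : ℝ) + 1))) :
    ‖(z.2 - g z.1 θ) - truncResid g f θs m z‖ₑ ≤ approxError g f Θ θs m z := by
  have h1 : (z.2 - g z.1 θ) - truncResid g f θs m z =
      ((z.2 - g z.1 θs) - truncResid g f θs m z) - (g z.1 θ - g z.1 θs) := by ring
  rw [h1]
  refine enorm_sub_le.trans ?_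
  rw [add_comm]
  exact add_le_add (le_iSup₂ (f := fun θ (_ : θ ∈ Θ ∩ Metric.ball θs (1 / ((m : ℝ) + 1))) =>
    ‖g z.1 θ - g z.1 θs‖ₑ) θ hθ) le_rfl

theorem approxError_le (hθs : θs ∈ Θ) (m : ℕ) (z : Vec p × ℝ) :
    approxError g f Θ θs m z ≤ 3 * residEnvelope g Θ z := by
  have h1 : (⨆ θ ∈ Θ ∩ Metric.ball θs (1 / ((m : ℝ) + 1)), ‖g z.1 θ - g z.1 θs‖ₑ) ≤
      2 * residEnvelope g Θ z := by
    refine iSup₂_le fun θ hθ => ?_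
    have : g z.1 θ - g z.1 θs = (z.2 - g z.1 θs) - (z.2 - g z.1 θ) := by ring
    rw [this, two_mul]
    exact enorm_sub_le.trans (add_le_add (enorm_resid_le z hθs) (enorm_resid_le z hθ.1))
  calc _ ≤ 2 * residEnvelope g Θ z + residEnvelope g Θ z :=
        add_le_add h1 ((enorm_sub_truncResid_le m z).trans (enorm_resid_le z hθs))
    _ = _ := by ring

theorem tendsto_weightedMoment_approxError (hg_meas : ∀ θ, Measurable fun u => g u θ)
    (hg : ∀ u, ContinuousOn (g u) Θ) (hf : Measurable f) (hθs : θs ∈ Θ)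
    (hS : weightedMoment ρ f (residEnvelope g Θ) ≠ ∞) :
    Tendsto (fun m => weightedMoment ρ f (approxError g f Θ θs m)) atTop (𝓝 0) := by
  have hfm : Measurable fun z : Vec p × ℝ => ENNReal.ofReal (f z.1) := by fun_prop
  have := tendsto_lintegral_of_dominated_convergence (μ := ρ)
    (F := fun m z => approxError g f Θ θs m z ^ 2 * ENNReal.ofReal (f z.1)) (f := fun _ => 0)
    (fun z => 9 * (residEnvelope g Θ z ^ 2 * ENNReal.ofReal (f z.1)))
    (fun m => ((measurable_approxError hg_meas hg hf m).pow_const 2).mul hfm)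
    (fun m => Eventually.of_forall fun z => by
      calc approxError g f Θ θs m z ^ 2 * ENNReal.ofReal (f z.1)
          ≤ (3 * residEnvelope g Θ z) ^ 2 * ENNReal.ofReal (f z.1) := by
            gcongr; exact approxError_le hθs m z
        _ = _ := by ring)
    (by
      rw [lintegral_const_mul' _ _ (by simp)]
      exact ENNReal.mul_ne_top (by simp) hS)
    (Eventually.of_forall fun z => by
      have h1 := tendsto_biSup_sub hθs (hg z.1)
      have h2 : Tendsto (fun m => ‖(z.2 - g z.1 θs) - truncResid g f θs m z‖ₑ) atTop (𝓝 0) := by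
        refine tendsto_const_nhds.congr' ?_
        filter_upwards [eventually_truncResid_eq z] with m hm
        rw [hm, sub_self, enorm_zero]
      have h3 := h1.add h2
      rw [add_zero] at h3
      have h4 := ENNReal.Tendsto.mul_const (b := ENNReal.ofReal (f z.1))
        (ENNReal.Tendsto.pow (n := 2) h3) (Or.inr ENNReal.ofReal_ne_top)
      rwa [zero_pow two_ne_zero, zero_mul] at h4)
  simpa [weightedMoment] using this

end Truncation

/-! ### The kernel estimator with estimated residuals -/

section KernelEstimator

variable {p d : ℕ} {g : Vec p → Vec d → ℝ} {Θ : Set (Vec d)} {θs : Vec d}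
  {Ω : Type*} [MeasurableSpace Ω] {P : Measure Ω}
  {ρ : Measure (Vec p × ℝ)} {x : ℕ → Ω → Vec p} {y : ℕ → Ω → ℝ} {f K : Vec p → ℝ}
  {κ : Kernel (Vec p) ℝ} [IsMarkovKernel κ]

theorem aemeasurable_pairBound (hs : IsIIDSample P ρ fun j ω => (x j ω, y j ω))
    (hK : Continuous K) {b : ℝ} {e s : Vec p × ℝ → ℝ≥0∞} (he : Measurable e) (hsm : Measurable s)
    (n : ℕ) :
    AEMeasurable (fun ω => pairBound K b (fun j => x j ω) (fun j => e (x j ω, y j ω))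
      (fun j => s (x j ω, y j ω)) n) P := by
  have hz := hs.aemeasurable
  have hkm := measurable_scaledKernel hK b
  have hφ : Measurable fun q : (Vec p × ℝ) × (Vec p × ℝ) =>
      (e q.1 * s q.2 + s q.1 * e q.2) *
        ENNReal.ofReal (scaledKernel K b (q.1.1 - q.2.1)) := by fun_prop
  have h1 : AEMeasurable (fun ω => ∑ j ∈ Finset.range n, ∑ l ∈ (Finset.range n).erase j,
      (e (x j ω, y j ω) * s (x l ω, y l ω) + s (x j ω, y j ω) * e (x l ω, y l ω)) *
        ENNReal.ofReal (scaledKernel K b (x j ω - x l ω))) P :=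
    Finset.aemeasurable_fun_sum _ fun j _ => Finset.aemeasurable_fun_sum _ fun l _ =>
      hφ.comp_aemeasurable ((hz j).prodMk (hz l))
  exact h1.const_mul (ENNReal.ofReal (1 / ((n : ℝ) * ((n : ℝ) - 1))))

/-- The kernel estimator with the estimated residuals converges in probability to
`E[E(η | X)² f(X)]`. Replacing the estimated residuals by the truncated residuals at `θs` changes
it by little, uniformly in `n`, by the bilinear bound for kernel-weighted moments. -/
theorem tendsto_V1 [IsProbabilityMeasure P] (hs : IsIIDSample P ρ fun j ω => (x j ω, y j ω))
    (hf : Measurable f) (hf0 : ∀ u, 0 ≤ f u)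
    (hρ : ρ.map Prod.fst = volume.withDensity fun u => ENNReal.ofReal (f u))
    (hκ : ρ.map Prod.fst ⊗ₘ κ = ρ)
    (hK : Continuous K) (hK0 : ∀ u, 0 ≤ K u) {C : ℝ} (hC : ∀ u, K u ≤ C)
    (hK1 : ∫ u, K u = 1) {h : ℕ → ℝ} (hh : ∀ᶠ n in atTop, 0 < h n)
    (hh0 : Tendsto h atTop (𝓝 0)) (hrate : Tendsto (fun n : ℕ => (n : ℝ) * h n ^ p) atTop atTop)
    (hg_meas : ∀ θ, Measurable fun u => g u θ) (hg : ∀ u, ContinuousOn (g u) Θ) (hθs : θs ∈ Θ)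
    (hS : weightedMoment ρ f (residEnvelope g Θ) ≠ ∞)
    (hη2 : MemLp (fun z : Vec p × ℝ => z.2 - g z.1 θs) 2 ρ)
    (hηf : Integrable (fun z : Vec p × ℝ => (z.2 - g z.1 θs) ^ 2 * f z.1) ρ)
    {θhat : ℕ × Ω → Vec d} (hθhat : Tendsto θhat (probFilter P) (𝓝[Θ] θs)) :
    Tendsto (fun q : ℕ × Ω => V1 K (h q.1) (fun j => x j q.2)
        (resid g (fun j => x j q.2) (fun j => y j q.2) (θhat q)) q.1)
      (probFilter P)
      (𝓝 (∫ u, (∫ t, (t - g u θs) ∂κ u) ^ 2 * f u ∂(ρ.map Prod.fst))) := by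
  have := hs.isProbabilityMeasure
  have hηm : Measurable fun z : Vec p × ℝ => z.2 - g z.1 θs :=
    measurable_snd.sub ((hg_meas θs).comp measurable_fst)
  have hc := tendsto_integral_sq_kernel hf hf0 hκ hηm hη2 hηf
    (fun m => measurable_truncResid (θs := θs) hg_meas hf m) abs_truncResid_le_abs
    (fun z => tendsto_const_nhds.congr' ((eventually_truncResid_eq z).mono fun m hm => hm.symm))
  have hN := tendsto_weightedMoment_approxError hg_meas hg hf hθs hS
  apply tendsto_probFilter_of_approx
  intro ε hε δ hδ
  have hδ2 : 0 < δ / 2 := ENNReal.half_pos hδ.ne'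
  -- the truncation level
  have hb : Tendsto (fun m => 2 * (weightedMoment ρ f (approxError g f Θ θs m) ^ (1 / 2 : ℝ) *
      weightedMoment ρ f (residEnvelope g Θ) ^ (1 / 2 : ℝ)) / ENNReal.ofReal ε) atTop (𝓝 0) := by
    have h1 : Tendsto (fun m => weightedMoment ρ f (approxError g f Θ θs m) ^ (1 / 2 : ℝ)) atTop
        (𝓝 0) := by
      have := hN.ennrpow_const (1 / 2 : ℝ)
      rwa [ENNReal.zero_rpow_of_pos (by norm_num)] at this
    have h2 := ENNReal.Tendsto.mul_const (b := weightedMoment ρ f (residEnvelope g Θ) ^ (1 / 2 : ℝ))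
      h1 (Or.inr (ENNReal.rpow_ne_top_of_nonneg (by norm_num) hS))
    have h3 := ENNReal.Tendsto.const_mul (a := 2) h2 (Or.inr (by simp))
    have h4 := ENNReal.Tendsto.div_const (b := ENNReal.ofReal ε) h3
      (Or.inr (ENNReal.ofReal_pos.2 hε).ne')
    simpa using h4
  obtain ⟨m, hm1, hm2⟩ := ((Metric.tendsto_nhds.1 hc ε hε).and
    (ENNReal.tendsto_nhds_zero.1 hb _ hδ2)).exists
  refine ⟨_, _, tendsto_V1_of_bounded hs hf hf0 hρ hκ hK hK0 hC hK1 hh hh0 hrate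
    (measurable_truncResid hg_meas hf m) (abs_truncResid_le m)
    (density_le_of_truncResid_ne_zero (g := g) (θs := θs) m), by simpa [Real.dist_eq] using hm1, ?_⟩
  have hθm : ∀ᶠ q in probFilter P, θhat q ∈ Θ ∩ Metric.ball θs (1 / ((m : ℝ) + 1)) :=
    hθhat (inter_mem_nhdsWithin Θ (Metric.ball_mem_nhds _ (by positivity)))
  have hem := measurable_approxError (θs := θs) hg_meas hg hf m
  have hsm := measurable_residEnvelope hg_meas hg
  filter_upwards [ENNReal.tendsto_nhds_zero.1 (eventually_probFilter.1 hθm) _ hδ2, hh,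
    eventually_ge_atTop 2] with n h1 hn hn2
  let Bn : Ω → ℝ≥0∞ := fun ω => pairBound K (h n) (fun j => x j ω)
    (fun j => approxError g f Θ θs m (x j ω, y j ω))
    (fun j => residEnvelope g Θ (x j ω, y j ω)) n
  have hBm : AEMeasurable Bn P := aemeasurable_pairBound hs hK hem hsm n
  have h2 : P {ω | ENNReal.ofReal ε ≤ Bn ω} ≤ δ / 2 := by
    refine (meas_ge_le_lintegral_div hBm (ENNReal.ofReal_pos.2 hε).ne'
      ENNReal.ofReal_ne_top).trans (le_trans ?_ hm2)
    gcongr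
    exact lintegral_pairBound_le hs hf hρ hK hK0 hK1 hn hem hsm hn2
  refine le_trans ?_ ((measure_union_le _ _).trans ((add_le_add h1 h2).trans_eq
    (ENNReal.add_halves δ)))
  refine measure_mono fun ω hω => ?_
  by_cases hθ : θhat (n, ω) ∈ Θ ∩ Metric.ball θs (1 / ((m : ℝ) + 1))
  · right
    have h3 := enorm_V1_sub_le (K := K) hK0 hn (u := fun j => x j ω)
      (r := resid g (fun j => x j ω) (fun j => y j ω) (θhat (n, ω)))
      (a := fun j => truncResid g f θs m (x j ω, y j ω))
      (e := fun j => approxError g f Θ θs m (x j ω, y j ω))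
      (s := fun j => residEnvelope g Θ (x j ω, y j ω))
      (fun j => enorm_resid_sub_truncResid_le m (x j ω, y j ω) hθ)
      (fun j => enorm_resid_le (x j ω, y j ω) hθ.1)
      (fun j => by
        refine le_trans ?_ (enorm_resid_le (x j ω, y j ω) hθs)
        rw [← ofReal_norm, ← ofReal_norm]
        exact ENNReal.ofReal_le_ofReal (abs_truncResid_le_abs m _)) hn2
    refine le_trans ?_ h3
    rw [← ofReal_norm]
    exact ENNReal.ofReal_le_ofReal hω
  · left
    exact hθ

end KernelEstimator

/-! ### The limit -/

section Population

variable {p d : ℕ} {g : Vec p → Vec d → ℝ} {Ω : Type*} [MeasurableSpace Ω] {P : Measure Ω}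
  {X : Ω → Vec p} {Y : Ω → ℝ} {w f : Vec p → ℝ} {θ : Vec d}

/-- The variance functional is nonnegative: its second factor is the mean square of the residual
of the projection of the weight on the gradient. -/
theorem Sigma01_nonneg (hgrad : ∀ a, MemLp (fun ω => gradient (g (X ω)) θ a) 2 P)
    (hw2 : MemLp (fun ω => w (X ω)) 2 P) (hgram : IsUnit (gram P g X θ).det) :
    0 ≤ Sigma01 P g w X Y θ := by
  refine mul_nonneg (integral_nonneg fun ω => sq_nonneg _) ?_
  set A := gram P g X θ
  set b := cross P g w X θ
  set v := Matrix.mulVec A⁻¹ b with hv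
  have hAv : Matrix.mulVec A v = b := by
    rw [hv, Matrix.mulVec_mulVec, Matrix.mul_nonsing_inv _ hgram, Matrix.one_mulVec]
  have hi1 : ∀ a c, Integrable
      (fun ω => gradient (g (X ω)) θ a * gradient (g (X ω)) θ c) P := fun a c =>
    (hgrad a).integrable_mul (hgrad c)
  have hi2 : ∀ a, Integrable (fun ω => gradient (g (X ω)) θ a * w (X ω)) P := fun a =>
    (hgrad a).integrable_mul hw2
  have hexp : ∫ ω, (w (X ω) - ∑ a, v a * gradient (g (X ω)) θ a) ^ 2 ∂P =
      (∫ ω, w (X ω) ^ 2 ∂P) - 2 * (b ⬝ᵥ v) + v ⬝ᵥ Matrix.mulVec A v := by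
    have h1 : ∀ ω, (w (X ω) - ∑ a, v a * gradient (g (X ω)) θ a) ^ 2 =
        w (X ω) ^ 2 - 2 * ∑ a, (v a * (gradient (g (X ω)) θ a * w (X ω))) +
        ∑ a, ∑ c, v a * (v c * (gradient (g (X ω)) θ a * gradient (g (X ω)) θ c)) := by
      intro ω
      have e1 : ∑ a, (v a * (gradient (g (X ω)) θ a * w (X ω))) =
          (∑ a, v a * gradient (g (X ω)) θ a) * w (X ω) := by
        rw [Finset.sum_mul]
        exact Finset.sum_congr rfl fun a _ => by ring
      have e2 : ∑ a, ∑ c, v a * (v c * (gradient (g (X ω)) θ a * gradient (g (X ω)) θ c)) =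
          (∑ a, v a * gradient (g (X ω)) θ a) * ∑ c, v c * gradient (g (X ω)) θ c := by
        rw [Finset.sum_mul_sum]
        exact Finset.sum_congr rfl fun a _ => Finset.sum_congr rfl fun c _ => by ring
      rw [e1, e2]
      ring
    simp_rw [h1]
    have i2 : Integrable (fun ω => ∑ a, (v a * (gradient (g (X ω)) θ a * w (X ω)))) P :=
      integrable_finsetSum _ fun a _ => (hi2 a).const_mul _
    have i3 : Integrable (fun ω => ∑ a, ∑ c,
        v a * (v c * (gradient (g (X ω)) θ a * gradient (g (X ω)) θ c))) P :=
      integrable_finsetSum _ fun a _ => integrable_finsetSum _ fun c _ =>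
        ((hi1 a c).const_mul _).const_mul _
    have i12 : Integrable (fun ω => w (X ω) ^ 2 -
        2 * ∑ a, (v a * (gradient (g (X ω)) θ a * w (X ω)))) P :=
      hw2.integrable_sq.sub (i2.const_mul 2)
    rw [integral_add i12 i3,
      integral_sub hw2.integrable_sq (i2.const_mul 2), integral_const_mul,
      integral_finsetSum _ fun a _ => (hi2 a).const_mul _,
      integral_finsetSum _ fun a _ => integrable_finsetSum _ fun c _ =>
        ((hi1 a c).const_mul _).const_mul _]
    have e3 : ∀ a, ∫ ω, ∑ c, v a * (v c * (gradient (g (X ω)) θ a * gradient (g (X ω)) θ c)) ∂P =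
        ∑ c, v a * (v c * A a c) := by
      intro a
      rw [integral_finsetSum _ fun c _ => ((hi1 a c).const_mul _).const_mul _]
      exact Finset.sum_congr rfl fun c _ => by
        rw [integral_const_mul, integral_const_mul]; rfl
    simp_rw [e3, integral_const_mul]
    congr 1
    · congr 2
      exact Finset.sum_congr rfl fun a _ => mul_comm _ _
    · simp only [dotProduct, Matrix.mulVec, Finset.mul_sum]
      exact Finset.sum_congr rfl fun a _ => Finset.sum_congr rfl fun c _ => by ring
  have h0 : 0 ≤ ∫ ω, (w (X ω) - ∑ a, v a * gradient (g (X ω)) θ a) ^ 2 ∂P :=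
    integral_nonneg fun ω => sq_nonneg _
  rw [hexp, hAv, dotProduct_comm v b] at h0
  linarith

theorem condMean_popResid_ae_eq [IsProbabilityMeasure P] (hX : Measurable X) (hY : Measurable Y)
    (hg_meas : Measurable fun u => g u θ) (hint : Integrable (popResid g X Y θ) P) :
    condMean P X (popResid g X Y θ) =ᵐ[P]
      fun ω => ∫ t, (t - g (X ω) θ) ∂(condDistrib Y X P (X ω)) := by
  have hη : StronglyMeasurable fun z : Vec p × ℝ => z.2 - g z.1 θ :=
    (measurable_snd.sub (hg_meas.comp measurable_fst)).stronglyMeasurable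
  exact condExp_prod_ae_eq_integral_condDistrib hX hY.aemeasurable hη hint

/-- The numerator of the limit is positive, since the density is positive almost surely at the
covariate and the conditional mean of the residual is not almost surely zero. -/
theorem integral_condMean_sq_pos (hX : Measurable X) (hf : Measurable f) (hf0 : ∀ u, 0 ≤ f u)
    (hXf : P.map X = volume.withDensity fun u => ENNReal.ofReal (f u)) {η : Ω → ℝ}
    (hint : Integrable (fun ω => condMean P X η ω ^ 2 * f (X ω)) P)
    (hne : ¬ condMean P X η =ᵐ[P] 0) :
    0 < ∫ ω, condMean P X η ω ^ 2 * f (X ω) ∂P := by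
  have hnn : ∀ ω, 0 ≤ condMean P X η ω ^ 2 * f (X ω) := fun ω =>
    mul_nonneg (sq_nonneg _) (hf0 _)
  refine lt_of_le_of_ne (integral_nonneg hnn) fun h0 => hne ?_
  have h1 := (integral_eq_zero_iff_of_nonneg hnn hint).1 h0.symm
  have h2 : ∀ᵐ u ∂(P.map X), 0 < f u := hXf ▸ ae_withDensity_pos hf
  filter_upwards [h1, ae_of_ae_map hX.aemeasurable h2] with ω e1 e2
  have := (mul_eq_zero.1 e1).resolve_right e2.ne'
  exact pow_eq_zero_iff two_ne_zero |>.1 this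

end Population

/-! ### Consequences of the alternative -/

section Transfer

theorem lintegral_map_ne_top_of_lt {α β : Type*} [MeasurableSpace α] [MeasurableSpace β]
    {μ : Measure α} {φ : α → β} {F : β → ℝ≥0∞} (h : ∫⁻ a, F (φ a) ∂μ < ∞) :
    ∫⁻ b, F b ∂(μ.map φ) ≠ ∞ :=
  ((lintegral_map_le F φ).trans_lt h).ne

variable {p d : ℕ} {g : Vec p → Vec d → ℝ} {Ω : Type*} [MeasurableSpace Ω] {P : Measure Ω}
  [IsProbabilityMeasure P] {X : Ω → Vec p} {Y : Ω → ℝ} {θs : Vec d}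

/-- If the residual depends on the covariate and the rank of the target matrix is the dimension
of the central subspace, then `t ↦ E[X exp(i t η)]` does not vanish almost everywhere: otherwise
the target matrix would be zero, hence the central subspace trivial and the residual independent
of the covariate. -/
theorem exists_not_ae_charMoment_eq_zero (hX : Measurable X) (hY : Measurable Y)
    (hg_meas : ∀ θ, Measurable fun u => g u θ) {S : Submodule ℝ (Vec p)}
    (hS_red : IsDimensionReduction (P.map fun ω => (X ω, popResid g X Y θs ω)) S)
    (hS_rank : (targetMatrix P X (popResid g X Y θs)).rank = Module.finrank ℝ S)
    (hdep : ¬ IndepFun (popResid g X Y θs) X P) :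
    ∃ a : Fin p, ¬ ∀ᵐ (t : ℝ) ∂(P.map (popResid g X Y θs)),
      ∫ ω, ((X ω a : ℝ) : ℂ) * Complex.exp (Complex.I * t * (popResid g X Y θs ω : ℂ)) ∂P = 0 := by
  by_contra! hcon
  have hη : Measurable (popResid g X Y θs) := hY.sub ((hg_meas θs).comp hX)
  have hXη : Measurable fun ω => (X ω, popResid g X Y θs ω) := hX.prodMk hη
  have := Measure.isProbabilityMeasure_map (μ := P) hXη.aemeasurable
  rw [targetMatrix_eq_zero hcon, Matrix.rank_zero] at hS_rank
  have hbot : S = ⊥ := Submodule.finrank_eq_zero.1 hS_rank.symm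
  subst hbot
  have h1 := indepFun_of_isDimensionReduction_bot hS_red
  apply hdep
  rw [indepFun_iff_measure_inter_preimage_eq_mul] at h1 ⊢
  intro s t hs ht
  have h2 := h1 s t hs ht
  rwa [Measure.map_apply hXη ((measurable_snd hs).inter (measurable_fst ht)),
    Measure.map_apply hXη (measurable_snd hs), Measure.map_apply hXη (measurable_fst ht)] at h2

theorem integrable_sq_kernel_mul_density {ρ : Measure (Vec p × ℝ)} [IsProbabilityMeasure ρ]
    {f : Vec p → ℝ} {κ : Kernel (Vec p) ℝ} [IsMarkovKernel κ] {η : Vec p × ℝ → ℝ}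
    (hf : Measurable f) (hf0 : ∀ u, 0 ≤ f u) (hκ : ρ.map Prod.fst ⊗ₘ κ = ρ) (hη : Measurable η)
    (hη2 : MemLp η 2 ρ) (hηf : Integrable (fun z => η z ^ 2 * f z.1) ρ) :
    Integrable (fun u => (∫ t, η (u, t) ∂κ u) ^ 2 * f u) (ρ.map Prod.fst) := by
  have hm : Measurable fun u => ∫ t, η (u, t) ∂κ u :=
    hη.stronglyMeasurable.integral_kernel_prod_right'.measurable
  refine (integrable_kernel_sq_mul_density hf0 hκ hηf).mono'
    ((hm.pow_const 2).mul hf).aestronglyMeasurable ?_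
  filter_upwards [ae_memLp_kernel hκ hη hη2] with u hu
  rw [Real.norm_of_nonneg (mul_nonneg (sq_nonneg _) (hf0 u))]
  exact mul_le_mul_of_nonneg_right (sq_integral_le_integral_sq hu) (hf0 u)

end Transfer

end HybridTest

theorem mainTheorem3 {p d : ℕ} {Ω : Type*} [MeasurableSpace Ω] (P : Measure Ω)
    [IsProbabilityMeasure P]
    -- the regression model Y = G(X, ε), with ε independent of X, E X = 0, Var X finite
    (X : Ω → HybridTest.Vec p) (Y ε : Ω → ℝ) (G : HybridTest.Vec p → ℝ → ℝ)
    (hX : Measurable X) (hY : Measurable Y) (hε : Measurable ε)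
    (hG : Measurable (Function.uncurry G))
    (hXε : IndepFun X ε P) (hmodel : ∀ ω, Y ω = G (X ω) (ε ω))
    (hX2 : MemLp X 2 P) (hX0 : ∫ ω, X ω ∂P = 0)
    -- X has the density f
    (f : HybridTest.Vec p → ℝ) (hf : Measurable f) (hf0 : ∀ u, 0 ≤ f u)
    (hXf : P.map X = volume.withDensity (fun u => ENNReal.ofReal (f u)))
    -- independent and identically distributed observations of (X, Y), with E Y² finite
    (x : ℕ → Ω → HybridTest.Vec p) (y : ℕ → Ω → ℝ)
    (hindep : iIndepFun (fun j ω => (x j ω, y j ω)) P)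
    (hident : ∀ j, IdentDistrib (fun ω => (x j ω, y j ω)) (fun ω => (X ω, Y ω)) P P)
    (hY2 : MemLp Y 2 P)
    -- the parameter space and the parametric regression function
    (Θ : Set (HybridTest.Vec d)) (hΘc : IsCompact Θ) (hΘconv : Convex ℝ Θ)
    (g : HybridTest.Vec p → HybridTest.Vec d → ℝ)
    (hg_meas : ∀ θ, Measurable fun u => g u θ)
    (hg_smooth : ∀ u, ∀ θ ∈ Θ, ContDiffAt ℝ 2 (g u) θ)
    -- the moment conditions
    (hm1 : ∫⁻ ω, (⨆ θ ∈ Θ, ‖g (X ω) θ‖ₑ ^ 2) ∂P < ∞)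
    (hm2 : ∫⁻ ω, (⨆ θ ∈ Θ, ‖gradient (g (X ω)) θ‖ₑ ^ 2) ∂P < ∞)
    (hm3 : ∫⁻ ω, (⨆ θ ∈ Θ, ‖Y ω - g (X ω) θ‖ₑ ^ 2 * ‖gradient (g (X ω)) θ‖ₑ ^ 2) ∂P < ∞)
    (hm4 : ∫⁻ ω, (⨆ θ ∈ Θ, ‖Y ω - g (X ω) θ‖ₑ ^ 2 * ‖iteratedFDeriv ℝ 2 (g (X ω)) θ‖ₑ) ∂P < ∞)
    (hm5 : ∫⁻ ω, (⨆ θ ∈ Θ, ‖Y ω - g (X ω) θ‖ₑ ^ 2) * ENNReal.ofReal (f (X ω)) ∂P < ∞)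
    -- the unique minimizer θs of E{Y - g(X, θ)}², and the nonsingular matrix E(ġ ġᵀ)
    (θs : HybridTest.Vec d) (hθs : θs ∈ Θ)
    (hθs_min : ∀ θ ∈ Θ, θ ≠ θs →
      ∫ ω, (Y ω - g (X ω) θs) ^ 2 ∂P < ∫ ω, (Y ω - g (X ω) θ) ^ 2 ∂P)
    (hgram : IsUnit (HybridTest.gram P g X θs).det)
    -- the weight function; the limiting standardizing variance does not vanish
    (w : HybridTest.Vec p → ℝ) (hw : Measurable w) (hw2 : MemLp (fun ω => w (X ω)) 2 P)
    (hSigma : HybridTest.Sigma01 P g w X Y θs ≠ 0)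
    -- the central subspace S of η given X: it is a dimension reduction subspace, the linearity
    -- condition holds, and the rank of the target matrix is dim S
    (S : Submodule ℝ (HybridTest.Vec p))
    (hS : S = HybridTest.centralSubspace
      (P.map fun ω => (X ω, HybridTest.popResid g X Y θs ω)))
    (hS_red : HybridTest.IsDimensionReduction
      (P.map fun ω => (X ω, HybridTest.popResid g X Y θs ω)) S)
    (hS_lin : HybridTest.LinearityCondition P X S)
    (hS_rank : (HybridTest.targetMatrix P X (HybridTest.popResid g X Y θs)).rank =
      Module.finrank ℝ S)
    -- the kernel and the bandwidth
    (K : HybridTest.Vec p → ℝ) (hK_symm : ∀ u, K (-u) = K u) (hK_nonneg : ∀ u, 0 ≤ K u)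
    (hK_cont : Continuous K) (hK_bdd : ∃ C, ∀ u, K u ≤ C) (hK_int : ∫ u, K u = 1)
    (h : ℕ → ℝ) (hh_pos : ∀ᶠ n in atTop, 0 < h n) (hh_zero : Tendsto h atTop (𝓝 0))
    (hh_rate : Tendsto (fun n : ℕ => (n : ℝ) * h n ^ p) atTop atTop)
    -- the ridges and the threshold
    (c₁ c₂ : ℕ → ℝ) (hc_pos : ∀ᶠ n in atTop, 0 < c₁ n ∧ 0 < c₂ n)
    (hc₁ : Tendsto c₁ atTop (𝓝 0)) (hc₂ : Tendsto c₂ atTop (𝓝 0))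
    (hc_rate : Tendsto (fun n : ℕ => (n : ℝ) * c₁ n * c₂ n) atTop atTop)
    (τ : ℝ) (hτ0 : 0 < τ) (hτ1 : τ < 1)
    -- the least squares estimators
    (θhat : ℕ → Ω → HybridTest.Vec d) (hθhat_meas : ∀ n, Measurable (θhat n))
    (hθhat : ∀ n, ∀ᵐ ω ∂P,
      HybridTest.IsLeastSquares g Θ (fun j => x j ω) (fun j => y j ω) n (θhat n ω))
    -- the alternative: for no θ is Y - g(X, θ) independent of X, for no θ is E(Y | X) = g(X, θ)
    (hH1_dep : ∀ θ ∈ Θ, ¬ IndepFun (HybridTest.popResid g X Y θ) X P)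
    (hH1_mean : ∀ θ ∈ Θ, ¬ HybridTest.condMean P X (HybridTest.popResid g X Y θ) =ᵐ[P] 0) :
    0 < HybridTest.muLimit P g w f X Y θs ∧
    TendstoInMeasure P
      (fun (n : ℕ) ω =>
        HybridTest.Tn g w K (h n) (c₁ n) (c₂ n) τ (fun j => x j ω) (fun j => y j ω)
          (θhat n ω) n / (n : ℝ))
      atTop (fun _ => HybridTest.muLimit P g w f X Y θs) := by
  obtain ⟨C, hC⟩ := hK_bdd
  have hXY : Measurable fun ω => (X ω, Y ω) := hX.prodMk hY
  set ρ := P.map fun ω => (X ω, Y ω) with hρdef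
  have hρ1 : IsProbabilityMeasure ρ := Measure.isProbabilityMeasure_map hXY.aemeasurable
  have hs : HybridTest.IsIIDSample P ρ fun j ω => (x j ω, y j ω) :=
    ⟨fun j => (hident j).aemeasurable_fst, fun j => (hident j).map_eq, hindep⟩
  have hfst : ρ.map Prod.fst = P.map X := by
    rw [hρdef, Measure.map_map measurable_fst hXY]; rfl
  have hρf : ρ.map Prod.fst = volume.withDensity fun u => ENNReal.ofReal (f u) := hfst.trans hXf
  have hκ : ρ.map Prod.fst ⊗ₘ condDistrib Y X P = ρ := by
    rw [hfst]
    exact compProd_map_condDistrib hY.aemeasurable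
  have hgcont : ∀ u, ContinuousOn (g u) Θ := fun u θ hθ =>
    (hg_smooth u θ hθ).continuousAt.continuousWithinAt
  have hηm : Measurable fun z : HybridTest.Vec p × ℝ => z.2 - g z.1 θs :=
    measurable_snd.sub ((hg_meas θs).comp measurable_fst)
  -- the moment conditions, in terms of the law of `(X, Y)`
  have hy2 : ∫⁻ z, ‖z.2‖ₑ ^ 2 ∂ρ ≠ ∞ :=
    HybridTest.lintegral_map_ne_top_of_lt (F := fun z : HybridTest.Vec p × ℝ => ‖z.2‖ₑ ^ 2) (by
      simpa using (eLpNorm_lt_top_iff_lintegral_rpow_enorm_lt_top two_ne_zero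
        ENNReal.ofNat_ne_top).1 hY2.2)
  have hw2' : ∫⁻ z, ‖w z.1‖ₑ ^ 2 ∂ρ ≠ ∞ :=
    HybridTest.lintegral_map_ne_top_of_lt (F := fun z : HybridTest.Vec p × ℝ => ‖w z.1‖ₑ ^ 2) (by
      simpa using (eLpNorm_lt_top_iff_lintegral_rpow_enorm_lt_top two_ne_zero
        ENNReal.ofNat_ne_top).1 hw2.2)
  have hx1 : ∀ a, ∫⁻ z, ‖z.1 a‖ₑ ∂ρ ≠ ∞ := fun a =>
    HybridTest.lintegral_map_ne_top_of_lt (F := fun z : HybridTest.Vec p × ℝ => ‖z.1 a‖ₑ)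
      ((lintegral_mono fun ω => HybridTest.enorm_apply_le (X ω) a).trans_lt
        (hX2.integrable one_le_two).2)
  have hg2 : ∫⁻ z, ⨆ θ ∈ Θ, ‖g z.1 θ‖ₑ ^ 2 ∂ρ ≠ ∞ :=
    HybridTest.lintegral_map_ne_top_of_lt
      (F := fun z : HybridTest.Vec p × ℝ => ⨆ θ ∈ Θ, ‖g z.1 θ‖ₑ ^ 2) hm1
  have hgrad2 : ∫⁻ z, ⨆ θ ∈ Θ, ‖gradient (g z.1) θ‖ₑ ^ 2 ∂ρ ≠ ∞ :=
    HybridTest.lintegral_map_ne_top_of_lt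
      (F := fun z : HybridTest.Vec p × ℝ => ⨆ θ ∈ Θ, ‖gradient (g z.1) θ‖ₑ ^ 2) hm2
  have hSenv : HybridTest.weightedMoment ρ f (HybridTest.residEnvelope g Θ) ≠ ∞ := by
    refine HybridTest.lintegral_map_ne_top_of_lt (F := fun z : HybridTest.Vec p × ℝ =>
      HybridTest.residEnvelope g Θ z ^ 2 * ENNReal.ofReal (f z.1)) ?_
    simpa only [HybridTest.residEnvelope_sq] using hm5
  have hη2ρ : MemLp (fun z : HybridTest.Vec p × ℝ => z.2 - g z.1 θs) 2 ρ := by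
    refine ⟨hηm.aestronglyMeasurable,
      (eLpNorm_lt_top_iff_lintegral_rpow_enorm_lt_top two_ne_zero ENNReal.ofNat_ne_top).2 ?_⟩
    refine (lintegral_mono fun z => ?_).trans_lt
      (HybridTest.lintegral_residual_bound_ne_top hy2 hg2).lt_top
    simpa [enorm_pow] using HybridTest.enorm_sub_sq_le (g := g) z hθs
  have hη2 : MemLp (HybridTest.popResid g X Y θs) 2 P :=
    hη2ρ.comp_of_map hXY.aemeasurable
  have hηf : Integrable (fun z : HybridTest.Vec p × ℝ => (z.2 - g z.1 θs) ^ 2 * f z.1) ρ := by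
    refine ⟨((hηm.pow_const 2).mul (hf.comp measurable_fst)).aestronglyMeasurable,
      lt_of_le_of_lt (lintegral_mono fun z => ?_) hSenv.lt_top⟩
    rw [enorm_mul, enorm_pow, Real.enorm_of_nonneg (hf0 _)]
    gcongr
    exact HybridTest.enorm_resid_le z hθs
  have hmin : ∀ θ ∈ Θ, θ ≠ θs →
      ∫ z, (z.2 - g z.1 θs) ^ 2 ∂ρ < ∫ z, (z.2 - g z.1 θ) ^ 2 ∂ρ := by
    intro θ hθ hne
    have hm : ∀ θ, Measurable fun z : HybridTest.Vec p × ℝ => (z.2 - g z.1 θ) ^ 2 := fun θ =>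
      (measurable_snd.sub ((hg_meas θ).comp measurable_fst)).pow_const 2
    rw [hρdef, integral_map hXY.aemeasurable (hm θs).aestronglyMeasurable,
      integral_map hXY.aemeasurable (hm θ).aestronglyMeasurable]
    exact hθs_min θ hθ hne
  -- consistency of the estimators
  have hθc : Tendsto (fun q : ℕ × Ω => θhat q.1 q.2) (HybridTest.probFilter P) (𝓝[Θ] θs) :=
    HybridTest.tendsto_leastSquares hs hΘc hg_meas hg_smooth hy2 hg2 hθs hmin hθhat
  have hσ := HybridTest.tendsto_sigmaHatSq hs hg_meas hg_smooth hy2 hg2 hgrad2 hw hw2' hθs hθc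
    hX hY hρdef.symm hgram
  have hV := HybridTest.tendsto_V1 hs hf hf0 hρf hκ hK_cont hK_nonneg hC hK_int hh_pos hh_zero
    hh_rate hg_meas hgcont hθs hSenv hη2ρ hηf hθc
  have hq : ∀ᶠ q in HybridTest.probFilter P, 0 < HybridTest.qHat (c₁ q.1) (c₂ q.1) τ
      (fun j => x j q.2) (HybridTest.resid g (fun j => x j q.2) (fun j => y j q.2)
        (θhat q.1 q.2)) q.1 := by
    obtain ⟨a, ha⟩ := HybridTest.exists_not_ae_charMoment_eq_zero hX hY hg_meas hS_red hS_rank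
      (hH1_dep θs hθs)
    refine HybridTest.eventually_qHat_pos hs hg_meas hg_smooth hθs hθc (hx1 a) ?_ hc_pos hc₁ hc₂
      hτ0 hτ1
    rw [hρdef, Measure.map_map hηm hXY]
    convert ha using 4 with t
    · refine integral_map hXY.aemeasurable (Measurable.aestronglyMeasurable ?_)
      fun_prop
    · rfl
  -- the limit of the kernel estimator is the numerator of `μ`
  have hcond := HybridTest.condMean_popResid_ae_eq (θ := θs) hX hY (hg_meas θs)
    (hη2.integrable one_le_two)
  have hint := HybridTest.integrable_sq_kernel_mul_density hf hf0 hκ hηm hη2ρ hηf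
  have hce : (fun ω => HybridTest.condMean P X (HybridTest.popResid g X Y θs) ω ^ 2 * f (X ω))
      =ᵐ[P] fun ω => (∫ t, (t - g (X ω) θs) ∂(condDistrib Y X P (X ω))) ^ 2 * f (X ω) := by
    filter_upwards [hcond] with ω hω
    rw [hω]
  rw [hfst] at hint
  have hnum : ∫ u, (∫ t, (t - g u θs) ∂(condDistrib Y X P u)) ^ 2 * f u ∂(ρ.map Prod.fst) =
      ∫ ω, HybridTest.condMean P X (HybridTest.popResid g X Y θs) ω ^ 2 * f (X ω) ∂P := by
    rw [hfst, integral_congr_ae hce]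
    exact integral_map hX.aemeasurable hint.1
  have hpos := HybridTest.integral_condMean_sq_pos hX hf hf0 hXf
    (((integrable_map_measure hint.1 hX.aemeasurable).1 hint).congr hce.symm)
    (hH1_mean θs hθs)
  have hgrad : ∀ a, MemLp (fun ω => gradient (g (X ω)) θs a) 2 P := by
    intro a
    refine ⟨((HybridTest.measurable_gradient_apply hg_meas hg_smooth hθs a).comp
      hX).aestronglyMeasurable,
      (eLpNorm_lt_top_iff_lintegral_rpow_enorm_lt_top two_ne_zero ENNReal.ofNat_ne_top).2 ?_⟩
    refine lt_of_le_of_lt (lintegral_mono fun ω => ?_) hm2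
    simp only [ENNReal.toReal_ofNat, ENNReal.rpow_ofNat]
    exact (pow_le_pow_left' (HybridTest.enorm_apply_le _ a) 2).trans
      (le_iSup₂ (f := fun θ (_ : θ ∈ Θ) => ‖gradient (g (X ω)) θ‖ₑ ^ 2) θs hθs)
  have hSigpos : 0 < HybridTest.Sigma01 P g w X Y θs :=
    lt_of_le_of_ne (HybridTest.Sigma01_nonneg hgrad hw2 hgram) hSigma.symm
  refine ⟨div_pos hpos hSigpos, HybridTest.tendstoInMeasure_const_iff.2 ?_⟩
  rw [hnum] at hV
  have hlim := hV.abs.div hσ hSigma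
  rw [abs_of_pos hpos] at hlim
  refine hlim.congr' ?_
  filter_upwards [hq, HybridTest.tendsto_fst_probFilter.eventually (eventually_gt_atTop 0)]
    with a ha hn
  have hn' : (a.1 : ℝ) ≠ 0 := by exact_mod_cast hn.ne'
  simp only [HybridTest.Tn, HybridTest.Vn, if_neg ha.ne', if_pos ha, mul_zero, mul_one, zero_add]
  simp only [Pi.div_apply]
  field_simp
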